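/- Let $n\ge 5$ be an integer, $A=\frac{n(n-4)+8}{2}$ and $B=\frac{n^2(n-4)^2}{16}$. Let $g\in C^1((0,\infty))$ satisfy $g>0$ on $(0,\infty)$, $\lim_{t\to0+}g(t)=0$, $$\frac{g(t)}{t}<g'(t)\le\frac{n+4}{n-4}\,\frac{g(t)}{t}\quad\text{for all }t>0,$$ assume that the limit $\beta:=\lim_{t\to0+}g'(t)$ exists and satisfies $\beta<\frac{n^2(n-4)^2}{16}$, and assume that $g(t)\ge c\,t^q$ for all $t\ge1$, for some $q>1$ and $c>0$. Consider the equation $$v''''-Av''+Bv=g(v)\quad\text{on }\mathbb R.\qquad(*)$$ **Theorem 1.2 (Classification of ODE solutions).** Every positive solution $v\in C^4(\mathbb R)$ of $(*)$ is constant, or homoclinic to zero (that is, $v,v',v'',v'''\to0$ as $|t|\to\infty$), or periodic. Moreover: (i) There is a unique $a_0>0$ with $g(a_0)=Ba_0$. If $v\in C^4(\mathbb R)$ is a positive solution of $(*)$, then $\inf_{\mathbb R}v\le a_0$, with equality if and only if $v$ is a non-zero constant. (ii) For every $a\in(0,a_0)$ there is a bounded solution $v\in C^4(\mathbb R)$ of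 $(*)$ with $\inf_{\mathbb R}v=a$, and it is unique up to translations. It is periodic with a minimal period $L>0$, has exactly one local maximum point and exactly one local minimum point in every interval $[x,x+L)$, and is symmetric with respect to each of its local extrema. (iii) There is a positive solution $v\in C^4(\mathbb R)$ of $(*)$ with $\inf_{\mathbb R}v=0$, and it is unique up to translations. It is homoclinic to zero. After a suitable translation it is even and strictly decreasing on $[0,\infty)$, and this translate, still denoted by $v$, has the following properties. Let $\mu=\frac12\bigl(A-\sqrt{A^2-4(B-\beta)}\bigr)$. For every $\epsilon>0$ there is a $C_\epsilon<\infty$ such that $v(t)\le C_\epsilon e^{-(\sqrt\mu-\epsilon)|t|}$ for all $t\in\mathbb R$. If, in addition, there are $r>1$ and $C<\infty$ with $|g(t)-\beta t|\le C\,t^r$ for all $0<t\le1$, then $\lim_{|t|\to\infty}e^{\sqrt\mu\,|t|}v(t)$ exists and is finite; if moreover $g(t)\ge\beta t$ for all $t>0$, then this limit is positive. -/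

import Mathlib

open Set Filter Topology

noncomputable section

/-- The coefficient `A = (n(n-4)+8)/2` of the fourth order equation. -/
def coeffA (n : ℕ) : ℝ := ((n : ℝ) * ((n : ℝ) - 4) + 8) / 2

/-- The coefficient `B = n²(n-4)²/16` of the fourth order equation. -/
def coeffB (n : ℕ) : ℝ := (n : ℝ) ^ 2 * ((n : ℝ) - 4) ^ 2 / 16

/-- The assumptions on the nonlinearity `g`, with `β = lim_{t → 0+} g'(t)`. Only the values of `g`
on `(0, ∞)` matter. -/
structure GrowthConditions (n : ℕ) (g : ℝ → ℝ) (β : ℝ) : Prop where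
  contDiffOn : ContDiffOn ℝ 1 g (Ioi 0)
  pos : ∀ t : ℝ, 0 < t → 0 < g t
  tendsto_zero : Tendsto g (𝓝[>] 0) (𝓝 0)
  lt_deriv : ∀ t : ℝ, 0 < t → g t / t < deriv g t
  deriv_le : ∀ t : ℝ, 0 < t → deriv g t ≤ ((n : ℝ) + 4) / ((n : ℝ) - 4) * (g t / t)
  tendsto_deriv : Tendsto (deriv g) (𝓝[>] 0) (𝓝 β)
  beta_lt : β < (n : ℝ) ^ 2 * ((n : ℝ) - 4) ^ 2 / 16
  superlinear : ∃ q c : ℝ, 1 < q ∧ 0 < c ∧ ∀ t : ℝ, 1 ≤ t → c * t ^ q ≤ g t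

/-- `v ∈ C⁴(ℝ)` solves `v'''' - A v'' + B v = g(v)` on `ℝ`. -/
def IsODESolution (n : ℕ) (g : ℝ → ℝ) (v : ℝ → ℝ) : Prop :=
  ContDiff ℝ 4 v ∧
    ∀ t : ℝ, iteratedDeriv 4 v t - coeffA n * iteratedDeriv 2 v t + coeffB n * v t = g (v t)

/-- `v ∈ C⁴(ℝ)` is a positive solution. -/
def IsPositiveSolution (n : ℕ) (g : ℝ → ℝ) (v : ℝ → ℝ) : Prop :=
  IsODESolution n g v ∧ ∀ t : ℝ, 0 < v t

/-- `v` is homoclinic to zero: `(v, v', v'', v''')(t) → 0` as `|t| → ∞`. -/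
def HomoclinicToZero (v : ℝ → ℝ) : Prop :=
  ∀ k : ℕ, k ≤ 3 → Tendsto (iteratedDeriv k v) (cocompact ℝ) (𝓝 0)

/-- `w` is a translate of `v`. -/
def IsTranslate (v w : ℝ → ℝ) : Prop := ∃ τ : ℝ, ∀ t : ℝ, w t = v (t + τ)

/-- `L` is the minimal positive period of `v`. -/
def IsMinimalPeriod (v : ℝ → ℝ) (L : ℝ) : Prop :=
  IsLeast {P : ℝ | 0 < P ∧ Function.Periodic v P} L

/-- `μ = (A - √(A² - 4(B - β)))/2`. -/
def muExp (n : ℕ) (β : ℝ) : ℝ :=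
  (coeffA n - Real.sqrt (coeffA n ^ 2 - 4 * (coeffB n - β))) / 2

end

/-! With a = (n-4)/2 and b = n/2 one has A = a² + b² and B = a²b², so the operator factors as (D² -
a²)(D² - b²). Setting z = v'' - a²v turns the equation into v'' = a²v + z, z'' = b²z + g(v). Since g
increases, this system is cooperative: an ordering of the data (v, v', z, z') of two solutions
persists forward in time, and their difference is unbounded above unless the data agree
(`IsSol.data_eq_of_ordered`). Exchanging the two solutions and reversing time always orders the
remaining data once v and v' agree, so a bounded solution is determined by (v, v') at one point
(`IsSol.eq_of_bounded`).

The classification follows from this planar picture. A bounded positive solution is symmetric about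
each critical point, so two critical points make it periodic and exactly one makes it homoclinic to
zero; a monotone one would converge to a₀ and be constant (`PosSol.trichotomy`). Every positive
solution is bounded: z > 0 somewhere would cause finite time blow-up, z ≤ 0 gives the Harnack
inequality |v'| ≤ a v, and superlinearity then gives a universal bound M. Hence g may be replaced by
a globally Lipschitz function agreeing with it on (0, M].

For a minimum α < a₀, shooting in v''(0) gives existence (`Admissible.exists_posSol`): the smallest
parameter whose solution stays nonnegative works, since the energy forbids touching zero and
minimality forces z ≤ 0. Centring these solutions at their maxima and letting α → 0 gives the
homoclinic one. Its uniqueness (`PosSol.homoclinic_le`) compares slopes at equal heights: the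
solution with the higher peak is always the steeper one, and at an inflection point of the other
this contradicts the energy identity combined with the cone inequality.

For the decay, the operator is refactored with the exponents √μ and τ of the linearization at zero,
the nonlinearity becoming g(v) - βv. Upper barriers for the two factors bound exp(√μ t) v, and the
Harnack inequality for the new factorization makes this quantity monotone
(`PosSol.exists_limit_exp_mul`). -/

noncomputable section

/-! ### Global flow of a Lipschitz vector field -/

/-- Coordinatewise truncation to the cube `[-R, R]^ι`. -/
def cubeClamp {ι : Type*} (R : ℝ) (x : ι → ℝ) : ι → ℝ := fun i => max (-R) (min R (x i))

lemma lipschitzWith_cubeClamp {ι : Type*} [Fintype ι] (R : ℝ) :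
    LipschitzWith 1 (cubeClamp R : (ι → ℝ) → ι → ℝ) := by
  refine LipschitzWith.of_dist_le_mul fun x y => ?_
  rw [NNReal.coe_one, one_mul]
  refine (dist_pi_le_iff dist_nonneg).2 fun i => ?_
  refine le_trans ?_ (dist_le_pi_dist x y i)
  simp only [cubeClamp, Real.dist_eq]
  refine (abs_max_sub_max_le_max _ _ _ _).trans ?_
  rw [sub_self, abs_zero, max_eq_right (abs_nonneg _)]
  refine (abs_min_sub_min_le_max _ _ _ _).trans ?_
  rw [sub_self, abs_zero, max_eq_right (abs_nonneg _)]

lemma norm_cubeClamp_le {ι : Type*} [Fintype ι] {R : ℝ} (hR : 0 ≤ R) (x : ι → ℝ) :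
    ‖cubeClamp R x‖ ≤ R := by
  refine (pi_norm_le_iff_of_nonneg hR).2 fun i => ?_
  rw [Real.norm_eq_abs, abs_le]
  exact ⟨le_max_left _ _, max_le (by linarith) (min_le_left _ _)⟩

lemma cubeClamp_eq_self {ι : Type*} [Fintype ι] {R : ℝ} {x : ι → ℝ} (hx : ‖x‖ ≤ R) :
    cubeClamp R x = x := by
  funext i
  have h := (norm_le_pi_norm x i).trans hx
  rw [Real.norm_eq_abs, abs_le] at h
  simp only [cubeClamp]
  rw [min_eq_right h.2, max_eq_right h.1]

lemma norm_cubeClamp_le_norm {ι : Type*} [Fintype ι] {R : ℝ} (hR : 0 ≤ R) (x : ι → ℝ) :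
    ‖cubeClamp R x‖ ≤ ‖x‖ := by
  refine (pi_norm_le_iff_of_nonneg (norm_nonneg _)).2 fun i => ?_
  have h := norm_le_pi_norm x i
  rw [Real.norm_eq_abs, abs_le] at h
  rw [Real.norm_eq_abs, abs_le, cubeClamp]
  constructor
  · rcases le_total R (x i) with h1 | h1
    · rw [min_eq_left h1]; exact le_max_of_le_right (by linarith [norm_nonneg x])
    · rw [min_eq_right h1]; exact le_max_of_le_right h.1
  · exact max_le (by linarith [norm_nonneg x]) ((min_le_right _ _).trans h.2)

/-- Only affine growth of the field enters, so the bound survives truncation of the field. Negative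
times are handled by reversing time. -/
lemma norm_le_gronwallBound_of_lipschitz {E : Type*} [NormedAddCommGroup E] [NormedSpace ℝ E]
    {F : E → E} {C T : ℝ} (hC : 0 ≤ C)
    (hF : ∀ x, ‖F x‖ ≤ C * ‖x‖ + C) {x : ℝ → E}
    (hx : ∀ t ∈ Icc (-T) T, HasDerivWithinAt x (F (x t)) (Icc (-T) T) t) :
    ∀ t ∈ Icc (-T) T, ‖x t‖ ≤ gronwallBound ‖x 0‖ C C T := by
  intro t ht
  have hT : 0 ≤ T := by have := ht.1.trans ht.2; linarith
  have hcont : ContinuousOn x (Icc (-T) T) := fun s hs => (hx s hs).continuousWithinAt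
  have hmono := gronwallBound_mono (norm_nonneg (x 0)) hC hC
  rcases le_total 0 t with h0 | h0
  · have := norm_le_gronwallBound_of_norm_deriv_right_le (f := x) (f' := fun s => F (x s))
      (δ := ‖x 0‖) (K := C) (ε := C) (a := 0) (b := T)
      (hcont.mono (Icc_subset_Icc (by linarith) le_rfl))
      (fun s hs => (hx s ⟨by linarith [hs.1], hs.2.le⟩).mono_of_mem_nhdsWithin
        (mem_of_superset (Ico_mem_nhdsGE hs.2) fun y hy => ⟨by linarith [hy.1, hs.1], hy.2.le⟩))
      le_rfl (fun s _ => hF _) t ⟨h0, ht.2⟩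
    exact this.trans (hmono (by linarith [ht.2]))
  · have hneg : ∀ s ∈ Icc (0:ℝ) T, HasDerivWithinAt (fun r => x (-r)) (-F (x (-s))) (Icc 0 T) s := by
      intro s hs
      have h1 := hx (-s) ⟨by linarith [hs.2], by linarith [hs.1]⟩
      have h2 : HasDerivWithinAt (fun r : ℝ => -r) (-1) (Icc 0 T) s := (hasDerivAt_neg s).hasDerivWithinAt
      have h3 := HasDerivWithinAt.scomp s h1 h2
        (fun r hr => ⟨by linarith [hr.2], by linarith [hr.1]⟩)
      simpa [Function.comp_def] using h3
    have := norm_le_gronwallBound_of_norm_deriv_right_le (f := fun r => x (-r))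
      (f' := fun s => -F (x (-s)))
      (δ := ‖x 0‖) (K := C) (ε := C) (a := 0) (b := T)
      (fun s hs => (hneg s hs).continuousWithinAt)
      (fun s hs => (hneg s ⟨hs.1, hs.2.le⟩).mono_of_mem_nhdsWithin
        (mem_of_superset (Ico_mem_nhdsGE hs.2) fun y hy => ⟨by linarith [hy.1, hs.1], hy.2.le⟩))
      (by simp) (fun s _ => by rw [norm_neg]; exact hF _) (-t) ⟨by linarith, by linarith [ht.1]⟩
    simp only [neg_neg] at this
    exact this.trans (hmono (by linarith [ht.1]))

lemma exists_solution_Icc {ι : Type*} [Fintype ι] {F : (ι → ℝ) → ι → ℝ} {K : NNReal}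
    (hF : LipschitzWith K F) (x0 : ι → ℝ) {T : ℝ} (hT : 0 ≤ T) :
    ∃ x : ℝ → ι → ℝ, x 0 = x0 ∧
      ∀ t ∈ Icc (-T) T, HasDerivWithinAt x (F (x t)) (Icc (-T) T) t := by
  set C : ℝ := max K ‖F 0‖
  have hC : 0 ≤ C := le_max_of_le_left K.2
  have hgrow : ∀ x, ‖F x‖ ≤ C * ‖x‖ + C := by
    intro x
    have h1 := hF.dist_le_mul x 0
    rw [dist_eq_norm, dist_zero_right] at h1
    have h2 : ‖F x‖ ≤ ‖F x - F 0‖ + ‖F 0‖ := by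
      simpa using norm_add_le (F x - F 0) (F 0)
    have h3 : (K:ℝ) * ‖x‖ ≤ C * ‖x‖ := mul_le_mul_of_nonneg_right (le_max_left _ _) (norm_nonneg _)
    have h4 : ‖F 0‖ ≤ C := le_max_right _ _
    linarith
  -- The field composed with the truncation to the cube of side R is bounded, so Picard–Lindelöf
  -- applies on all of [-T, T]. The truncation does not increase norms, so the Gronwall bound R
  -- still holds for its solution, which therefore never feels the truncation.
  set R : ℝ := max 0 (gronwallBound ‖x0‖ C C T)
  have hR : 0 ≤ R := le_max_left _ _
  have hlip : LipschitzWith K (fun x => F (cubeClamp R x)) := by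
    simpa [Function.comp_def] using hF.comp (lipschitzWith_cubeClamp R)
  have hbd : ∀ x, ‖F (cubeClamp R x)‖ ≤ C * R + C := fun x =>
    (hgrow _).trans (by gcongr; exact norm_cubeClamp_le hR x)
  have hpos : 0 ≤ C * R + C := by positivity
  have hpl : IsPicardLindelof (fun _ x => F (cubeClamp R x))
      (⟨0, by constructor <;> linarith⟩ : Icc (-T) T) x0
      (⟨(C * R + C) * T, by positivity⟩ : NNReal) 0 ⟨C * R + C, hpos⟩ K := by
    refine ⟨fun _ _ => hlip.lipschitzOnWith, fun _ _ => continuousOn_const, fun _ _ x _ => hbd x, ?_⟩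
    change (C * R + C) * max (T - 0) (0 - -T) ≤ (C * R + C) * T - 0
    simp
  obtain ⟨x, hx0, hx⟩ := hpl.exists_eq_forall_mem_Icc_hasDerivWithinAt₀
  have hx0' : x 0 = x0 := hx0
  refine ⟨x, hx0', fun t ht => ?_⟩
  have hb := norm_le_gronwallBound_of_lipschitz (F := fun x => F (cubeClamp R x)) hC
    (fun x => (hgrow _).trans (by gcongr; exact norm_cubeClamp_le_norm hR x)) hx t ht
  rw [hx0'] at hb
  have := hx t ht
  rwa [cubeClamp_eq_self (hb.trans (le_max_right _ _))] at this

/-- A globally Lipschitz autonomous vector field has global integral curves. -/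
theorem exists_global_solution {ι : Type*} [Fintype ι] {F : (ι → ℝ) → ι → ℝ} {K : NNReal}
    (hF : LipschitzWith K F) (x0 : ι → ℝ) :
    ∃ x : ℝ → ι → ℝ, x 0 = x0 ∧ ∀ t, HasDerivAt x (F (x t)) t := by
  choose y hy0 hy using fun n : ℕ => exists_solution_Icc hF x0 (Nat.cast_nonneg n)
  have hagree : ∀ m n : ℕ, m ≤ n → ∀ t ∈ Icc (-(m:ℝ)) m, y m t = y n t := by
    intro m n hmn t ht
    rcases Nat.eq_zero_or_pos m with rfl | hm
    · have : t = 0 := by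
        have h1 := ht.1; have h2 := ht.2; simp at h1 h2; linarith
      rw [this, hy0, hy0]
    have hm' : (0:ℝ) < m := Nat.cast_pos.2 hm
    have hmn' : (m:ℝ) ≤ n := Nat.cast_le.2 hmn
    have hsub : Icc (-(m:ℝ)) m ⊆ Icc (-(n:ℝ)) n := Icc_subset_Icc (by linarith) hmn'
    refine ODE_solution_unique_of_mem_Icc (v := fun _ => F) (s := fun _ => univ) (K := K)
      (a := -(m:ℝ)) (b := m) (t₀ := 0) (fun _ _ => hF.lipschitzOnWith) ⟨by linarith, hm'⟩
      (fun s hs => (hy m s hs).continuousWithinAt)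
      (fun s hs => (hy m s (Ioo_subset_Icc_self hs)).hasDerivAt (Icc_mem_nhds hs.1 hs.2))
      (fun _ _ => mem_univ _)
      (fun s hs => ((hy n s (hsub hs)).mono hsub).continuousWithinAt)
      (fun s hs => ((hy n s (hsub (Ioo_subset_Icc_self hs))).mono hsub).hasDerivAt
        (Icc_mem_nhds hs.1 hs.2))
      (fun _ _ => mem_univ _) (by rw [hy0, hy0]) ht
  refine ⟨fun t => y ⌈|t|⌉₊ t, by simp [hy0], fun t => ?_⟩
  -- The extra 1 puts t in the interior of [-N, N] even when |t| is an integer, so the derivative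
  -- there is two-sided.
  set N : ℕ := ⌈|t|⌉₊ + 1
  have hlt : |t| < N := by
    have := Nat.le_ceil |t|
    simp only [N]; push_cast; linarith
  have hnear : ∀ s ∈ Ioo (-(N:ℝ)) N, y ⌈|s|⌉₊ s = y N s := by
    intro s hs
    refine hagree _ _ (Nat.ceil_le.2 (abs_lt.2 ⟨hs.1, hs.2⟩).le) s ?_
    have := Nat.le_ceil |s|
    exact abs_le.1 this
  have ht : t ∈ Ioo (-(N:ℝ)) N := abs_lt.1 hlt
  have hd := (hy N t (Ioo_subset_Icc_self ht)).hasDerivAt (Icc_mem_nhds ht.1 ht.2)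
  simp only [hnear t ht]
  exact hd.congr_of_eventuallyEq (by
    filter_upwards [Ioo_mem_nhds ht.1 ht.2] with s hs using hnear s hs)

/-- Continuous dependence on the initial value. -/
lemma dist_le_of_lipschitz_field {ι : Type*} [Fintype ι] {F : (ι → ℝ) → ι → ℝ} {K : NNReal}
    (hF : LipschitzWith K F) {x y : ℝ → ι → ℝ} (hx : ∀ t, HasDerivAt x (F (x t)) t)
    (hy : ∀ t, HasDerivAt y (F (y t)) t) {t : ℝ} (ht : 0 ≤ t) :
    dist (x t) (y t) ≤ dist (x 0) (y 0) * Real.exp (K * t) := by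
  have := dist_le_of_trajectories_ODE (v := fun _ => F) (K := K) (f := x) (g := y) (a := 0) (b := t)
    (δ := dist (x 0) (y 0)) (fun _ => hF)
    (fun s _ => (hx s).continuousAt.continuousWithinAt) (fun s _ => (hx s).hasDerivWithinAt)
    (fun s _ => (hy s).continuousAt.continuousWithinAt) (fun s _ => (hy s).hasDerivWithinAt)
    le_rfl t ⟨ht, le_rfl⟩
  simpa using this
end

/-! ### Differential inequalities and the positivity cone -/

noncomputable section

lemma le_of_hasDerivAt_nonneg {φ φ' : ℝ → ℝ} (h : ∀ t, HasDerivAt φ (φ' t) t) {s t : ℝ}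
    (hst : s ≤ t) (hn : ∀ r ∈ Ioo s t, 0 ≤ φ' r) : φ s ≤ φ t := by
  have hc : ContinuousOn φ (Icc s t) := fun r _ => (h r).continuousAt.continuousWithinAt
  refine monotoneOn_of_deriv_nonneg (convex_Icc s t) hc
    (fun r _ => (h r).differentiableAt.differentiableWithinAt) (fun r hr => ?_)
    (left_mem_Icc.2 hst) (right_mem_Icc.2 hst) hst
  rw [interior_Icc] at hr
  rw [(h r).deriv]
  exact hn r hr

lemma le_of_hasDerivAt_nonpos {φ φ' : ℝ → ℝ} (h : ∀ t, HasDerivAt φ (φ' t) t) {s t : ℝ}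
    (hst : s ≤ t) (hn : ∀ r ∈ Ioo s t, φ' r ≤ 0) : φ t ≤ φ s := by
  have := le_of_hasDerivAt_nonneg (φ := fun r => -φ r) (φ' := fun r => -φ' r)
    (fun r => (h r).neg) hst (fun r hr => by linarith [hn r hr])
  linarith

lemma hasDerivAt_const_mul_self (k t : ℝ) : HasDerivAt (fun s : ℝ => k * s) k t := by
  simpa using (hasDerivAt_id t).const_mul k

lemma add_mul_le_of_hasDerivAt_ge {φ φ' : ℝ → ℝ} (h : ∀ t, HasDerivAt φ (φ' t) t) {s t c : ℝ}
    (hst : s ≤ t) (hn : ∀ r ∈ Ioo s t, c ≤ φ' r) : φ s + c * (t - s) ≤ φ t := by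
  have := le_of_hasDerivAt_nonneg (φ := fun r => φ r - c * r) (φ' := fun r => φ' r - c)
    (fun r => (h r).sub (hasDerivAt_const_mul_self c r)) hst (fun r hr => by linarith [hn r hr])
  linarith

lemma le_add_mul_of_hasDerivAt_le {φ φ' : ℝ → ℝ} (h : ∀ t, HasDerivAt φ (φ' t) t) {s t c : ℝ}
    (hst : s ≤ t) (hn : ∀ r ∈ Ioo s t, φ' r ≤ c) : φ t ≤ φ s + c * (t - s) := by
  have := le_of_hasDerivAt_nonneg (φ := fun r => c * r - φ r) (φ' := fun r => c - φ' r)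
    (fun r => (hasDerivAt_const_mul_self c r).sub (h r)) hst (fun r hr => by linarith [hn r hr])
  linarith

lemma hasDerivAt_exp_mul (k t : ℝ) :
    HasDerivAt (fun s : ℝ => Real.exp (k * s)) (k * Real.exp (k * t)) t := by
  have := (hasDerivAt_const_mul_self k t).exp
  rwa [mul_comm] at this

/-- If `φ' ≥ k φ` then `exp (-k t) φ` is nondecreasing. -/
lemma exp_mul_le_exp_mul {φ φ' : ℝ → ℝ} (h : ∀ t, HasDerivAt φ (φ' t) t) {k s t : ℝ}
    (hst : s ≤ t) (hn : ∀ r ∈ Ioo s t, k * φ r ≤ φ' r) :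
    Real.exp (-k * s) * φ s ≤ Real.exp (-k * t) * φ t := by
  refine le_of_hasDerivAt_nonneg (fun r => (hasDerivAt_exp_mul (-k) r).mul (h r)) hst fun r hr => ?_
  have h1 := hn r hr
  have h2 := Real.exp_pos (-k * r)
  nlinarith

lemma nonneg_of_deriv_ge {φ φ' : ℝ → ℝ} (h : ∀ t, HasDerivAt φ (φ' t) t) {k s t : ℝ}
    (hst : s ≤ t) (hn : ∀ r ∈ Ioo s t, k * φ r ≤ φ' r) (h0 : 0 ≤ φ s) : 0 ≤ φ t := by
  have h1 := exp_mul_le_exp_mul h hst hn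
  have h2 : 0 ≤ Real.exp (-k * s) * φ s := by positivity
  exact nonneg_of_mul_nonneg_right (h2.trans h1) (Real.exp_pos _)

/-- The solutions of `z'' ≥ k² z` with nonnegative Cauchy data stay nonnegative and
nondecreasing. -/
lemma nonneg_of_second_deriv_ge {z z1 z2 : ℝ → ℝ} (h0 : ∀ t, HasDerivAt z (z1 t) t)
    (h1 : ∀ t, HasDerivAt z1 (z2 t) t) {k s t : ℝ} (hk : 0 ≤ k) (hst : s ≤ t)
    (hn : ∀ r ∈ Ioo s t, k ^ 2 * z r ≤ z2 r) (hz : 0 ≤ z s) (hz1 : 0 ≤ z1 s) :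
    0 ≤ z t ∧ 0 ≤ z1 t := by
  -- Factor D² - k² = (D - k)(D + k): y = z' + kz satisfies y' ≥ ky, and then z' ≥ -kz.
  have hy : ∀ u ∈ Icc s t, 0 ≤ z1 u + k * z u := by
    intro u hu
    refine nonneg_of_deriv_ge (φ := fun r => z1 r + k * z r) (φ' := fun r => z2 r + k * z1 r)
      (k := k) (fun r => (h1 r).add ((h0 r).const_mul k)) hu.1 (fun r hr => ?_) (by positivity)
    have := hn r ⟨hr.1, hr.2.trans_le hu.2⟩
    nlinarith
  have hzt : ∀ u ∈ Icc s t, 0 ≤ z u := by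
    intro u hu
    refine nonneg_of_deriv_ge (k := -k) h0 hu.1 (fun r hr => ?_) hz
    have := hy r ⟨hr.1.le, hr.2.le.trans hu.2⟩
    linarith
  refine ⟨hzt t ⟨hst, le_rfl⟩, hz1.trans (le_of_hasDerivAt_nonneg h1 hst fun r hr => ?_)⟩
  have h2 := hn r hr
  have h3 := hzt r ⟨hr.1.le, hr.2.le⟩
  have : 0 ≤ k ^ 2 * z r := by positivity
  linarith

/-- Positivity cone for the system `w'' ≥ a² w + z`, `z'' = b² z + r`, with `w` initially
positive. -/
lemma cone_of_pos {a b : ℝ} (ha : 0 ≤ a) (hb : 0 ≤ b) {w w1 w2 z z1 r : ℝ → ℝ}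
    (hw : ∀ t, HasDerivAt w (w1 t) t) (hw1 : ∀ t, HasDerivAt w1 (w2 t) t)
    (hw2 : ∀ t, a ^ 2 * w t + z t ≤ w2 t)
    (hz : ∀ t, HasDerivAt z (z1 t) t) (hz1 : ∀ t, HasDerivAt z1 (b ^ 2 * z t + r t) t)
    (hr : ∀ t, 0 ≤ t → 0 ≤ w t → 0 ≤ r t)
    (w_pos : 0 < w 0) (w1_nonneg : 0 ≤ w1 0) (z_nonneg : 0 ≤ z 0) (z1_nonneg : 0 ≤ z1 0) :
    ∀ t, 0 ≤ t → 0 ≤ w t ∧ 0 ≤ w1 t ∧ 0 ≤ z t ∧ 0 ≤ z1 t := by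
  have key : ∀ t, 0 ≤ t → (∀ s ∈ Ioo 0 t, 0 ≤ w s) →
      0 ≤ w t ∧ 0 ≤ w1 t ∧ 0 ≤ z t ∧ 0 ≤ z1 t := by
    intro t ht hs
    have hzs : ∀ s ∈ Icc 0 t, 0 ≤ z s ∧ 0 ≤ z1 s := fun s hs' =>
      nonneg_of_second_deriv_ge hz hz1 hb hs'.1 (fun u hu => by
        have := hr u hu.1.le (hs u ⟨hu.1, hu.2.trans_le hs'.2⟩); linarith) z_nonneg z1_nonneg
    have hwt := nonneg_of_second_deriv_ge hw hw1 ha ht (fun u hu => by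
        have := (hzs u ⟨hu.1.le, hu.2.le⟩).1; linarith [hw2 u]) w_pos.le w1_nonneg
    exact ⟨hwt.1, hwt.2, hzs t ⟨ht, le_rfl⟩⟩
  have hcont : Continuous w := continuous_iff_continuousAt.2 fun t => (hw t).continuousAt
  have hpos : ∀ t, 0 ≤ t → 0 < w t := by
    by_contra! hcon
    obtain ⟨t0, ht0, hwt0⟩ := hcon
    set S : Set ℝ := Ici 0 ∩ w ⁻¹' Iic 0
    have hScl : IsClosed S := isClosed_Ici.inter (isClosed_Iic.preimage hcont)
    -- At the first time T with w ≤ 0, `key` gives w' ≥ 0 on (0, T), hence w(T) ≥ w(0) > 0, a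
    -- contradiction.
    have hSb : BddBelow S := ⟨0, fun x hx => hx.1⟩
    have hT : sInf S ∈ S := hScl.csInf_mem ⟨t0, ht0, hwt0⟩ hSb
    set T := sInf S
    have hlt : ∀ s ∈ Ico 0 T, 0 < w s := by
      intro s hs
      by_contra! h
      exact absurd (csInf_le hSb ⟨hs.1, h⟩) (not_le.2 hs.2)
    have hmono : w 0 ≤ w T := le_of_hasDerivAt_nonneg hw hT.1 fun s hs =>
      (key s hs.1.le fun u hu => (hlt u ⟨hu.1.le, hu.2.trans hs.2⟩).le).2.1
    have : w T ≤ 0 := hT.2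
    linarith
  exact fun t ht => key t ht fun s hs => (hpos s hs.1.le).le

lemma nonneg_of_forall_pos_add_mul {x c : ℝ} (h : ∀ ε > 0, 0 ≤ x + ε * c) : 0 ≤ x := by
  have h1 : Tendsto (fun ε : ℝ => x + ε * c) (𝓝[>] 0) (𝓝 (x + 0 * c)) :=
    tendsto_nhdsWithin_of_tendsto_nhds (by fun_prop : Continuous fun ε : ℝ => x + ε * c).continuousAt
  rw [zero_mul, add_zero] at h1
  exact ge_of_tendsto h1 (eventually_mem_nhdsWithin.mono fun ε hε => h ε hε)

/-- Positivity cone for the system `w'' ≥ a² w + z`, `z'' = b² z + r`, where `r` is nonnegative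
where `w` is, and controlled by `w` where `w` is negative. -/
lemma cone_nonneg {a b K : ℝ} (ha : 0 ≤ a) (hb : 0 ≤ b) (hK : 0 ≤ K) {w w1 w2 z z1 r : ℝ → ℝ}
    (hw : ∀ t, HasDerivAt w (w1 t) t) (hw1 : ∀ t, HasDerivAt w1 (w2 t) t)
    (hw2 : ∀ t, a ^ 2 * w t + z t ≤ w2 t)
    (hz : ∀ t, HasDerivAt z (z1 t) t) (hz1 : ∀ t, HasDerivAt z1 (b ^ 2 * z t + r t) t)
    (hr : ∀ t, 0 ≤ t → 0 ≤ w t → 0 ≤ r t) (hr' : ∀ t, 0 ≤ t → w t ≤ 0 → K * w t ≤ r t)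
    (w_nonneg : 0 ≤ w 0) (w1_nonneg : 0 ≤ w1 0) (z_nonneg : 0 ≤ z 0) (z1_nonneg : 0 ≤ z1 0) :
    ∀ t, 0 ≤ t → 0 ≤ w t ∧ 0 ≤ w1 t ∧ 0 ≤ z t ∧ 0 ≤ z1 t := by
  -- The solution is perturbed by ε exp(mt) times a vector inside the cone, so that `cone_of_pos`
  -- applies. With this m, (m² - a²)(m² - b²) ≥ K, so the source gained by the perturbation absorbs
  -- the possible loss K w ≥ -Kε exp(mt) where -ε exp(mt) ≤ w ≤ 0. Then ε → 0.
  set m : ℝ := Real.sqrt (a ^ 2 + b ^ 2 + K + 1)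
  have hm : m ^ 2 = a ^ 2 + b ^ 2 + K + 1 := Real.sq_sqrt (by positivity)
  have hm0 : 0 ≤ m := Real.sqrt_nonneg _
  have hma : 0 ≤ m ^ 2 - a ^ 2 := by rw [hm]; linarith [sq_nonneg b]
  have hmb : K ≤ (m ^ 2 - a ^ 2) * (m ^ 2 - b ^ 2) := by
    rw [hm]; nlinarith [sq_nonneg a, sq_nonneg b, mul_nonneg hK hK,
      mul_nonneg hK (sq_nonneg a), mul_nonneg hK (sq_nonneg b),
      mul_nonneg (sq_nonneg a) (sq_nonneg b)]
  have key : ∀ ε > 0, ∀ t, 0 ≤ t →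
      0 ≤ w t + ε * Real.exp (m * t) ∧ 0 ≤ w1 t + ε * (m * Real.exp (m * t)) ∧
      0 ≤ z t + ε * ((m ^ 2 - a ^ 2) * Real.exp (m * t)) ∧
      0 ≤ z1 t + ε * ((m ^ 2 - a ^ 2) * (m * Real.exp (m * t))) := by
    intro ε hε
    refine cone_of_pos ha hb
      (r := fun t => r t + ε * ((m ^ 2 - a ^ 2) * (m ^ 2 - b ^ 2) * Real.exp (m * t)))
      (fun t => (hw t).add ((hasDerivAt_exp_mul m t).const_mul ε))
      (fun t => (hw1 t).add (((hasDerivAt_exp_mul m t).const_mul m).const_mul ε))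
      (fun t => by linarith [hw2 t])
      (fun t => (hz t).add (((hasDerivAt_exp_mul m t).const_mul (m ^ 2 - a ^ 2)).const_mul ε))
      (fun t => ?_) ?_ ?_ ?_ ?_ ?_
    · refine ((hz1 t).add ((((hasDerivAt_exp_mul m t).const_mul m).const_mul
        (m ^ 2 - a ^ 2)).const_mul ε)).congr_deriv ?_
      simp only [mul_add]
      ring
    · intro t ht hwt
      have hE := Real.exp_pos (m * t)
      have hεE : 0 < ε * Real.exp (m * t) := mul_pos hε hE
      have h2 : K * (ε * Real.exp (m * t)) ≤
          (m ^ 2 - a ^ 2) * (m ^ 2 - b ^ 2) * (ε * Real.exp (m * t)) := by gcongr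
      have h3 : ε * ((m ^ 2 - a ^ 2) * (m ^ 2 - b ^ 2) * Real.exp (m * t)) =
        (m ^ 2 - a ^ 2) * (m ^ 2 - b ^ 2) * (ε * Real.exp (m * t)) := by ring
      rw [h3]
      rcases le_total 0 (w t) with h | h
      · have := hr t ht h
        have h4 : 0 ≤ K * (ε * Real.exp (m * t)) := by positivity
        linarith
      · have h4 := hr' t ht h
        have h5 : 0 ≤ K * (w t + ε * Real.exp (m * t)) := mul_nonneg hK hwt
        linarith
    · simp only [mul_zero, Real.exp_zero]; linarith
    · simp only [mul_zero, Real.exp_zero]; positivity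
    · simp only [mul_zero, Real.exp_zero]; positivity
    · simp only [mul_zero, Real.exp_zero]; positivity
  intro t ht
  exact ⟨nonneg_of_forall_pos_add_mul fun ε hε => (key ε hε t ht).1,
    nonneg_of_forall_pos_add_mul fun ε hε => (key ε hε t ht).2.1,
    nonneg_of_forall_pos_add_mul fun ε hε => (key ε hε t ht).2.2.1,
    nonneg_of_forall_pos_add_mul fun ε hε => (key ε hε t ht).2.2.2⟩

lemma HasDerivAt.eq_zero_of_forall_gt {φ φ' : ℝ → ℝ} (h : ∀ t, HasDerivAt φ (φ' t) t)
    (h0 : ∀ t, 0 < t → φ t = 0) : φ 0 = 0 ∧ ∀ t, 0 < t → φ' t = 0 := by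
  constructor
  · have h1 : Tendsto φ (𝓝[>] 0) (𝓝 (φ 0)) :=
      tendsto_nhdsWithin_of_tendsto_nhds (h 0).continuousAt
    refine tendsto_nhds_unique (h1.congr' ?_) tendsto_const_nhds
    exact eventually_mem_nhdsWithin.mono fun t ht => h0 t ht
  · intro t ht
    refine (h t).unique ((hasDerivAt_const t (0:ℝ)).congr_of_eventuallyEq ?_)
    filter_upwards [Ioi_mem_nhds ht] with s hs using h0 s hs

/-- A solution in the positivity cone that is bounded above vanishes. -/
lemma cone_eq_zero_of_bddAbove {a b K : ℝ} (ha : 0 < a) (hb : 0 ≤ b) (hK : 0 ≤ K)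
    {w w1 z z1 r : ℝ → ℝ}
    (hw : ∀ t, HasDerivAt w (w1 t) t) (hw1 : ∀ t, HasDerivAt w1 (a ^ 2 * w t + z t) t)
    (hz : ∀ t, HasDerivAt z (z1 t) t) (hz1 : ∀ t, HasDerivAt z1 (b ^ 2 * z t + r t) t)
    (hr : ∀ t, 0 ≤ t → 0 ≤ w t → 0 ≤ r t) (hr' : ∀ t, 0 ≤ t → w t ≤ 0 → K * w t ≤ r t)
    (w_nonneg : 0 ≤ w 0) (w1_nonneg : 0 ≤ w1 0) (z_nonneg : 0 ≤ z 0) (z1_nonneg : 0 ≤ z1 0)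
    {C : ℝ} (hC : ∀ t, 0 ≤ t → w t ≤ C) :
    w 0 = 0 ∧ w1 0 = 0 ∧ z 0 = 0 ∧ z1 0 = 0 := by
  have hcone := cone_nonneg ha.le hb hK hw hw1 (fun _ => le_rfl) hz hz1 hr hr' w_nonneg w1_nonneg z_nonneg z1_nonneg
  have hw1mono : ∀ s t, 0 ≤ s → s ≤ t → w1 s ≤ w1 t := fun s t hs hst =>
    le_of_hasDerivAt_nonneg hw1 hst fun u hu => by
      obtain ⟨h1, -, h3, -⟩ := hcone u (hs.trans hu.1.le)
      positivity
  -- In the cone w is convex, so a positive slope would persist and make w unbounded.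
  have hw1zero : ∀ t, 0 ≤ t → w1 t = 0 := by
    intro t ht
    by_contra hne
    have hpos : 0 < w1 t := lt_of_le_of_ne (hcone t ht).2.1 (Ne.symm hne)
    have hgrow := add_mul_le_of_hasDerivAt_ge hw (s := t) (t := t + (C + 1) / w1 t) (c := w1 t)
    have hC0 : 0 ≤ C := (hcone t ht).1.trans (hC t ht)
    have hle : t ≤ t + (C + 1) / w1 t := by
      have : 0 ≤ (C + 1) / w1 t := by positivity
      linarith
    have h1 := hgrow hle fun u hu => hw1mono t u ht hu.1.le
    have h2 := hC (t + (C + 1) / w1 t) (ht.trans hle)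
    have h3 : w1 t * (t + (C + 1) / w1 t - t) = C + 1 := by field_simp; ring
    linarith [(hcone t ht).1]
  have h1 := HasDerivAt.eq_zero_of_forall_gt hw1 fun t ht => hw1zero t ht.le
  -- Now w'' = a²w + z = 0 with both summands nonnegative, so both vanish; a > 0 is needed for w.
  have hwz : ∀ t, 0 < t → w t = 0 ∧ z t = 0 := by
    intro t ht
    obtain ⟨h2, -, h3, -⟩ := hcone t ht.le
    have h4 := h1.2 t ht
    have h5 : 0 ≤ a ^ 2 * w t := by positivity
    have h6 : a ^ 2 * w t = 0 := by linarith
    exact ⟨(mul_eq_zero.1 h6).resolve_left (by positivity), by linarith⟩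
  have h2 := HasDerivAt.eq_zero_of_forall_gt hw fun t ht => (hwz t ht).1
  have h3 := HasDerivAt.eq_zero_of_forall_gt hz fun t ht => (hwz t ht).2
  have h4 := HasDerivAt.eq_zero_of_forall_gt hz1 fun t ht => h3.2 t ht
  exact ⟨h2.1, h1.1, h3.1, h4.1⟩
end

/-! ### The fourth order equation: comparison, uniqueness, energy -/

noncomputable section

/-- `f` is nondecreasing and Lipschitz continuous with constant `K`. -/
structure MonotoneLipschitz (K : ℝ) (f : ℝ → ℝ) : Prop where
  nonneg : 0 ≤ K
  le : ∀ x y, x ≤ y → f x ≤ f y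
  sub_le : ∀ x y, x ≤ y → f y - f x ≤ K * (y - x)

lemma MonotoneLipschitz.abs_sub_le {K : ℝ} {f : ℝ → ℝ} (hf : MonotoneLipschitz K f) (x y : ℝ) :
    |f x - f y| ≤ K * |x - y| := by
  rcases le_total x y with h | h
  · rw [abs_sub_comm, abs_sub_comm x, abs_of_nonneg (sub_nonneg.2 (hf.le x y h)),
      abs_of_nonneg (sub_nonneg.2 h)]
    exact hf.sub_le x y h
  · rw [abs_of_nonneg (sub_nonneg.2 (hf.le y x h)), abs_of_nonneg (sub_nonneg.2 h)]
    exact hf.sub_le y x h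

lemma MonotoneLipschitz.continuous {K : ℝ} {f : ℝ → ℝ} (hf : MonotoneLipschitz K f) :
    Continuous f := by
  have : LipschitzWith ⟨K, hf.nonneg⟩ f := LipschitzWith.of_dist_le_mul fun x y => by
    rw [Real.dist_eq, Real.dist_eq]; exact hf.abs_sub_le x y
  exact this.continuous

/-- `v` solves `v'''' - (a² + b²) v'' + a² b² v = f(v)`, and `v1, v2, v3` are its derivatives. -/
structure IsSol (a b : ℝ) (f v v1 v2 v3 : ℝ → ℝ) : Prop where
  d0 : ∀ t, HasDerivAt v (v1 t) t
  d1 : ∀ t, HasDerivAt v1 (v2 t) t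
  d2 : ∀ t, HasDerivAt v2 (v3 t) t
  d3 : ∀ t, HasDerivAt v3 ((a ^ 2 + b ^ 2) * v2 t - a ^ 2 * b ^ 2 * v t + f (v t)) t

variable {a b K : ℝ} {f v v1 v2 v3 u u1 u2 u3 : ℝ → ℝ}

lemma hasDerivAt_comp_add_left {φ : ℝ → ℝ} {φ' s t : ℝ} (h : HasDerivAt φ φ' (s + t)) :
    HasDerivAt (fun r => φ (s + r)) φ' t := by
  have h2 : HasDerivAt (fun r : ℝ => s + r) 1 t := by simpa using (hasDerivAt_id t).const_add s
  have := HasDerivAt.scomp t h h2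
  simpa [Function.comp_def] using this

lemma hasDerivAt_comp_neg' {φ : ℝ → ℝ} {φ' t : ℝ} (h : HasDerivAt φ φ' (-t)) :
    HasDerivAt (fun r => φ (-r)) (-φ') t := by
  have := HasDerivAt.scomp t h (hasDerivAt_neg t)
  simpa [Function.comp_def] using this

namespace IsSol

lemma shift (h : IsSol a b f v v1 v2 v3) (s : ℝ) :
    IsSol a b f (fun t => v (s + t)) (fun t => v1 (s + t)) (fun t => v2 (s + t))
      (fun t => v3 (s + t)) :=
  ⟨fun _ => hasDerivAt_comp_add_left (h.d0 _), fun _ => hasDerivAt_comp_add_left (h.d1 _),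
    fun _ => hasDerivAt_comp_add_left (h.d2 _), fun _ => hasDerivAt_comp_add_left (h.d3 _)⟩

lemma reflect (h : IsSol a b f v v1 v2 v3) :
    IsSol a b f (fun t => v (-t)) (fun t => -v1 (-t)) (fun t => v2 (-t)) (fun t => -v3 (-t)) := by
  refine ⟨fun _ => hasDerivAt_comp_neg' (h.d0 _), fun t => ?_,
    fun _ => hasDerivAt_comp_neg' (h.d2 _), fun t => ?_⟩
  · exact (hasDerivAt_comp_neg' (h.d1 (-t))).neg.congr_deriv (neg_neg _)
  · exact (hasDerivAt_comp_neg' (h.d3 (-t))).neg.congr_deriv (neg_neg _)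

lemma dz (h : IsSol a b f v v1 v2 v3) (t : ℝ) :
    HasDerivAt (fun s => v2 s - a ^ 2 * v s) (v3 t - a ^ 2 * v1 t) t :=
  (h.d2 t).sub ((h.d0 t).const_mul _)

/-- Second half of the factorization (D² - b²)(D² - a²)v = f(v): the equation is a second order one
for z = v'' - a²v with source f(v). -/
lemma dz1 (h : IsSol a b f v v1 v2 v3) (t : ℝ) :
    HasDerivAt (fun s => v3 s - a ^ 2 * v1 s) (b ^ 2 * (v2 t - a ^ 2 * v t) + f (v t)) t :=
  ((h.d3 t).sub ((h.d1 t).const_mul _)).congr_deriv (by ring)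

/-- Comparison of two solutions with ordered Cauchy data. -/
lemma comparison (hf : MonotoneLipschitz K f) (ha : 0 ≤ a) (hb : 0 ≤ b)
    (hu : IsSol a b f u u1 u2 u3) (hv : IsSol a b f v v1 v2 v3)
    (h0 : u 0 ≤ v 0) (h1 : u1 0 ≤ v1 0) (h2 : u2 0 - a ^ 2 * u 0 ≤ v2 0 - a ^ 2 * v 0)
    (h3 : u3 0 - a ^ 2 * u1 0 ≤ v3 0 - a ^ 2 * v1 0) :
    ∀ t, 0 ≤ t → u t ≤ v t ∧ u1 t ≤ v1 t ∧ u2 t - a ^ 2 * u t ≤ v2 t - a ^ 2 * v t ∧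
      u3 t - a ^ 2 * u1 t ≤ v3 t - a ^ 2 * v1 t := by
  intro t ht
  have := cone_nonneg ha hb hf.nonneg (w := fun t => v t - u t) (w1 := fun t => v1 t - u1 t)
    (z := fun t => (v2 t - a ^ 2 * v t) - (u2 t - a ^ 2 * u t))
    (z1 := fun t => (v3 t - a ^ 2 * v1 t) - (u3 t - a ^ 2 * u1 t))
    (r := fun t => f (v t) - f (u t))
    (fun t => (hv.d0 t).sub (hu.d0 t))
    (fun t => (hv.d1 t).sub (hu.d1 t)) (fun t => by linarith)
    (fun t => (hv.dz t).sub (hu.dz t))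
    (fun t => ((hv.dz1 t).sub (hu.dz1 t)).congr_deriv (by ring))
    (fun t _ h => sub_nonneg.2 (hf.le _ _ (by linarith)))
    (fun t _ h => by have := hf.sub_le (v t) (u t) (by linarith); linarith)
    (by simpa using h0) (by simpa using h1) (by linarith) (by linarith) t ht
  refine ⟨?_, ?_, ?_, ?_⟩ <;> linarith [this.1, this.2.1, this.2.2.1, this.2.2.2]

/-- The difference of the two solutions lies in the positivity cone, and a cone solution bounded
above is zero. A one-sided bound on the difference suffices. -/
lemma data_eq_of_ordered (hf : MonotoneLipschitz K f) (ha : 0 < a) (hb : 0 ≤ b)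
    (hu : IsSol a b f u u1 u2 u3) (hv : IsSol a b f v v1 v2 v3)
    (h0 : u 0 ≤ v 0) (h1 : u1 0 ≤ v1 0) (h2 : u2 0 - a ^ 2 * u 0 ≤ v2 0 - a ^ 2 * v 0)
    (h3 : u3 0 - a ^ 2 * u1 0 ≤ v3 0 - a ^ 2 * v1 0) {C : ℝ} (hC : ∀ t, v t - u t ≤ C) :
    u 0 = v 0 ∧ u1 0 = v1 0 ∧ u2 0 = v2 0 ∧ u3 0 = v3 0 := by
  have := cone_eq_zero_of_bddAbove ha hb hf.nonneg (w := fun t => v t - u t)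
    (w1 := fun t => v1 t - u1 t)
    (z := fun t => (v2 t - a ^ 2 * v t) - (u2 t - a ^ 2 * u t))
    (z1 := fun t => (v3 t - a ^ 2 * v1 t) - (u3 t - a ^ 2 * u1 t))
    (r := fun t => f (v t) - f (u t))
    (fun t => (hv.d0 t).sub (hu.d0 t))
    (fun t => ((hv.d1 t).sub (hu.d1 t)).congr_deriv (by ring))
    (fun t => (hv.dz t).sub (hu.dz t))
    (fun t => ((hv.dz1 t).sub (hu.dz1 t)).congr_deriv (by ring))
    (fun t _ h => sub_nonneg.2 (hf.le _ _ (by linarith)))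
    (fun t _ h => by have := hf.sub_le (v t) (u t) (by linarith); linarith)
    (by simpa using h0) (by simpa using h1) (by linarith) (by linarith)
    (C := C) (fun t _ => hC t)
  obtain ⟨e0, e1, e2, e3⟩ := this
  have e0' : v 0 = u 0 := by linarith
  have e1' : v1 0 = u1 0 := by linarith
  rw [e0'] at e2
  rw [e1'] at e3
  exact ⟨e0'.symm, e1'.symm, by linarith, by linarith⟩

/-- Uniqueness for the Cauchy problem. -/
lemma eq_of_data (hf : MonotoneLipschitz K f) (ha : 0 ≤ a) (hb : 0 ≤ b)
    (hu : IsSol a b f u u1 u2 u3) (hv : IsSol a b f v v1 v2 v3)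
    (h0 : u 0 = v 0) (h1 : u1 0 = v1 0) (h2 : u2 0 = v2 0) (h3 : u3 0 = v3 0) (t : ℝ) :
    u t = v t ∧ u1 t = v1 t ∧ u2 t = v2 t ∧ u3 t = v3 t := by
  have fwd : ∀ {u u1 u2 u3 v v1 v2 v3 : ℝ → ℝ}, IsSol a b f u u1 u2 u3 → IsSol a b f v v1 v2 v3 →
      u 0 = v 0 → u1 0 = v1 0 → u2 0 = v2 0 → u3 0 = v3 0 → ∀ t, 0 ≤ t →
      u t = v t ∧ u1 t = v1 t ∧ u2 t = v2 t ∧ u3 t = v3 t := by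
    intro u u1 u2 u3 v v1 v2 v3 hu hv h0 h1 h2 h3 t ht
    obtain ⟨p0, p1, p2, p3⟩ := comparison hf ha hb hu hv h0.le h1.le (by rw [h0, h2])
      (by rw [h1, h3]) t ht
    obtain ⟨q0, q1, q2, q3⟩ := comparison hf ha hb hv hu h0.ge h1.ge (by rw [h0, h2])
      (by rw [h1, h3]) t ht
    have e0 := le_antisymm p0 q0
    have e1 := le_antisymm p1 q1
    rw [e0] at p2 q2
    rw [e1] at p3 q3
    exact ⟨e0, e1, by linarith, by linarith⟩
  rcases le_total 0 t with ht | ht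
  · exact fwd hu hv h0 h1 h2 h3 t ht
  · have := fwd hu.reflect hv.reflect (by simpa using h0) (by simpa using h1) (by simpa using h2)
      (by simpa using h3) (-t) (by linarith)
    simpa using this

/-- Bounded solutions are determined by `v` and `v'` at a single point. -/
lemma eq_of_bounded (hf : MonotoneLipschitz K f) (ha : 0 < a) (hb : 0 ≤ b)
    (hu : IsSol a b f u u1 u2 u3) (hv : IsSol a b f v v1 v2 v3)
    {C : ℝ} (hCu : ∀ t, |u t| ≤ C) (hCv : ∀ t, |v t| ≤ C)
    (h0 : u 0 = v 0) (h1 : u1 0 = v1 0) (t : ℝ) :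
    u t = v t ∧ u1 t = v1 t ∧ u2 t = v2 t ∧ u3 t = v3 t := by
  -- Exchanging u and v orders the second derivatives; time reversal keeps that order and flips the
  -- third derivatives. So all data may be taken ordered.
  wlog h2 : u2 0 ≤ v2 0 generalizing u u1 u2 u3 v v1 v2 v3
  · obtain ⟨e0, e1, e2, e3⟩ := this hv hu hCv hCu h0.symm h1.symm (le_of_not_ge h2)
    exact ⟨e0.symm, e1.symm, e2.symm, e3.symm⟩
  wlog h3 : u3 0 ≤ v3 0 generalizing u u1 u2 u3 v v1 v2 v3 t
  · have := this (-t) hu.reflect hv.reflect (fun t => hCu _) (fun t => hCv _) (by simpa using h0)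
      (by simpa using h1) (by simpa using h2) (by simpa using le_of_not_ge h3)
    simpa using this
  obtain ⟨-, -, e2, e3⟩ := data_eq_of_ordered hf ha hb hu hv h0.le h1.le (by rw [h0]; linarith)
    (by rw [h1]; linarith) (C := 2 * C)
    (fun t => by linarith [abs_le.1 (hCu t), abs_le.1 (hCv t)])
  exact eq_of_data hf ha.le hb hu hv h0 h1 e2 e3 t

lemma eq_of_bounded' (hf : MonotoneLipschitz K f) (ha : 0 < a) (hb : 0 ≤ b)
    (hu : IsSol a b f u u1 u2 u3) (hv : IsSol a b f v v1 v2 v3)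
    {C : ℝ} (hCu : ∀ t, |u t| ≤ C) (hCv : ∀ t, |v t| ≤ C) {s t : ℝ}
    (h0 : u s = v t) (h1 : u1 s = v1 t) (r : ℝ) :
    u (s + r) = v (t + r) ∧ u1 (s + r) = v1 (t + r) :=
  have h := eq_of_bounded hf ha hb (hu.shift s) (hv.shift t) (fun _ => hCu _) (fun _ => hCv _)
    (by simpa using h0) (by simpa using h1) r
  ⟨h.1, h.2.1⟩

/-- Where two bounded solutions cross, the third derivative of the difference is controlled by
the first one. -/
lemma third_deriv_lt_of_cross (hf : MonotoneLipschitz K f) (ha : 0 < a) (hb : 0 ≤ b)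
    (hu : IsSol a b f u u1 u2 u3) (hv : IsSol a b f v v1 v2 v3)
    {C : ℝ} (hCu : ∀ t, |u t| ≤ C) (hCv : ∀ t, |v t| ≤ C)
    (h0 : u 0 = v 0) (h1 : u1 0 < v1 0) : v3 0 - u3 0 < a ^ 2 * (v1 0 - u1 0) := by
  by_contra! h3
  -- If the second derivatives are ordered like the first, the data are ordered forward in time.
  -- Otherwise time reversal, which changes the sign of the odd derivatives, orders them with u and
  -- v exchanged. Either way the slopes would coincide.
  rcases le_total (u2 0) (v2 0) with h2 | h2
  · exact h1.ne (data_eq_of_ordered hf ha hb hu hv h0.le h1.le (by rw [h0]; linarith)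
      (by linarith) (C := 2 * C)
      (fun t => by linarith [abs_le.1 (hCu t), abs_le.1 (hCv t)])).2.1
  · have := (data_eq_of_ordered hf ha hb hv.reflect hu.reflect (by simpa using h0.ge)
      (by simpa using h1.le) (by simp only [neg_zero, h0]; linarith)
      (by simp only [neg_zero]; linarith) (C := 2 * C)
      (fun t => by linarith [abs_le.1 (hCu (-t)), abs_le.1 (hCv (-t))])).2.1
    simp only [neg_zero, neg_inj] at this
    exact h1.ne this.symm

end IsSol

/-- The first order vector field of the equation. -/
def phaseField (a b : ℝ) (f : ℝ → ℝ) (x : Fin 4 → ℝ) : Fin 4 → ℝ :=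
  ![x 1, x 2, x 3, (a ^ 2 + b ^ 2) * x 2 - a ^ 2 * b ^ 2 * x 0 + f (x 0)]

lemma lipschitzWith_phaseField (hf : MonotoneLipschitz K f) :
    LipschitzWith ⟨1 + a ^ 2 + b ^ 2 + a ^ 2 * b ^ 2 + K, by have := hf.nonneg; positivity⟩
      (phaseField a b f) := by
  refine LipschitzWith.of_dist_le_mul fun x y => ?_
  have hK := hf.nonneg
  set D := dist x y
  have hD : 0 ≤ D := dist_nonneg
  have hxy : ∀ i, |x i - y i| ≤ D := fun i => by rw [← Real.dist_eq]; exact dist_le_pi_dist x y i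
  have hle : D ≤ (1 + a ^ 2 + b ^ 2 + a ^ 2 * b ^ 2 + K) * D := by
    have : 0 ≤ (a ^ 2 + b ^ 2 + a ^ 2 * b ^ 2 + K) * D := by positivity
    nlinarith
  refine (dist_pi_le_iff (by change 0 ≤ (1 + a ^ 2 + b ^ 2 + a ^ 2 * b ^ 2 + K) * D; positivity)).2
    fun i => ?_
  change dist (phaseField a b f x i) (phaseField a b f y i) ≤
    (1 + a ^ 2 + b ^ 2 + a ^ 2 * b ^ 2 + K) * D
  rw [Real.dist_eq]
  fin_cases i
  · simpa [phaseField] using (hxy 1).trans hle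
  · simpa [phaseField] using (hxy 2).trans hle
  · simpa [phaseField] using (hxy 3).trans hle
  · have e : phaseField a b f x 3 - phaseField a b f y 3 = (a ^ 2 + b ^ 2) * (x 2 - y 2)
        + (-(a ^ 2 * b ^ 2)) * (x 0 - y 0) + (f (x 0) - f (y 0)) := by
      simp [phaseField]; ring
    change |phaseField a b f x 3 - phaseField a b f y 3| ≤ _
    rw [e]
    refine (abs_add_three _ _ _).trans ?_
    rw [abs_mul, abs_mul, abs_neg, abs_of_nonneg (by positivity : 0 ≤ a ^ 2 + b ^ 2),
      abs_of_nonneg (by positivity : 0 ≤ a ^ 2 * b ^ 2)]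
    have h1 : (a ^ 2 + b ^ 2) * |x 2 - y 2| ≤ (a ^ 2 + b ^ 2) * D := by gcongr; exact hxy 2
    have h2 : a ^ 2 * b ^ 2 * |x 0 - y 0| ≤ a ^ 2 * b ^ 2 * D := by gcongr; exact hxy 0
    have h3 : |f (x 0) - f (y 0)| ≤ K * D := (hf.abs_sub_le _ _).trans (by gcongr; exact hxy 0)
    nlinarith

lemma exists_isSol (hf : MonotoneLipschitz K f) (a b c0 c1 c2 c3 : ℝ) :
    ∃ v v1 v2 v3 : ℝ → ℝ, IsSol a b f v v1 v2 v3 ∧ v 0 = c0 ∧ v1 0 = c1 ∧ v2 0 = c2 ∧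
      v3 0 = c3 := by
  obtain ⟨x, hx0, hx⟩ := exists_global_solution (lipschitzWith_phaseField (a := a) (b := b) hf)
    ![c0, c1, c2, c3]
  have h := fun t => hasDerivAt_pi.1 (hx t)
  refine ⟨fun t => x t 0, fun t => x t 1, fun t => x t 2, fun t => x t 3,
    ⟨fun t => h t 0, fun t => h t 1, fun t => h t 2, fun t => h t 3⟩, ?_, ?_, ?_, ?_⟩ <;>
  simp [hx0]

/-- Continuous dependence of solutions on the Cauchy data at `0`, on `[0, ∞)`. -/
lemma exists_exp_dependence (hf : MonotoneLipschitz K f) (a b : ℝ) :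
    ∃ L : ℝ, 0 ≤ L ∧ ∀ u u1 u2 u3 v v1 v2 v3 : ℝ → ℝ, IsSol a b f u u1 u2 u3 →
      IsSol a b f v v1 v2 v3 → ∀ δ, |u 0 - v 0| ≤ δ → |u1 0 - v1 0| ≤ δ → |u2 0 - v2 0| ≤ δ →
      |u3 0 - v3 0| ≤ δ → ∀ t, 0 ≤ t → |u t - v t| ≤ δ * Real.exp (L * t) ∧
        |u1 t - v1 t| ≤ δ * Real.exp (L * t) ∧ |u2 t - v2 t| ≤ δ * Real.exp (L * t) ∧
        |u3 t - v3 t| ≤ δ * Real.exp (L * t) := by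
  refine ⟨_, NNReal.coe_nonneg ⟨1 + a ^ 2 + b ^ 2 + a ^ 2 * b ^ 2 + K, by
    have := hf.nonneg; positivity⟩, ?_⟩
  intro u u1 u2 u3 v v1 v2 v3 hu hv δ h0 h1 h2 h3 t ht
  have hcurve : ∀ {v v1 v2 v3 : ℝ → ℝ}, IsSol a b f v v1 v2 v3 → ∀ t,
      HasDerivAt (fun t => ![v t, v1 t, v2 t, v3 t])
        (phaseField a b f ![v t, v1 t, v2 t, v3 t]) t := by
    intro v v1 v2 v3 hv t
    refine hasDerivAt_pi.2 fun i => ?_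
    fin_cases i
    · simpa [phaseField] using hv.d0 t
    · simpa [phaseField] using hv.d1 t
    · simpa [phaseField] using hv.d2 t
    · simpa [phaseField] using hv.d3 t
  have hd := dist_le_of_lipschitz_field (lipschitzWith_phaseField (a := a) (b := b) hf)
    (hcurve hu) (hcurve hv) ht
  have hδ : 0 ≤ δ := (abs_nonneg _).trans h0
  have h00 : dist ![u 0, u1 0, u2 0, u3 0] ![v 0, v1 0, v2 0, v3 0] ≤ δ := by
    refine (dist_pi_le_iff hδ).2 fun i => ?_
    fin_cases i <;> simpa [Real.dist_eq]
  have hd' := fun i => (dist_le_pi_dist _ _ i).trans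
    (hd.trans (mul_le_mul_of_nonneg_right h00 (Real.exp_pos _).le))
  exact ⟨by simpa [Real.dist_eq] using hd' 0, by simpa [Real.dist_eq] using hd' 1,
    by simpa [Real.dist_eq] using hd' 2, by simpa [Real.dist_eq] using hd' 3⟩

/-- The primitive of `f` vanishing at `0`. -/
def primitive (f : ℝ → ℝ) (x : ℝ) : ℝ := ∫ t in (0:ℝ)..x, f t

lemma hasDerivAt_primitive (hf : Continuous f) (x : ℝ) : HasDerivAt (primitive f) (f x) x :=
  (hf.integral_hasStrictDerivAt 0 x).hasDerivAt

@[simp] lemma primitive_zero : primitive f 0 = 0 := by simp [primitive]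

/-- Twice the potential energy, `B x² - 2 ∫₀ˣ f`. -/
def potential (a b : ℝ) (f : ℝ → ℝ) (x : ℝ) : ℝ := a ^ 2 * b ^ 2 * x ^ 2 - 2 * primitive f x

lemma hasDerivAt_potential (hf : Continuous f) (x : ℝ) :
    HasDerivAt (potential a b f) (2 * (a ^ 2 * b ^ 2 * x - f x)) x := by
  refine (((hasDerivAt_pow 2 x).const_mul (a ^ 2 * b ^ 2)).sub
    ((hasDerivAt_primitive hf x).const_mul 2)).congr_deriv ?_
  simp; ring

@[simp] lemma potential_zero : potential a b f 0 = 0 := by simp [potential]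

/-- The conserved energy (times two). -/
lemma IsSol.energy (hf : Continuous f) (h : IsSol a b f v v1 v2 v3) (s t : ℝ) :
    2 * (v1 s * v3 s) - v2 s ^ 2 - (a ^ 2 + b ^ 2) * v1 s ^ 2 + potential a b f (v s) =
    2 * (v1 t * v3 t) - v2 t ^ 2 - (a ^ 2 + b ^ 2) * v1 t ^ 2 + potential a b f (v t) := by
  have hd : ∀ t, HasDerivAt (fun t => 2 * (v1 t * v3 t) - v2 t ^ 2 - (a ^ 2 + b ^ 2) * v1 t ^ 2 +
      potential a b f (v t)) 0 t := by
    intro t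
    have h1 := (((h.d1 t).mul (h.d3 t)).const_mul 2).sub ((h.d2 t).pow 2)
    have h2 := h1.sub (((h.d1 t).pow 2).const_mul (a ^ 2 + b ^ 2))
    have h3 := h2.add ((hasDerivAt_potential (a := a) (b := b) hf (v t)).comp t (h.d0 t))
    refine h3.congr_deriv ?_
    simp; ring
  exact is_const_of_deriv_eq_zero (fun t => (hd t).differentiableAt) (fun t => (hd t).deriv) s t
end

/-! ### A priori estimates: blow-up, Harnack inequality, universal bound -/

noncomputable section

variable {a b K : ℝ} {f v v1 v2 v3 u u1 u2 u3 : ℝ → ℝ}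

lemma tendsto_atTop_of_deriv_ge {φ φ' : ℝ → ℝ} (h : ∀ t, HasDerivAt φ (φ' t) t) {T c : ℝ}
    (hc : 0 < c) (hn : ∀ t, T ≤ t → c ≤ φ' t) : Tendsto φ atTop atTop := by
  have h1 : Tendsto (fun t => φ T + c * (t - T)) atTop atTop :=
    tendsto_atTop_add_const_left _ _
      ((tendsto_atTop_add_const_right _ (-T) tendsto_id).const_mul_atTop hc)
  refine tendsto_atTop_mono' _ ?_ h1
  filter_upwards [eventually_ge_atTop T] with t ht
  exact add_mul_le_of_hasDerivAt_ge h ht fun r hr => hn r hr.1.le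

lemma not_bddAbove_of_tendsto {φ : ℝ → ℝ} (h : Tendsto φ atTop atTop) {C : ℝ}
    (hC : ∀ t, φ t ≤ C) : False := by
  obtain ⟨t, ht⟩ := (h.eventually (eventually_gt_atTop C)).exists
  exact absurd (hC t) (not_le.2 ht)

lemma abs_taylor_le {y y1 y2 : ℝ → ℝ} (h0 : ∀ t, HasDerivAt y (y1 t) t)
    (h1 : ∀ t, HasDerivAt y1 (y2 t) t) {C : ℝ} (hC : ∀ t, |y2 t| ≤ C) (t : ℝ) {h : ℝ}
    (hh : 0 ≤ h) : |y (t + h) - y t - h * y1 t| ≤ C * h ^ 2 := by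
  have hC0 : 0 ≤ C := (abs_nonneg _).trans (hC 0)
  have hb : ∀ r ∈ Ioo t (t + h), y1 t - C * h ≤ y1 r ∧ y1 r ≤ y1 t + C * h := by
    intro r hr
    have e1 := add_mul_le_of_hasDerivAt_ge h1 hr.1.le (fun s _ => (abs_le.1 (hC s)).1)
    have e2 := le_add_mul_of_hasDerivAt_le h1 hr.1.le (fun s _ => (abs_le.1 (hC s)).2)
    have e3 : C * (r - t) ≤ C * h := by gcongr; linarith [hr.2]
    constructor <;> linarith
  have e1 := add_mul_le_of_hasDerivAt_ge h0 (by linarith : t ≤ t + h) (fun s hs => (hb s hs).1)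
  have e2 := le_add_mul_of_hasDerivAt_le h0 (by linarith : t ≤ t + h) (fun s hs => (hb s hs).2)
  rw [abs_le]
  constructor <;> nlinarith

/-- Landau's interpolation inequality: Taylor's formula with step 1. -/
lemma abs_deriv_le_of_bounds {y y1 y2 : ℝ → ℝ} (h0 : ∀ t, HasDerivAt y (y1 t) t)
    (h1 : ∀ t, HasDerivAt y1 (y2 t) t) {C0 C2 : ℝ} (hC0 : ∀ t, |y t| ≤ C0)
    (hC : ∀ t, |y2 t| ≤ C2) (t : ℝ) : |y1 t| ≤ 2 * C0 + C2 := by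
  have e := abs_le.1 (abs_taylor_le h0 h1 hC t zero_le_one)
  have e1 := abs_le.1 (hC0 t)
  have e2 := abs_le.1 (hC0 (t + 1))
  rw [abs_le]
  constructor <;> linarith [e.1, e.2]

/-- A convergent function with bounded second derivative has a derivative tending to zero. -/
lemma tendsto_deriv_zero_of_tendsto {y y1 y2 : ℝ → ℝ} (h0 : ∀ t, HasDerivAt y (y1 t) t)
    (h1 : ∀ t, HasDerivAt y1 (y2 t) t) {C l : ℝ} (hC : ∀ t, |y2 t| ≤ C)
    (hl : Tendsto y atTop (𝓝 l)) : Tendsto y1 atTop (𝓝 0) := by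
  have hC0 : 0 ≤ C := (abs_nonneg _).trans (hC 0)
  rw [Metric.tendsto_atTop]
  intro ε hε
  -- The step makes the Taylor error C h² smaller than h ε / 2; the increment y(t + h) - y(t)
  -- contributes the other half for large t.
  set h : ℝ := ε / (2 * (C + 1))
  have hh : 0 < h := by positivity
  have hCh : C * h < ε / 2 := by
    have : (C + 1) * h = ε / 2 := by simp only [h]; field_simp
    nlinarith
  have hdiff : Tendsto (fun t => y (t + h) - y t) atTop (𝓝 0) := by
    simpa using (hl.comp (tendsto_atTop_add_const_right _ h tendsto_id)).sub hl
  obtain ⟨N, hN⟩ := (Metric.tendsto_atTop.1 hdiff) (h * (ε / 2)) (by positivity)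
  refine ⟨N, fun t ht => ?_⟩
  have e1 := hN t ht
  rw [Real.dist_eq, sub_zero] at e1 ⊢
  have e2 := abs_le.1 (abs_taylor_le h0 h1 hC t hh.le)
  have e3 := abs_lt.1 e1
  have e4 : h * |y1 t| < h * ε := by
    rw [← abs_of_pos hh, ← abs_mul, abs_of_pos hh, abs_lt]
    constructor <;> nlinarith [e2.1, e2.2, e3.1, e3.2]
  exact lt_of_mul_lt_mul_left e4 hh.le

/-- A convex function on the line that is bounded above has vanishing derivative. -/
lemma deriv_eq_zero_of_convex_of_bddAbove {y y1 y2 : ℝ → ℝ} (h0 : ∀ t, HasDerivAt y (y1 t) t)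
    (h1 : ∀ t, HasDerivAt y1 (y2 t) t) (h2 : ∀ t, 0 ≤ y2 t) {C : ℝ} (hC : ∀ t, y t ≤ C) (t : ℝ) :
    y1 t = 0 := by
  have key : ∀ {y y1 y2 : ℝ → ℝ}, (∀ t, HasDerivAt y (y1 t) t) → (∀ t, HasDerivAt y1 (y2 t) t) →
      (∀ t, 0 ≤ y2 t) → (∀ t, y t ≤ C) → ∀ t, y1 t ≤ 0 := by
    intro y y1 y2 h0 h1 h2 hC t
    by_contra! hpos
    exact not_bddAbove_of_tendsto (tendsto_atTop_of_deriv_ge h0 hpos fun s hs =>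
      le_of_hasDerivAt_nonneg h1 hs fun r _ => h2 r) hC
  refine le_antisymm (key h0 h1 h2 hC t) ?_
  have := key (y := fun t => y (-t)) (y1 := fun t => -y1 (-t)) (y2 := fun t => y2 (-t))
    (fun t => hasDerivAt_comp_neg' (h0 _))
    (fun t => (hasDerivAt_comp_neg' (h1 (-t))).neg.congr_deriv (neg_neg _))
    (fun t => h2 _) (fun t => hC _) (-t)
  simp only [neg_neg] at this
  linarith

namespace IsSol

/-- Once `z = v'' - a² v` is positive and nondecreasing, it stays so. -/
lemma z_growth (h : IsSol a b f v v1 v2 v3) (hb : 0 ≤ b) (hfv : ∀ t, 0 ≤ f (v t)) {s : ℝ}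
    (hz : 0 < v2 s - a ^ 2 * v s) (hz1 : 0 ≤ v3 s - a ^ 2 * v1 s) {t : ℝ} (hst : s ≤ t) :
    v2 s - a ^ 2 * v s ≤ v2 t - a ^ 2 * v t ∧ 0 ≤ v3 t - a ^ 2 * v1 t := by
  have key : ∀ t, s ≤ t → 0 ≤ v2 t - a ^ 2 * v t ∧ 0 ≤ v3 t - a ^ 2 * v1 t := fun t hst =>
    nonneg_of_second_deriv_ge h.dz h.dz1 hb hst (fun r _ => by linarith [hfv r]) hz.le hz1
  exact ⟨le_of_hasDerivAt_nonneg h.dz hst fun r hr => (key r hr.1.le).2, (key t hst).2⟩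

lemma tendsto_deriv_atTop (h : IsSol a b f v v1 v2 v3) (hb : 0 ≤ b) (hv : ∀ t, 0 ≤ v t)
    (hfv : ∀ t, 0 ≤ f (v t)) {s : ℝ}
    (hz : 0 < v2 s - a ^ 2 * v s) (hz1 : 0 ≤ v3 s - a ^ 2 * v1 s) : Tendsto v1 atTop atTop := by
  refine tendsto_atTop_of_deriv_ge (T := s) h.d1 hz fun t ht => ?_
  have := (h.z_growth hb hfv hz hz1 ht).1
  nlinarith [hv t, sq_nonneg a, mul_nonneg (sq_nonneg a) (hv t)]

lemma tendsto_atTop (h : IsSol a b f v v1 v2 v3) (hb : 0 ≤ b) (hv : ∀ t, 0 ≤ v t)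
    (hfv : ∀ t, 0 ≤ f (v t)) {s : ℝ}
    (hz : 0 < v2 s - a ^ 2 * v s) (hz1 : 0 ≤ v3 s - a ^ 2 * v1 s) : Tendsto v atTop atTop := by
  obtain ⟨T, hT⟩ := eventually_atTop.1
    ((h.tendsto_deriv_atTop hb hv hfv hz hz1).eventually (eventually_ge_atTop 1))
  exact tendsto_atTop_of_deriv_ge h.d0 one_pos hT

/-- Time reversal preserves z and flips z', so a point with z > 0 may be assumed to have z' ≥ 0. The
range condition on u covers both v and its reflection. -/
lemma z_nonpos_of_forall_not (h : IsSol a b f v v1 v2 v3)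
    (hnot : ∀ u u1 u2 u3 : ℝ → ℝ, IsSol a b f u u1 u2 u3 → (∀ t, ∃ s, u t = v s) →
      ∀ s, 0 < u2 s - a ^ 2 * u s → 0 ≤ u3 s - a ^ 2 * u1 s → False) (t : ℝ) :
    v2 t - a ^ 2 * v t ≤ 0 := by
  by_contra! hz
  rcases le_total 0 (v3 t - a ^ 2 * v1 t) with h1 | h1
  · exact hnot v v1 v2 v3 h (fun t => ⟨t, rfl⟩) t hz h1
  · exact hnot _ _ _ _ h.reflect (fun t => ⟨-t, rfl⟩) (-t) (by simpa using hz)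
      (by simp only [neg_neg]; linarith)

lemma z_nonpos_of_bounded (h : IsSol a b f v v1 v2 v3) (hb : 0 ≤ b) (hv : ∀ t, 0 ≤ v t)
    (hfv : ∀ t, 0 ≤ f (v t)) {C : ℝ} (hC : ∀ t, v t ≤ C) (t : ℝ) :
    v2 t - a ^ 2 * v t ≤ 0 := by
  refine h.z_nonpos_of_forall_not (fun u u1 u2 u3 hu hr s hs hs1 => ?_) t
  have hru : ∀ (P : ℝ → Prop), (∀ t, P (v t)) → ∀ t, P (u t) := fun P hP t => by
    obtain ⟨s, hs⟩ := hr t; rw [hs]; exact hP s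
  exact not_bddAbove_of_tendsto (hu.tendsto_atTop hb (hru (0 ≤ ·) hv) (hru (0 ≤ f ·) hfv) hs hs1)
    (hru (· ≤ C) hC)

/-- Integrate v'''' ≥ N four times, spending time δ on each integration and discarding the
nonnegative initial values. -/
lemma fourth_order_growth (h : IsSol a b f v v1 v2 v3) {t N δ : ℝ} (hδ : 0 ≤ δ)
    (hN : ∀ r, t ≤ r → N ≤ (a ^ 2 + b ^ 2) * v2 r - a ^ 2 * b ^ 2 * v r + f (v r))
    (hN0 : 0 ≤ N) (h0 : ∀ r, t ≤ r → 0 ≤ v r) (h1 : ∀ r, t ≤ r → 0 ≤ v1 r)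
    (h2 : ∀ r, t ≤ r → 0 ≤ v2 r) (h3 : ∀ r, t ≤ r → 0 ≤ v3 r) :
    N * δ ^ 4 ≤ v (t + 4 * δ) := by
  have e3 : ∀ r, t + δ ≤ r → N * δ ≤ v3 r := fun r hr => by
    have := add_mul_le_of_hasDerivAt_ge h.d3 (by linarith : t ≤ r) (fun s hs => hN s hs.1.le)
    have h5 : N * δ ≤ N * (r - t) := by gcongr; linarith
    linarith [h3 t le_rfl]
  have e2 : ∀ r, t + 2 * δ ≤ r → N * δ ^ 2 ≤ v2 r := fun r hr => by
    have := add_mul_le_of_hasDerivAt_ge h.d2 (by linarith : t + δ ≤ r) (fun s hs => e3 s hs.1.le)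
    have h5 : N * δ * δ ≤ N * δ * (r - (t + δ)) := by gcongr; linarith
    linarith [h2 (t + δ) (by linarith)]
  have e1 : ∀ r, t + 3 * δ ≤ r → N * δ ^ 3 ≤ v1 r := fun r hr => by
    have := add_mul_le_of_hasDerivAt_ge h.d1 (by linarith : t + 2 * δ ≤ r)
      (fun s hs => e2 s hs.1.le)
    have h5 : N * δ ^ 2 * δ ≤ N * δ ^ 2 * (r - (t + 2 * δ)) := by gcongr; linarith
    linarith [h1 (t + 2 * δ) (by linarith)]
  have := add_mul_le_of_hasDerivAt_ge h.d0 (by linarith : t + 3 * δ ≤ t + 4 * δ)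
    (fun s hs => e1 s hs.1.le)
  linarith [h0 (t + 3 * δ) (by linarith)]

/-- With a superlinear nonlinearity, a positive solution for which `z = v'' - a² v` becomes
positive blows up in finite time. -/
lemma z_nonpos_of_superlinear (h : IsSol a b f v v1 v2 v3) (hb : 0 ≤ b) (hv : ∀ t, 0 < v t)
    (hf : ∀ t, 0 < t → 0 ≤ f t) {q c : ℝ} (hq : 1 < q) (hc : 0 < c)
    (hfq : ∀ t, 1 ≤ t → c * t ^ q ≤ f t) (t : ℝ) : v2 t - a ^ 2 * v t ≤ 0 := by
  refine h.z_nonpos_of_forall_not (fun u u1 u2 u3 hu hr s hs hs1 => ?_) t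
  have hpos : ∀ t, 0 < u t := fun t => by obtain ⟨s, hs⟩ := hr t; rw [hs]; exact hv s
  have hfu : ∀ t, 0 ≤ f (u t) := fun t => hf _ (hpos t)
  have hu1 := hu.tendsto_deriv_atTop hb (fun t => (hpos t).le) hfu hs hs1
  have hu0 := hu.tendsto_atTop hb (fun t => (hpos t).le) hfu hs hs1
  have hq1 : 0 < q - 1 := by linarith
  -- The constants make u grow by a factor D along times with geometrically shrinking gaps: D^(q-1)
  -- ≥ 16 offsets the fourth power of the halved step, and V pays for c and 4⁴ = 256.
  obtain ⟨D, hD2, hD⟩ : ∃ D : ℝ, 2 ≤ D ∧ 16 ≤ D ^ (q - 1) :=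
    ((eventually_ge_atTop 2).and ((tendsto_rpow_atTop hq1).eventually
      (eventually_ge_atTop 16))).exists
  obtain ⟨V, hV1, hV⟩ : ∃ V : ℝ, 1 ≤ V ∧ 256 * D / c ≤ V ^ (q - 1) :=
    ((eventually_ge_atTop 1).and ((tendsto_rpow_atTop hq1).eventually
      (eventually_ge_atTop (256 * D / c)))).exists
  obtain ⟨T, hT⟩ := eventually_atTop.1 ((eventually_ge_atTop s).and
    ((hu1.eventually (eventually_ge_atTop 0)).and (hu0.eventually (eventually_ge_atTop V))))
  have hmono : ∀ r r', T ≤ r → r ≤ r' → u r ≤ u r' := fun r r' hr hrr =>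
    le_of_hasDerivAt_nonneg hu.d0 hrr fun x hx => (hT x (hr.trans hx.1.le)).2.1
  have hzz := fun r (hr : T ≤ r) => hu.z_growth hb hfu hs hs1 (hT r hr).1
  have step : ∀ r δ, T ≤ r → 0 ≤ δ → c * u r ^ q * δ ^ 4 ≤ u (r + 4 * δ) := by
    intro r δ hr hδ
    have hur : 1 ≤ u r := hV1.trans (hT r hr).2.2
    -- Here u'''' = (a² + b²)z + a⁴u + f(u), and every term is nonnegative, so u'''' ≥ f(u).
    refine hu.fourth_order_growth hδ (fun x hx => ?_) (by positivity) (fun x _ => (hpos x).le)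
      (fun x hx => (hT x (hr.trans hx)).2.1) (fun x hx => ?_) (fun x hx => ?_)
    · have h1 := (hzz x (hr.trans hx)).1
      have h2 : c * u r ^ q ≤ f (u x) := by
        refine le_trans ?_ (hfq (u x) (hur.trans (hmono r x hr hx)))
        gcongr
        exact hmono r x hr hx
      have h3 : 0 ≤ (a ^ 2 + b ^ 2) * (u2 x - a ^ 2 * u x) := by
        have : 0 ≤ u2 x - a ^ 2 * u x := by linarith
        positivity
      have h4 : 0 ≤ a ^ 4 * u x := by have := (hpos x).le; positivity
      nlinarith
    · have h1 := (hzz x (hr.trans hx)).1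
      have h4 : 0 ≤ a ^ 2 * u x := by have := (hpos x).le; positivity
      linarith
    · have h1 := (hzz x (hr.trans hx)).2
      have h4 : 0 ≤ a ^ 2 * u1 x := mul_nonneg (sq_nonneg a) (hT x (hr.trans hx)).2.1
      linarith
  -- The times T + 2(1 - 2^(-k)) stay below T + 2, while the lower bounds diverge; this is the
  -- blow-up.
  have hiter : ∀ k : ℕ, V * D ^ k ≤ u (T + 2 * (1 - (1 / 2) ^ k)) := by
    intro k
    induction k with
    | zero => simpa using (hT T le_rfl).2.2
    | succ k ih =>
      have hk1 : ((1:ℝ) / 2) ^ k ≤ 1 := pow_le_one₀ (by norm_num) (by norm_num)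
      have h1 := step (T + 2 * (1 - (1 / 2) ^ k)) ((1 / 2) ^ k / 4) (by linarith) (by positivity)
      have e : T + 2 * (1 - (1 / 2) ^ k) + 4 * ((1 / 2) ^ k / 4) =
          T + 2 * (1 - ((1:ℝ) / 2) ^ (k + 1)) := by rw [pow_succ]; ring
      rw [e] at h1
      refine le_trans ?_ h1
      set X := u (T + 2 * (1 - (1 / 2) ^ k))
      have hY : 0 < V * D ^ k := by positivity
      have h2 : (V * D ^ k) ^ q ≤ X ^ q := by gcongr
      have h3 : (V * D ^ k) ^ q = V ^ (q - 1) * (D ^ (q - 1)) ^ k * (V * D ^ k) := by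
        have : q = (q - 1) + 1 := by ring
        conv_lhs => rw [this, Real.rpow_add hY, Real.rpow_one]
        rw [Real.mul_rpow (by positivity) (by positivity), ← Real.rpow_natCast D k,
          ← Real.rpow_mul (by positivity), mul_comm (k:ℝ), Real.rpow_mul (by positivity),
          Real.rpow_natCast]
      have h4 : (16:ℝ) ^ k ≤ (D ^ (q - 1)) ^ k := by gcongr
      have h5 : 256 * D ≤ c * V ^ (q - 1) := by
        rw [div_le_iff₀ hc] at hV; linarith
      have h6 : (((1:ℝ) / 2) ^ k / 4) ^ 4 * (16 : ℝ) ^ k = 1 / 256 := by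
        rw [div_pow, ← pow_mul, mul_comm k 4, pow_mul, div_mul_eq_mul_div, ← mul_pow]
        norm_num
      calc V * D ^ (k + 1) = 256 * D * (1 / 256) * (V * D ^ k) := by rw [pow_succ]; ring
        _ = 256 * D * ((((1:ℝ) / 2) ^ k / 4) ^ 4 * (16 : ℝ) ^ k) * (V * D ^ k) := by rw [h6]
        _ ≤ c * V ^ (q - 1) * ((((1:ℝ) / 2) ^ k / 4) ^ 4 * (D ^ (q - 1)) ^ k) * (V * D ^ k) := by
          gcongr
        _ = c * (V ^ (q - 1) * (D ^ (q - 1)) ^ k * (V * D ^ k)) * (((1:ℝ) / 2) ^ k / 4) ^ 4 := by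
          ring
        _ = c * (V * D ^ k) ^ q * (((1:ℝ) / 2) ^ k / 4) ^ 4 := by rw [h3]
        _ ≤ c * X ^ q * (((1:ℝ) / 2) ^ k / 4) ^ 4 := by gcongr
  obtain ⟨k, hk⟩ := pow_unbounded_of_one_lt (u (T + 2)) (by norm_num : (1:ℝ) < 2)
  have h1 := hiter k
  have hk1 : ((1:ℝ) / 2) ^ k ≤ 1 := pow_le_one₀ (by norm_num) (by norm_num)
  have hk0 : 0 < ((1:ℝ) / 2) ^ k := by positivity
  have h2 := hmono (T + 2 * (1 - (1 / 2) ^ k)) (T + 2) (by linarith) (by linarith)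
  have h3 : (2:ℝ) ^ k ≤ V * D ^ k := by
    have : (2:ℝ) ^ k ≤ D ^ k := by gcongr
    nlinarith [pow_pos (by linarith : (0:ℝ) < D) k]
  linarith

/-- A Harnack inequality: a positive function on the line with `v'' ≤ a² v` satisfies
`-v' ≤ a v`. -/
lemma neg_deriv_le (h : IsSol a b f v v1 v2 v3) (ha : 0 ≤ a) (hv : ∀ t, 0 < v t)
    (hz : ∀ t, v2 t - a ^ 2 * v t ≤ 0) (t : ℝ) : -v1 t ≤ a * v t := by
  by_contra! hneg
  -- Since y' - ay = z ≤ 0, a negative value of y keeps exp(ar) y below a negative constant. This is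
  -- the derivative of exp(ar) v, which would tend to -∞ although v > 0.
  set y : ℝ → ℝ := fun r => v1 r + a * v r
  have hy : ∀ r, HasDerivAt y (v2 r + a * v1 r) r := fun r => (h.d1 r).add ((h.d0 r).const_mul a)
  have hyt : y t < 0 := by simp only [y]; linarith
  have hE : ∀ r, t ≤ r → Real.exp (a * r) * y r ≤ Real.exp (a * t) * y t := by
    intro r hr
    have h1 := exp_mul_le_exp_mul (φ := fun r => -y r) (k := a) (fun r => (hy r).neg) hr
      (fun s _ => by simp only [y]; nlinarith [hz s])
    have h2 : Real.exp (-a * r) * y r ≤ Real.exp (-a * t) * y t := by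
      simp only [mul_neg] at h1; linarith
    have h3 : Real.exp (2 * a * t) ≤ Real.exp (2 * a * r) := Real.exp_le_exp.2 (by gcongr)
    have h4 : Real.exp (-a * t) * y t < 0 := mul_neg_of_pos_of_neg (Real.exp_pos _) hyt
    have e1 : ∀ s, Real.exp (a * s) * y s = Real.exp (2 * a * s) * (Real.exp (-a * s) * y s) := by
      intro s; rw [← mul_assoc, ← Real.exp_add]; ring_nf
    rw [e1, e1]
    nlinarith [Real.exp_pos (2 * a * r)]
  have hφ : ∀ r, HasDerivAt (fun r => -(Real.exp (a * r) * v r)) (-(Real.exp (a * r) * y r)) r :=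
    fun r => ((hasDerivAt_exp_mul a r).mul (h.d0 r)).neg.congr_deriv (by simp only [y]; ring)
  refine not_bddAbove_of_tendsto (C := 0) (tendsto_atTop_of_deriv_ge hφ (T := t)
    (c := -(Real.exp (a * t) * y t)) ?_ fun r hr => ?_) fun r => ?_
  · have : Real.exp (a * t) * y t < 0 := mul_neg_of_pos_of_neg (Real.exp_pos _) hyt
    linarith
  · linarith [hE r hr]
  · have := hv r
    have : 0 < Real.exp (a * r) * v r := by positivity
    linarith

lemma abs_deriv_le (h : IsSol a b f v v1 v2 v3) (ha : 0 ≤ a) (hv : ∀ t, 0 < v t)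
    (hz : ∀ t, v2 t - a ^ 2 * v t ≤ 0) (t : ℝ) : |v1 t| ≤ a * v t := by
  have h1 := h.neg_deriv_le ha hv hz t
  have h2 := h.reflect.neg_deriv_le ha (fun t => hv _) (fun t => hz _) (-t)
  simp only [neg_neg] at h2
  exact abs_le.2 ⟨by linarith, h2⟩

lemma exp_harnack (h : IsSol a b f v v1 v2 v3) (hH : ∀ t, |v1 t| ≤ a * v t) (s t : ℝ) :
    v t ≤ v s * Real.exp (a * |t - s|) := by
  rcases le_total s t with hst | hst
  · have h1 := exp_mul_le_exp_mul (φ := fun r => -v r) (k := a) (fun r => (h.d0 r).neg) hst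
      (fun r _ => by have := (abs_le.1 (hH r)).2; simp only [mul_neg]; linarith)
    simp only [mul_neg, neg_le_neg_iff] at h1
    rw [abs_of_nonneg (by linarith)]
    have e1 : v t = Real.exp (a * t) * (Real.exp (-a * t) * v t) := by
      rw [← mul_assoc, ← Real.exp_add]; simp
    have e2 : v s * Real.exp (a * (t - s)) = Real.exp (a * t) * (Real.exp (-a * s) * v s) := by
      rw [← mul_assoc, ← Real.exp_add, mul_comm]; ring_nf
    rw [e1, e2]
    gcongr
  · have h1 := exp_mul_le_exp_mul (k := -a) h.d0 hst
      (fun r _ => by have := (abs_le.1 (hH r)).1; linarith)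
    rw [neg_neg] at h1
    rw [abs_of_nonpos (by linarith)]
    have e1 : v t = Real.exp (-a * t) * (Real.exp (a * t) * v t) := by
      rw [← mul_assoc, ← Real.exp_add]; simp
    have e2 : v s * Real.exp (a * -(t - s)) = Real.exp (-a * t) * (Real.exp (a * s) * v s) := by
      rw [← mul_assoc, ← Real.exp_add, mul_comm]; ring_nf
    rw [e1, e2]
    gcongr

/-- A second derivative bounded below forces a function that is nonpositive nearby to be
quantitatively negative. -/
lemma le_neg_of_second_deriv_ge {y y1 y2 : ℝ → ℝ} (h0 : ∀ t, HasDerivAt y (y1 t) t)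
    (h1 : ∀ t, HasDerivAt y1 (y2 t) t) {N t : ℝ} (hN : 0 ≤ N)
    (h2 : ∀ r ∈ Icc (t - 1 / 2) (t + 1 / 2), N ≤ y2 r) (hy : ∀ r, y r ≤ 0) : y t ≤ -(N / 16) := by
  -- Up to reflection y is nondecreasing to the right of t. On [t + 1/4, t + 1/2] its slope is at
  -- least N/4, so it rises by N/16 while staying nonpositive.
  wlog hy1 : 0 ≤ y1 t generalizing y y1 y2 t
  · have := this (y := fun t => y (-t)) (y1 := fun t => -y1 (-t)) (y2 := fun t => y2 (-t))
      (t := -t) (fun t => hasDerivAt_comp_neg' (h0 _))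
      (fun t => (hasDerivAt_comp_neg' (h1 (-t))).neg.congr_deriv (neg_neg _))
      (fun r hr => h2 _ ⟨by linarith [hr.2], by linarith [hr.1]⟩) (fun r => hy _)
      (by simp only [neg_neg]; linarith)
    simpa using this
  have e1 : ∀ r ∈ Icc t (t + 1 / 2), N * (r - t) ≤ y1 r := fun r hr => by
    have := add_mul_le_of_hasDerivAt_ge h1 hr.1 (fun s hs => h2 s ⟨by linarith [hs.1], by
      linarith [hs.2, hr.2]⟩)
    linarith
  have e2 := le_of_hasDerivAt_nonneg h0 (by linarith : t ≤ t + 1 / 4) (fun r hr =>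
    (mul_nonneg hN (by linarith [hr.1])).trans (e1 r ⟨hr.1.le, by linarith [hr.2]⟩))
  have e3 := add_mul_le_of_hasDerivAt_ge h0 (c := N / 4) (by linarith : t + 1 / 4 ≤ t + 1 / 2)
    (fun r hr => by
      have h5 := e1 r ⟨by linarith [hr.1], hr.2.le⟩
      have h6 : N * (1 / 4) ≤ N * (r - t) := by gcongr; linarith [hr.1]
      linarith)
  linarith [hy (t + 1 / 2)]

/-- Universal bound for positive solutions. -/
lemma le_of_large (h : IsSol a b f v v1 v2 v3) (ha : 0 ≤ a) (hv : ∀ t, 0 < v t)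
    (hz : ∀ t, v2 t - a ^ 2 * v t ≤ 0) {M : ℝ}
    (hlarge : ∀ t, M * Real.exp (-a) ≤ t →
      (a ^ 2 * b ^ 2 + 16 * (a ^ 2 + b ^ 2 + 2 * a) * Real.exp (2 * a) + 1) * t ≤ f t) (s : ℝ) :
    v s ≤ M := by
  by_contra! hM
  have hH := h.abs_deriv_le ha hv hz
  set V := v s
  have hV : 0 < V := hv s
  set E := Real.exp a
  have hE : 0 < E := Real.exp_pos _
  have hEi : Real.exp (-a) = E⁻¹ := Real.exp_neg a
  have hE2 : Real.exp (2 * a) = E ^ 2 := by rw [sq, ← Real.exp_add]; ring_nf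
  have hup : ∀ r ∈ Icc (s - 1) (s + 1), v r ≤ V * E := fun r hr => by
    refine (h.exp_harnack hH s r).trans ?_
    have : |r - s| ≤ 1 := abs_le.2 ⟨by linarith [hr.1], by linarith [hr.2]⟩
    exact mul_le_mul_of_nonneg_left (Real.exp_le_exp.2 (by nlinarith)) hV.le
  have hlo : ∀ r ∈ Icc (s - 1) (s + 1), V * E⁻¹ ≤ v r := fun r hr => by
    have h1 := h.exp_harnack hH r s
    have h2 : |s - r| ≤ 1 := abs_le.2 ⟨by linarith [hr.2], by linarith [hr.1]⟩
    have h3 : Real.exp (a * |s - r|) ≤ E := Real.exp_le_exp.2 (by nlinarith)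
    have h4 : V ≤ v r * E := h1.trans (by have := (hv r).le; gcongr)
    rwa [← div_eq_mul_inv, div_le_iff₀ hE]
  -- By Harnack v lies between V/E and VE near s, so N bounds f(v) - a²b²v from below. That is the
  -- second derivative of v'' - (a² + b²)v ≤ 0, whence v'' ≤ (a² + b²)VE - N/16 on a unit interval.
  -- N is chosen so that v' would then drop by more than 2aVE, which Harnack forbids.
  set N : ℝ := (16 * (a ^ 2 + b ^ 2 + 2 * a) * E ^ 2 + 1) * (V * E⁻¹)
  have hN : 0 ≤ N := by positivity
  have hd0 : ∀ t, HasDerivAt (fun t => v2 t - (a ^ 2 + b ^ 2) * v t)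
      (v3 t - (a ^ 2 + b ^ 2) * v1 t) t := fun t => (h.d2 t).sub ((h.d0 t).const_mul _)
  have hd1 : ∀ t, HasDerivAt (fun t => v3 t - (a ^ 2 + b ^ 2) * v1 t)
      (f (v t) - a ^ 2 * b ^ 2 * v t) t := fun t =>
    ((h.d3 t).sub ((h.d1 t).const_mul _)).congr_deriv (by ring)
  have hfN : ∀ r ∈ Icc (s - 1) (s + 1), N ≤ f (v r) - a ^ 2 * b ^ 2 * v r := by
    intro r hr
    have h1 := hlo r hr
    have h2 := hlarge (v r) (le_trans (by rw [hEi]; gcongr) h1)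
    rw [hE2] at h2
    have h3 : N ≤ (16 * (a ^ 2 + b ^ 2 + 2 * a) * E ^ 2 + 1) * v r :=
      mul_le_mul_of_nonneg_left h1 (by positivity)
    linarith
  have hu : ∀ t ∈ Icc (s - 1 / 2) (s + 1 / 2),
      v2 t - (a ^ 2 + b ^ 2) * v t ≤ -(N / 16) := by
    intro t ht
    refine le_neg_of_second_deriv_ge hd0 hd1 hN (fun r hr => hfN r ⟨?_, ?_⟩) fun r => ?_
    · linarith [hr.1, ht.1]
    · linarith [hr.2, ht.2]
    · have : 0 ≤ b ^ 2 * v r := by have := (hv r).le; positivity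
      linarith [hz r]
  have hv1 := le_add_mul_of_hasDerivAt_le h.d1 (c := -(N / 16) + (a ^ 2 + b ^ 2) * (V * E))
    (by linarith : s - 1 / 2 ≤ s + 1 / 2) (fun r hr => by
      have h1 := hu r ⟨hr.1.le, hr.2.le⟩
      have h2 : (a ^ 2 + b ^ 2) * v r ≤ (a ^ 2 + b ^ 2) * (V * E) :=
        mul_le_mul_of_nonneg_left (hup r ⟨by linarith [hr.1], by linarith [hr.2]⟩) (by positivity)
      linarith)
  have b1 := (abs_le.1 (hH (s + 1 / 2))).1
  have b2 := (abs_le.1 (hH (s - 1 / 2))).2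
  have b3 : a * v (s + 1 / 2) ≤ a * (V * E) :=
    mul_le_mul_of_nonneg_left (hup _ ⟨by linarith, by linarith⟩) ha
  have b4 : a * v (s - 1 / 2) ≤ a * (V * E) :=
    mul_le_mul_of_nonneg_left (hup _ ⟨by linarith, by linarith⟩) ha
  have hNe : N = 16 * (a ^ 2 + b ^ 2 + 2 * a) * (V * E) + V * E⁻¹ := by
    simp only [N]; field_simp
  have hp : 0 < V * E⁻¹ := by positivity
  nlinarith

end IsSol
end

/-! ### Bounded positive solutions: derivative bounds, symmetry, limits -/

noncomputable section

/-- Globally Lipschitz nonlinearities with the sign, ratio and growth properties used in the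
phase space analysis. -/
structure Admissible (a b K M a0 : ℝ) (f : ℝ → ℝ) : Prop where
  a_pos : 0 < a
  a_lt_b : a < b
  lip : MonotoneLipschitz K f
  zero : f 0 = 0
  a0_pos : 0 < a0
  lt : ∀ t, 0 < t → t < a0 → f t < a ^ 2 * b ^ 2 * t
  eq : f a0 = a ^ 2 * b ^ 2 * a0
  gt : ∀ t, a0 < t → a ^ 2 * b ^ 2 * t < f t
  ratio : ∀ s t, 0 < s → s ≤ t → f s * t ≤ f t * s
  large : ∀ t, M * Real.exp (-a) ≤ t →
    (a ^ 2 * b ^ 2 + 16 * (a ^ 2 + b ^ 2 + 2 * a) * Real.exp (2 * a) + 1) * t ≤ f t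

/-- Solutions with values in `(0, M]`. -/
structure PosSol (a b : ℝ) (f : ℝ → ℝ) (M : ℝ) (v v1 v2 v3 : ℝ → ℝ) : Prop where
  sol : IsSol a b f v v1 v2 v3
  pos : ∀ t, 0 < v t
  le : ∀ t, v t ≤ M

lemma forall_pos_or_forall_neg {φ : ℝ → ℝ} (hφ : Continuous φ) {s : Set ℝ} (hs : IsPreconnected s)
    (hne : ∀ x ∈ s, φ x ≠ 0) : (∀ x ∈ s, 0 < φ x) ∨ (∀ x ∈ s, φ x < 0) := by
  by_contra! hcon
  obtain ⟨⟨x, hx, hx0⟩, y, hy, hy0⟩ := hcon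
  obtain ⟨z, hz, hz0⟩ := hs.intermediate_value hx hy hφ.continuousOn ⟨hx0, hy0⟩
  exact hne z hz hz0

lemma exists_tendsto_of_deriv_nonpos {φ φ' : ℝ → ℝ} (h : ∀ t, HasDerivAt φ (φ' t) t) {c m : ℝ}
    (hn : ∀ t, c < t → φ' t ≤ 0) (hm : ∀ t, m ≤ φ t) :
    ∃ l, Tendsto φ atTop (𝓝 l) ∧ m ≤ l ∧ ∀ t, c ≤ t → l ≤ φ t := by
  have hanti : ∀ s t, c ≤ s → s ≤ t → φ t ≤ φ s := fun s t hs hst =>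
    le_of_hasDerivAt_nonpos h hst fun r hr => hn r (hs.trans_lt hr.1)
  have hA : Antitone fun t => φ (max c t) := fun s t hst =>
    hanti _ _ (le_max_left _ _) (max_le_max le_rfl hst)
  have ht := tendsto_atTop_ciInf hA ⟨m, by rintro _ ⟨t, rfl⟩; exact hm _⟩
  have ht' : Tendsto φ atTop (𝓝 (⨅ t, φ (max c t))) := by
    refine ht.congr' ?_
    filter_upwards [eventually_ge_atTop c] with t ht
    rw [max_eq_right ht]
  refine ⟨_, ht', ge_of_tendsto' ht' hm, fun t hct => le_of_tendsto ht' ?_⟩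
  filter_upwards [eventually_ge_atTop t] with s hs using hanti t s hct hs

namespace Admissible

variable {a b K M a0 : ℝ} {f : ℝ → ℝ}

lemma b_pos (hF : Admissible a b K M a0 f) : 0 < b := hF.a_pos.trans hF.a_lt_b

lemma nonneg (hF : Admissible a b K M a0 f) {t : ℝ} (ht : 0 ≤ t) : 0 ≤ f t := by
  rw [← hF.zero]; exact hF.lip.le _ _ ht

lemma eq_of_fixed (hF : Admissible a b K M a0 f) {t : ℝ} (ht : 0 < t)
    (h : f t = a ^ 2 * b ^ 2 * t) : t = a0 := by
  rcases lt_trichotomy t a0 with h1 | h1 | h1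
  · exact absurd h (hF.lt t ht h1).ne
  · exact h1
  · exact absurd h (hF.gt t h1).ne'

lemma le_of_le (hF : Admissible a b K M a0 f) {t : ℝ} (ht : 0 < t) (h : t ≤ a0) :
    f t ≤ a ^ 2 * b ^ 2 * t := by
  rcases h.lt_or_eq with h | rfl
  · exact (hF.lt t ht h).le
  · exact hF.eq.le

lemma ge_of_ge (hF : Admissible a b K M a0 f) {t : ℝ} (h : a0 ≤ t) :
    a ^ 2 * b ^ 2 * t ≤ f t := by
  rcases h.lt_or_eq with h | rfl
  · exact (hF.gt t h).le
  · exact hF.eq.ge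

end Admissible

namespace PosSol

variable {a b K M a0 : ℝ} {f v v1 v2 v3 u u1 u2 u3 : ℝ → ℝ}

lemma shift (h : PosSol a b f M v v1 v2 v3) (s : ℝ) :
    PosSol a b f M (fun t => v (s + t)) (fun t => v1 (s + t)) (fun t => v2 (s + t))
      (fun t => v3 (s + t)) := ⟨h.sol.shift s, fun _ => h.pos _, fun _ => h.le _⟩

lemma reflect (h : PosSol a b f M v v1 v2 v3) :
    PosSol a b f M (fun t => v (-t)) (fun t => -v1 (-t)) (fun t => v2 (-t)) (fun t => -v3 (-t)) :=
  ⟨h.sol.reflect, fun _ => h.pos _, fun _ => h.le _⟩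

lemma abs_le (h : PosSol a b f M v v1 v2 v3) (t : ℝ) : |v t| ≤ M := by
  rw [abs_of_pos (h.pos t)]; exact h.le t

lemma f_nonneg (hF : Admissible a b K M a0 f) (h : PosSol a b f M v v1 v2 v3) (t : ℝ) :
    0 ≤ f (v t) := hF.nonneg (h.pos t).le

lemma z_nonpos (hF : Admissible a b K M a0 f) (h : PosSol a b f M v v1 v2 v3) (t : ℝ) :
    v2 t - a ^ 2 * v t ≤ 0 :=
  h.sol.z_nonpos_of_bounded hF.b_pos.le (fun t => (h.pos t).le) (h.f_nonneg hF) h.le t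

lemma harnack (hF : Admissible a b K M a0 f) (h : PosSol a b f M v v1 v2 v3) (t : ℝ) :
    |v1 t| ≤ a * v t := h.sol.abs_deriv_le hF.a_pos.le h.pos (h.z_nonpos hF) t

/-- Maximum principle: y = -z - f(M)/b² satisfies y'' ≥ b²y. If y > 0 somewhere, then up to
reflection y grows without bound, so v'' and then v' tend to -∞, against |v'| ≤ aM. -/
lemma z_ge (hF : Admissible a b K M a0 f) (h : PosSol a b f M v v1 v2 v3) (t : ℝ) :
    -(f M / b ^ 2) ≤ v2 t - a ^ 2 * v t := by
  by_contra! hlt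
  wlog hz1 : v3 t - a ^ 2 * v1 t ≤ 0 generalizing v v1 v2 v3 t
  · exact this h.reflect (-t) (by simpa using hlt) (by simp only [neg_neg]; linarith)
  have hb := hF.b_pos
  set y : ℝ → ℝ := fun s => -(v2 s - a ^ 2 * v s) - f M / b ^ 2
  have hy0 : ∀ s, HasDerivAt y (-(v3 s - a ^ 2 * v1 s)) s := fun s =>
    (h.sol.dz s).neg.sub_const _
  have hy1 : ∀ s, HasDerivAt (fun s => -(v3 s - a ^ 2 * v1 s))
      (-(b ^ 2 * (v2 s - a ^ 2 * v s) + f (v s))) s := fun s => (h.sol.dz1 s).neg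
  have hy2 : ∀ s, b ^ 2 * y s ≤ -(b ^ 2 * (v2 s - a ^ 2 * v s) + f (v s)) := fun s => by
    have e : b ^ 2 * y s = -(b ^ 2 * (v2 s - a ^ 2 * v s)) - f M := by
      simp only [y]; field_simp
    have := hF.lip.le _ _ (h.le s)
    linarith
  have hyt : 0 < y t := by simp only [y]; linarith
  have key : ∀ s, t ≤ s → 0 ≤ -(v3 s - a ^ 2 * v1 s) := fun s hs =>
    (nonneg_of_second_deriv_ge hy0 hy1 hb.le hs (fun r _ => hy2 r) hyt.le (by linarith)).2
  have hmono : ∀ s, t ≤ s → y t ≤ y s := fun s hs =>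
    le_of_hasDerivAt_nonneg hy0 hs fun r hr => key r hr.1.le
  have t1 : Tendsto (fun s => -(v3 s - a ^ 2 * v1 s)) atTop atTop :=
    tendsto_atTop_of_deriv_ge hy1 (T := t) (c := b ^ 2 * y t) (by positivity) fun s hs =>
      (mul_le_mul_of_nonneg_left (hmono s hs) (sq_nonneg b)).trans (hy2 s)
  obtain ⟨T1, hT1⟩ := eventually_atTop.1 (t1.eventually (eventually_ge_atTop 1))
  have t2 : Tendsto y atTop atTop := tendsto_atTop_of_deriv_ge hy0 one_pos hT1
  obtain ⟨T2, hT2⟩ := eventually_atTop.1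
    (t2.eventually (eventually_ge_atTop (a ^ 2 * M + 1 - f M / b ^ 2)))
  have t3 : Tendsto (fun s => -v1 s) atTop atTop :=
    tendsto_atTop_of_deriv_ge (fun s => (h.sol.d1 s).neg) one_pos (T := T2) fun s hs => by
      have h1 := hT2 s hs
      have h2 : a ^ 2 * v s ≤ a ^ 2 * M := mul_le_mul_of_nonneg_left (h.le s) (sq_nonneg a)
      simp only [y] at h1
      linarith
  refine not_bddAbove_of_tendsto t3 (C := a * M) fun s => ?_
  have h1 := (_root_.abs_le.1 (h.harnack hF s)).1
  have h2 : a * v s ≤ a * M := mul_le_mul_of_nonneg_left (h.le s) hF.a_pos.le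
  linarith

/-- Uniform bounds on derivatives. -/
lemma exists_bound (hF : Admissible a b K M a0 f) : ∃ C : ℝ, ∀ v v1 v2 v3 : ℝ → ℝ,
    PosSol a b f M v v1 v2 v3 → ∀ t, |v1 t| ≤ C ∧ |v2 t| ≤ C ∧ |v3 t| ≤ C ∧
      |(a ^ 2 + b ^ 2) * v2 t - a ^ 2 * b ^ 2 * v t + f (v t)| ≤ C := by
  have ha := hF.a_pos
  have hb := hF.b_pos
  set Z := f M / b ^ 2
  set Z1 := 2 * Z + (b ^ 2 * Z + f M)
  refine ⟨max (a * M) (max (a ^ 2 * M + Z) (max (Z1 + a ^ 2 * (a * M))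
    ((a ^ 2 + b ^ 2) * (a ^ 2 * M + Z) + a ^ 2 * b ^ 2 * M + f M))), ?_⟩
  intro v v1 v2 v3 h t
  have hM : 0 < M := (h.pos 0).trans_le (h.le 0)
  have hfM : 0 ≤ f M := hF.nonneg hM.le
  have hZ : 0 ≤ Z := by positivity
  have hz : ∀ t, |v2 t - a ^ 2 * v t| ≤ Z := fun t =>
    _root_.abs_le.2 ⟨h.z_ge hF t, (h.z_nonpos hF t).trans hZ⟩
  have hfv : ∀ t, |f (v t)| ≤ f M := fun t => by
    rw [abs_of_nonneg (h.f_nonneg hF t)]; exact hF.lip.le _ _ (h.le t)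
  have hz2 : ∀ t, |b ^ 2 * (v2 t - a ^ 2 * v t) + f (v t)| ≤ b ^ 2 * Z + f M := fun t => by
    refine (abs_add_le _ _).trans (add_le_add ?_ (hfv t))
    rw [abs_mul, abs_of_nonneg (sq_nonneg b)]
    exact mul_le_mul_of_nonneg_left (hz t) (sq_nonneg b)
  have hz1 : ∀ t, |v3 t - a ^ 2 * v1 t| ≤ Z1 :=
    abs_deriv_le_of_bounds h.sol.dz h.sol.dz1 hz hz2
  have hv1 : |v1 t| ≤ a * M :=
    (h.harnack hF t).trans (mul_le_mul_of_nonneg_left (h.le t) ha.le)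
  have hv2 : |v2 t| ≤ a ^ 2 * M + Z := by
    have h1 := _root_.abs_le.1 (hz t)
    have h2 : a ^ 2 * v t ≤ a ^ 2 * M := mul_le_mul_of_nonneg_left (h.le t) (sq_nonneg a)
    have h3 : 0 ≤ a ^ 2 * v t := mul_nonneg (sq_nonneg a) (h.pos t).le
    exact _root_.abs_le.2 ⟨by linarith [h1.1, mul_pos (pow_pos ha 2) hM], by linarith [h1.2]⟩
  refine ⟨hv1.trans (le_max_left _ _),
    hv2.trans ((le_max_left _ _).trans (le_max_right _ _)), ?_, ?_⟩
  · refine le_trans ?_ ((le_max_left _ _).trans ((le_max_right _ _).trans (le_max_right _ _)))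
    have h1 := _root_.abs_le.1 (hz1 t)
    have h2 := _root_.abs_le.1 hv1
    have h3 : 0 < a ^ 2 := by positivity
    exact _root_.abs_le.2 ⟨by nlinarith [h1.1, h2.1], by nlinarith [h1.2, h2.2]⟩
  · refine le_trans ?_ ((le_max_right _ _).trans ((le_max_right _ _).trans (le_max_right _ _)))
    refine (abs_add_le _ _).trans (add_le_add ?_ (hfv t))
    refine (abs_sub _ _).trans (add_le_add ?_ ?_)
    · rw [abs_mul, abs_of_nonneg (by positivity : 0 ≤ a ^ 2 + b ^ 2)]
      exact mul_le_mul_of_nonneg_left hv2 (by positivity)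
    · rw [abs_mul, abs_of_nonneg (by positivity : 0 ≤ a ^ 2 * b ^ 2)]
      exact mul_le_mul_of_nonneg_left (h.abs_le t) (by positivity)

lemma eq_of_eq (hF : Admissible a b K M a0 f) (hu : PosSol a b f M u u1 u2 u3)
    (hv : PosSol a b f M v v1 v2 v3) {s t : ℝ} (h0 : u s = v t) (h1 : u1 s = v1 t) (r : ℝ) :
    u (s + r) = v (t + r) ∧ u1 (s + r) = v1 (t + r) :=
  IsSol.eq_of_bounded' hF.lip hF.a_pos hF.b_pos.le hu.sol hv.sol hu.abs_le hv.abs_le h0 h1 r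

/-- Bounded positive solutions are symmetric about their critical points. -/
lemma symm (hF : Admissible a b K M a0 f) (h : PosSol a b f M v v1 v2 v3) {c : ℝ}
    (hc : v1 c = 0) (r : ℝ) : v (c + r) = v (c - r) ∧ v1 (c + r) = -v1 (c - r) := by
  -- At a critical point v and its mirror image share both value and slope.
  have := h.eq_of_eq hF h.reflect (s := c) (t := -c) (by simp) (by simp [hc]) r
  simpa [sub_eq_add_neg, add_comm] using this

/-- The reflections about c and d compose to the translation by 2(d - c). -/
lemma periodic (hF : Admissible a b K M a0 f) (h : PosSol a b f M v v1 v2 v3) {c d : ℝ}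
    (hc : v1 c = 0) (hd : v1 d = 0) :
    Function.Periodic v (2 * (d - c)) ∧ Function.Periodic v1 (2 * (d - c)) := by
  have key : ∀ t, v (t + 2 * (d - c)) = v t ∧ v1 (t + 2 * (d - c)) = v1 t := by
    intro t
    obtain ⟨e1, e1'⟩ := h.symm hF hd (t + d - 2 * c)
    obtain ⟨e2, e2'⟩ := h.symm hF hc (c - t)
    have i1 : d + (t + d - 2 * c) = t + 2 * (d - c) := by ring
    have i2 : d - (t + d - 2 * c) = c + (c - t) := by ring
    have i3 : c - (c - t) = t := by ring
    rw [i1, i2] at e1 e1'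
    rw [i3] at e2 e2'
    exact ⟨e1.trans e2, by rw [e1', e2', neg_neg]⟩
  exact ⟨fun t => (key t).1, fun t => (key t).2⟩

lemma deriv_continuous (h : PosSol a b f M v v1 v2 v3) : Continuous v1 :=
  continuous_iff_continuousAt.2 fun t => (h.sol.d1 t).continuousAt

lemma continuous (h : PosSol a b f M v v1 v2 v3) : Continuous v :=
  continuous_iff_continuousAt.2 fun t => (h.sol.d0 t).continuousAt

/-- The limit of a bounded positive solution is an equilibrium. -/
lemma tendsto_derivs (hF : Admissible a b K M a0 f) (h : PosSol a b f M v v1 v2 v3) {l : ℝ}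
    (hl : Tendsto v atTop (𝓝 l)) : Tendsto v1 atTop (𝓝 0) ∧ Tendsto v2 atTop (𝓝 0) ∧
      Tendsto v3 atTop (𝓝 0) ∧ f l = a ^ 2 * b ^ 2 * l := by
  obtain ⟨C, hC⟩ := exists_bound hF
  have hC := hC v v1 v2 v3 h
  have t1 := tendsto_deriv_zero_of_tendsto h.sol.d0 h.sol.d1 (fun t => (hC t).2.1) hl
  have t2 := tendsto_deriv_zero_of_tendsto h.sol.d1 h.sol.d2 (fun t => (hC t).2.2.1) t1
  have t3 := tendsto_deriv_zero_of_tendsto h.sol.d2 h.sol.d3 (fun t => (hC t).2.2.2) t2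
  refine ⟨t1, t2, t3, ?_⟩
  -- m is the limit of v''''; if it were nonzero, v''' would be unbounded.
  set m : ℝ := f l - a ^ 2 * b ^ 2 * l
  have t4 : Tendsto (fun t => (a ^ 2 + b ^ 2) * v2 t - a ^ 2 * b ^ 2 * v t + f (v t)) atTop
      (𝓝 m) := by
    have := ((t2.const_mul (a ^ 2 + b ^ 2)).sub (hl.const_mul (a ^ 2 * b ^ 2))).add
      ((hF.lip.continuous.tendsto l).comp hl)
    have e : m = (a ^ 2 + b ^ 2) * 0 - a ^ 2 * b ^ 2 * l + f l := by simp only [m]; ring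
    rw [e]
    exact this
  have hm : m = 0 := by
    rcases lt_trichotomy m 0 with hm | hm | hm
    · exfalso
      obtain ⟨T, hT⟩ := eventually_atTop.1 (t4.eventually (gt_mem_nhds (by linarith : m < m / 2)))
      exact not_bddAbove_of_tendsto (C := C) (tendsto_atTop_of_deriv_ge
        (φ := fun t => -v3 t) (T := T) (c := -(m / 2))
        (fun t => (h.sol.d3 t).neg) (by linarith) (fun t ht => by linarith [hT t ht]))
        fun t => by linarith [(_root_.abs_le.1 (hC t).2.2.1).1]
    · exact hm
    · exfalso
      obtain ⟨T, hT⟩ := eventually_atTop.1 (t4.eventually (lt_mem_nhds (by linarith : m / 2 < m)))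
      exact not_bddAbove_of_tendsto (C := C) (tendsto_atTop_of_deriv_ge (T := T) (c := m / 2)
        h.sol.d3 (by linarith) (fun t ht => (hT t ht).le))
        fun t => (_root_.abs_le.1 (hC t).2.2.1).2
  simp only [m] at hm
  linarith

end PosSol
end

/-! ### Classification by critical points -/

noncomputable section
namespace PosSol

variable {a b K M a0 : ℝ} {f v v1 v2 v3 u u1 u2 u3 : ℝ → ℝ}

lemma hasDerivAt_u (h : PosSol a b f M v v1 v2 v3) (t : ℝ) :
    HasDerivAt (fun s => v2 s - (a ^ 2 + b ^ 2) * v s) (v3 t - (a ^ 2 + b ^ 2) * v1 t) t :=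
  (h.sol.d2 t).sub ((h.sol.d0 t).const_mul _)

/-- The function v'' - (a² + b²)v is convex where v ≥ a₀ and concave where v ≤ a₀, which is what
rules out nonconstant solutions on one side of a₀. -/
lemma hasDerivAt_u1 (h : PosSol a b f M v v1 v2 v3) (t : ℝ) :
    HasDerivAt (fun s => v3 s - (a ^ 2 + b ^ 2) * v1 s) (f (v t) - a ^ 2 * b ^ 2 * v t) t :=
  ((h.sol.d3 t).sub ((h.sol.d1 t).const_mul _)).congr_deriv (by ring)

lemma eq_a0_of_deriv_eq_zero (hF : Admissible a b K M a0 f) (h : PosSol a b f M v v1 v2 v3)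
    (h0 : ∀ t, v3 t - (a ^ 2 + b ^ 2) * v1 t = 0) (t : ℝ) : v t = a0 := by
  have h1 := (h.hasDerivAt_u1 t).unique
    ((hasDerivAt_const t (0:ℝ)).congr_of_eventuallyEq (Eventually.of_forall h0))
  exact hF.eq_of_fixed (h.pos t) (by linarith)

/-- The convex function v'' - (a² + b²)v = z - b²v is bounded above by 0, hence constant, so f(v) =
a²b²v throughout. -/
lemma eq_a0_of_ge (hF : Admissible a b K M a0 f) (h : PosSol a b f M v v1 v2 v3)
    (hge : ∀ t, a0 ≤ v t) : ∀ t, v t = a0 := by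
  refine h.eq_a0_of_deriv_eq_zero hF (deriv_eq_zero_of_convex_of_bddAbove h.hasDerivAt_u
    h.hasDerivAt_u1 (fun t => sub_nonneg.2 (hF.ge_of_ge (hge t))) (C := 0) fun t => ?_)
  have h1 := h.z_nonpos hF t
  have h2 : 0 ≤ b ^ 2 * v t := mul_nonneg (sq_nonneg b) (h.pos t).le
  linarith

/-- Now the negative of that function is convex; its upper bound is the lower bound for z. -/
lemma eq_a0_of_le (hF : Admissible a b K M a0 f) (h : PosSol a b f M v v1 v2 v3)
    (hle : ∀ t, v t ≤ a0) : ∀ t, v t = a0 := by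
  have key := deriv_eq_zero_of_convex_of_bddAbove (fun t => (h.hasDerivAt_u t).neg)
    (fun t => (h.hasDerivAt_u1 t).neg) (C := f M / b ^ 2 + b ^ 2 * M)
    (fun t => by linarith [hF.le_of_le (h.pos t) (hle t)]) fun t => by
      have h1 := h.z_ge hF t
      have h2 : b ^ 2 * v t ≤ b ^ 2 * M := mul_le_mul_of_nonneg_left (h.le t) (sq_nonneg b)
      simp only [Pi.neg_apply]
      linarith
  exact h.eq_a0_of_deriv_eq_zero hF fun t => neg_eq_zero.1 (key t)

lemma limit_pos_eq (hF : Admissible a b K M a0 f) (h : PosSol a b f M v v1 v2 v3) {l : ℝ}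
    (hl : Tendsto v atTop (𝓝 l)) (hpos : 0 < l) : l = a0 :=
  hF.eq_of_fixed hpos (h.tendsto_derivs hF hl).2.2.2

lemma deriv_eq_zero_of_const (h : PosSol a b f M v v1 v2 v3) {c : ℝ} (hc : ∀ t, v t = c) (t : ℝ) :
    v1 t = 0 :=
  (h.sol.d0 t).unique ((hasDerivAt_const t c).congr_of_eventuallyEq (Eventually.of_forall hc))

/-- A bounded positive solution that is nondecreasing on a half line about which it is symmetric,
or on the whole line, is constant. -/
lemma eq_a0_of_eventually_nondecreasing (hF : Admissible a b K M a0 f)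
    (h : PosSol a b f M v v1 v2 v3) {c : ℝ} (hn : ∀ t, c < t → 0 ≤ v1 t)
    (hc : ∀ t, t < c → v t ≤ v c ∨ v t = v (2 * c - t)) : ∀ t, v t = a0 := by
  obtain ⟨l, hl, -, hle⟩ := exists_tendsto_of_deriv_nonpos (φ := fun t => -v t)
    (fun t => (h.sol.d0 t).neg) (c := c) (m := -M) (fun t ht => by linarith [hn t ht])
    (fun t => by linarith [h.le t])
  have hl' : Tendsto v atTop (𝓝 (-l)) := by simpa using hl.neg
  have hvl : ∀ t, c ≤ t → v t ≤ -l := fun t ht => by linarith [hle t ht]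
  -- The limit is positive, hence equal to a₀, and it is approached from below; so v ≤ a₀
  -- everywhere.
  have hla := h.limit_pos_eq hF hl' ((h.pos c).trans_le (hvl c le_rfl))
  rw [hla] at hvl
  refine h.eq_a0_of_le hF fun t => ?_
  rcases le_or_gt c t with ht | ht
  · exact hvl t ht
  · rcases hc t ht with h1 | h1
    · exact h1.trans (hvl c le_rfl)
    · rw [h1]; exact hvl _ (by linarith)

lemma exists_deriv_eq_zero (hF : Admissible a b K M a0 f) (h : PosSol a b f M v v1 v2 v3) :
    ∃ c, v1 c = 0 := by
  by_contra! hne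
  have key : ∀ {v v1 v2 v3 : ℝ → ℝ}, PosSol a b f M v v1 v2 v3 → (∀ t, 0 < v1 t) → False := by
    intro v v1 v2 v3 h hpos
    have := h.eq_a0_of_eventually_nondecreasing hF (c := 0) (fun t _ => (hpos t).le) fun t ht =>
      Or.inl (le_of_hasDerivAt_nonneg h.sol.d0 ht.le fun r _ => (hpos r).le)
    exact (hpos 0).ne' (h.deriv_eq_zero_of_const this 0)
  rcases forall_pos_or_forall_neg h.deriv_continuous isPreconnected_univ (fun t _ => hne t)
    with h1 | h1
  · exact key h fun t => h1 t (mem_univ t)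
  · exact key h.reflect fun t => by linarith [h1 (-t) (mem_univ _)]

/-- A bounded positive solution with exactly one critical point increases before it, decreases
after it and is homoclinic to zero. -/
lemma homoclinic_of_unique (hF : Admissible a b K M a0 f) (h : PosSol a b f M v v1 v2 v3) {c : ℝ}
    (hc : v1 c = 0) (hu : ∀ t, v1 t = 0 → t = c) :
    (∀ t, c < t → v1 t < 0) ∧ Tendsto v atTop (𝓝 0) := by
  have hsym : ∀ t, v t = v (2 * c - t) := fun t => by
    have := (h.symm hF hc (t - c)).1
    rwa [show c + (t - c) = t by ring, show c - (t - c) = 2 * c - t by ring] at this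
  have hnc : ¬ ∀ t, v t = a0 := fun hconst => by
    have := hu (c + 1) (h.deriv_eq_zero_of_const hconst _)
    linarith
  rcases forall_pos_or_forall_neg h.deriv_continuous (isPreconnected_Ioi (a := c))
    (fun t ht h0 => (mem_Ioi.1 ht).ne' (hu t h0)) with h1 | h1
  · exact absurd (h.eq_a0_of_eventually_nondecreasing hF (c := c) (fun t ht => (h1 t ht).le)
      fun t _ => Or.inr (hsym t)) hnc
  · refine ⟨fun t ht => h1 t ht, ?_⟩
    obtain ⟨l, hl, hl0, hle⟩ := exists_tendsto_of_deriv_nonpos h.sol.d0 (c := c) (m := 0)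
      (fun t ht => (h1 t ht).le) (fun t => (h.pos t).le)
    rcases hl0.eq_or_lt with rfl | hlpos
    · exact hl
    -- A positive limit is a₀, approached from above on both sides of c by symmetry; then v ≥ a₀ and
    -- v is constant.
    · have hla := h.limit_pos_eq hF hl hlpos
      rw [hla] at hle
      refine absurd (h.eq_a0_of_ge hF fun t => ?_) hnc
      rcases le_total c t with ht | ht
      · exact hle t ht
      · rw [hsym]; exact hle _ (by linarith)

/-- Classification of bounded positive solutions by their critical points. -/
lemma trichotomy (hF : Admissible a b K M a0 f) (h : PosSol a b f M v v1 v2 v3) :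
    (∀ t, v t = a0) ∨ ((¬ ∀ t, v t = a0) ∧ ∃ c d, c < d ∧ v1 c = 0 ∧ v1 d = 0) ∨
      (∃ c, v1 c = 0 ∧ (∀ t, c < t → v1 t < 0) ∧ Tendsto v atTop (𝓝 0)) := by
  by_cases hconst : ∀ t, v t = a0
  · exact Or.inl hconst
  refine Or.inr ?_
  obtain ⟨c, hc⟩ := h.exists_deriv_eq_zero hF
  by_cases hu : ∀ t, v1 t = 0 → t = c
  · exact Or.inr ⟨c, hc, h.homoclinic_of_unique hF hc hu⟩
  · push Not at hu
    obtain ⟨d, hd, hdc⟩ := hu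
    refine Or.inl ⟨hconst, ?_⟩
    rcases lt_or_gt_of_ne hdc with h1 | h1
    · exact ⟨d, c, h1, hd, hc⟩
    · exact ⟨c, d, h1, hc, hd⟩

lemma tendsto_cocompact_zero (hF : Admissible a b K M a0 f) (h : PosSol a b f M v v1 v2 v3) {c : ℝ}
    (hc : v1 c = 0) (hl : Tendsto v atTop (𝓝 0)) :
    Tendsto v (cocompact ℝ) (𝓝 0) ∧ Tendsto v1 (cocompact ℝ) (𝓝 0) ∧
      Tendsto v2 (cocompact ℝ) (𝓝 0) ∧ Tendsto v3 (cocompact ℝ) (𝓝 0) := by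
  obtain ⟨t1, t2, t3, -⟩ := h.tendsto_derivs hF hl
  have hsym : (fun t => v (-t)) = fun t => v (2 * c + t) := by
    funext t
    have := (h.symm hF hc (-t - c)).1
    rwa [show c + (-t - c) = -t by ring, show c - (-t - c) = 2 * c + t by ring] at this
  have hl' : Tendsto (fun t => v (-t)) atTop (𝓝 0) := by
    rw [hsym]
    exact hl.comp (tendsto_atTop_add_const_left _ (2 * c) tendsto_id)
  obtain ⟨s1, s2, s3, -⟩ := h.reflect.tendsto_derivs hF hl'
  have hbot : ∀ φ : ℝ → ℝ, Tendsto (fun t => φ (-t)) atTop (𝓝 0) → Tendsto φ atBot (𝓝 0) := by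
    intro φ hφ
    have := hφ.comp tendsto_neg_atBot_atTop
    simpa [Function.comp_def] using this
  rw [cocompact_eq_atBot_atTop]
  refine ⟨(hbot v hl').sup hl, (hbot v1 ?_).sup t1, (hbot v2 s2).sup t2, (hbot v3 ?_).sup t3⟩
  · simpa using s1.neg
  · simpa using s3.neg

lemma exists_min_of_periodic (h : PosSol a b f M v v1 v2 v3) {P : ℝ} (hP : 0 < P)
    (hper : Function.Periodic v P) : ∃ t, v1 t = 0 ∧ ∀ s, v t ≤ v s := by
  obtain ⟨t, -, ht⟩ := (isCompact_Icc (a := (0:ℝ)) (b := P)).exists_isMinOn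
    (nonempty_Icc.2 hP.le) h.continuous.continuousOn
  have hmin : ∀ s, v t ≤ v s := fun s => by
    obtain ⟨y, hy, hys⟩ := hper.exists_mem_Ico₀ hP s
    rw [hys]; exact ht (Ico_subset_Icc_self hy)
  have hloc : IsLocalMin v t := Eventually.of_forall hmin
  exact ⟨t, hloc.hasDerivAt_eq_zero (h.sol.d0 t), hmin⟩

end PosSol
end

/-! ### Shooting for solutions with prescribed minimum -/

noncomputable section

variable {a b K M a0 : ℝ} {f v v1 v2 v3 : ℝ → ℝ}

lemma isSol_zero (h0 : f 0 = 0) (a b : ℝ) :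
    IsSol a b f (fun _ => 0) (fun _ => 0) (fun _ => 0) (fun _ => 0) :=
  ⟨fun t => hasDerivAt_const t 0, fun t => hasDerivAt_const t 0, fun t => hasDerivAt_const t 0,
    fun t => (hasDerivAt_const t (0:ℝ)).congr_deriv (by simp [h0])⟩

lemma IsSol.even (hf : MonotoneLipschitz K f) (ha : 0 ≤ a) (hb : 0 ≤ b)
    (h : IsSol a b f v v1 v2 v3) (h1 : v1 0 = 0) (h3 : v3 0 = 0) (t : ℝ) : v (-t) = v t :=
  (IsSol.eq_of_data hf ha hb h.reflect h (by simp) (by simp [h1]) (by simp) (by simp [h3]) t).1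

/-- A solution that lies in the positivity cone at some time stays nonnegative afterwards. -/
lemma IsSol.nonneg_of_cone (hf : MonotoneLipschitz K f) (h0 : f 0 = 0) (ha : 0 ≤ a) (hb : 0 ≤ b)
    (h : IsSol a b f v v1 v2 v3) {s t : ℝ} (c0 : 0 ≤ v s) (c1 : 0 ≤ v1 s)
    (c2 : 0 ≤ v2 s - a ^ 2 * v s) (c3 : 0 ≤ v3 s - a ^ 2 * v1 s) (hst : s ≤ t) : 0 ≤ v t := by
  have := (IsSol.comparison hf ha hb (isSol_zero h0 a b) (h.shift s) (by simpa using c0)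
    (by simpa using c1) (by simpa using c2) (by simpa using c3) (t - s) (by linarith)).1
  simpa using this

namespace Admissible

/-- This keeps the energy positive for all shooting parameters up to (a²b²α - f(α))/b². With D =
a²b²α - f(α), monotonicity of f(t)/t gives f(t) ≤ f(α)t/α below α, and integrating yields potential
≥ Dα. Moreover D ≤ a²b²α and a < b give (D/b²)² < Dα. -/
lemma potential_gt (hF : Admissible a b K M a0 f) {α : ℝ} (hα : 0 < α) (hα0 : α < a0) :
    ((a ^ 2 * b ^ 2 * α - f α) / b ^ 2) ^ 2 < potential a b f α := by
  have ha := hF.a_pos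
  have hb := hF.b_pos
  set D := a ^ 2 * b ^ 2 * α - f α
  have hD : 0 < D := sub_pos.2 (hF.lt α hα hα0)
  have hDle : D ≤ a ^ 2 * b ^ 2 * α := by simp only [D]; linarith [hF.nonneg hα.le]
  have key := le_of_hasDerivAt_nonneg (φ := fun t => potential a b f t - D / α * t ^ 2)
    (φ' := fun t => 2 * (a ^ 2 * b ^ 2 * t - f t) - D / α * (2 * t))
    (fun t => ((hasDerivAt_potential hF.lip.continuous t).sub
      ((hasDerivAt_pow 2 t).const_mul (D / α))).congr_deriv (by simp)) hα.le (fun t ht => by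
      have h1 := hF.ratio t α ht.1 ht.2.le
      have h2 : D / α * (2 * t) = 2 * (a ^ 2 * b ^ 2 * t) - 2 * (f α * t / α) := by
        simp only [D]; field_simp
      have h3 : f t ≤ f α * t / α := by rwa [le_div_iff₀ hα]
      linarith)
  have h4 : D / α * α ^ 2 = D * α := by field_simp
  simp only [potential_zero, h4] at key
  have h5 : D * α ≤ potential a b f α := by linarith
  refine lt_of_lt_of_le ?_ h5
  have hab : a ^ 2 < b ^ 2 := by
    have := hF.a_lt_b
    gcongr
  rw [div_pow, div_lt_iff₀ (by positivity), sq D, mul_assoc]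
  refine mul_lt_mul_of_pos_left (hDle.trans_lt ?_) hD
  have : a ^ 2 * (b ^ 2 * α) < b ^ 2 * (b ^ 2 * α) := mul_lt_mul_of_pos_right hab (by positivity)
  linarith

/-- With `v(0) = α < a₀` and `v'(0) = v''(0) = v'''(0) = 0` the solution becomes negative. -/
lemma exists_neg_of_second_deriv_zero (hF : Admissible a b K M a0 f) {α : ℝ} (hα : 0 < α)
    (hα0 : α < a0) (h : IsSol a b f v v1 v2 v3) (h0 : v 0 = α) (h1 : v1 0 = 0) (h2 : v2 0 = 0)
    (h3 : v3 0 = 0) : ∃ t, 0 ≤ t ∧ v t < 0 := by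
  by_contra! hnn
  have hD : 0 < a ^ 2 * b ^ 2 * α - f α := sub_pos.2 (hF.lt α hα hα0)
  set w : ℝ → ℝ := fun t => α - v t
  -- The shift by a²α makes w'' = a²w + z exactly. The source of the z equation is at least D > 0 as
  -- long as w ≥ 0, so repeated integration drives w to infinity.
  set z : ℝ → ℝ := fun t => -(v2 t - a ^ 2 * v t) - a ^ 2 * α
  have hw : ∀ t, HasDerivAt w (-v1 t) t := fun t => (h.d0 t).const_sub α
  have hw1 : ∀ t, HasDerivAt (fun t => -v1 t) (-v2 t) t := fun t => (h.d1 t).neg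
  have hz : ∀ t, HasDerivAt z (-(v3 t - a ^ 2 * v1 t)) t := fun t => (h.dz t).neg.sub_const _
  have hz1 : ∀ t, HasDerivAt (fun t => -(v3 t - a ^ 2 * v1 t))
      (b ^ 2 * z t + (a ^ 2 * b ^ 2 * α - f (v t))) t := fun t =>
    (h.dz1 t).neg.congr_deriv (by simp only [z]; ring)
  have hr : ∀ t, 0 ≤ w t → a ^ 2 * b ^ 2 * α - f α ≤ a ^ 2 * b ^ 2 * α - f (v t) := fun t ht => by
    have := hF.lip.le (v t) α (by simp only [w] at ht; linarith)
    linarith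
  have hcone := cone_nonneg hF.a_pos.le hF.b_pos.le hF.lip.nonneg hw hw1
    (fun t => by simp only [w, z]; linarith) hz hz1 (fun t _ ht => hD.le.trans (hr t ht))
    (fun t _ ht => by
      have := hF.lip.sub_le α (v t) (by simp only [w] at ht; linarith)
      simp only [w]
      linarith) (by simp [w, h0]) (by simp [h1]) (by simp [z, h0, h2]) (by simp [h1, h3])
  have t1 := tendsto_atTop_of_deriv_ge hz1 hD (T := 0) fun t ht => by
    have h1 := (hcone t ht).2.2.1
    have h2 := hr t (hcone t ht).1
    have h3 : 0 ≤ b ^ 2 * z t := mul_nonneg (sq_nonneg b) h1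
    linarith
  obtain ⟨T1, hT1⟩ := eventually_atTop.1 (t1.eventually (eventually_ge_atTop 1))
  have t2 := tendsto_atTop_of_deriv_ge hz one_pos hT1
  obtain ⟨T2, hT2⟩ := eventually_atTop.1 (t2.eventually (eventually_ge_atTop 1))
  have t3 := tendsto_atTop_of_deriv_ge hw1 one_pos (T := max T2 0) fun t ht => by
    have h1 := hT2 t ((le_max_left _ _).trans ht)
    have h2 := (hcone t ((le_max_right _ _).trans ht)).1
    have h3 : 0 ≤ a ^ 2 * w t := mul_nonneg (sq_nonneg a) h2
    simp only [w, z] at *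
    linarith
  obtain ⟨T3, hT3⟩ := eventually_atTop.1 (t3.eventually (eventually_ge_atTop 1))
  have t4 := tendsto_atTop_of_deriv_ge hw one_pos hT3
  obtain ⟨t, ht, ht0⟩ := ((t4.eventually (eventually_gt_atTop α)).and
    (eventually_ge_atTop 0)).exists
  have := hnn t ht0
  simp only [w] at ht
  linarith

/-- With `v(0) = α < a₀`, `v'(0) = v'''(0) = 0` and `b² v''(0) = B α - f(α)` the solution stays
above `α`. -/
lemma le_of_second_deriv_eq (hF : Admissible a b K M a0 f) {α : ℝ} (hα : 0 < α)
    (hα0 : α < a0) (h : IsSol a b f v v1 v2 v3) (h0 : v 0 = α) (h1 : v1 0 = 0)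
    (h2 : v2 0 = (a ^ 2 * b ^ 2 * α - f α) / b ^ 2) (h3 : v3 0 = 0) {t : ℝ} (ht : 0 ≤ t) :
    α ≤ v t := by
  have hb := hF.b_pos
  have hD : 0 < a ^ 2 * b ^ 2 * α - f α := sub_pos.2 (hF.lt α hα hα0)
  set σ := (a ^ 2 * b ^ 2 * α - f α) / b ^ 2
  have hσ : 0 < σ := by positivity
  have hσb : b ^ 2 * σ = a ^ 2 * b ^ 2 * α - f α := by simp only [σ]; field_simp
  -- The constant makes z(0) = 0 and the source f(v) - f(α), because b²σ = a²b²α - f(α). The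
  -- discarded term in w'' = a²w + z + σ is σ ≥ 0.
  set z : ℝ → ℝ := fun t => v2 t - a ^ 2 * v t + (a ^ 2 * α - σ)
  have hz : ∀ t, HasDerivAt z (v3 t - a ^ 2 * v1 t) t := fun t => (h.dz t).add_const _
  have hcone := cone_nonneg hF.a_pos.le hb.le hF.lip.nonneg (w := fun t => v t - α)
    (r := fun t => f (v t) - f α) (fun t => (h.d0 t).sub_const α) h.d1
    (fun t => by simp only [z]; linarith) hz
    (fun t => (h.dz1 t).congr_deriv (by
      have e : b ^ 2 * z t = b ^ 2 * (v2 t - a ^ 2 * v t) + (a ^ 2 * b ^ 2 * α - b ^ 2 * σ) := by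
        simp only [z]; ring
      rw [e, hσb]; ring))
    (fun t _ ht => sub_nonneg.2 (hF.lip.le _ _ (by linarith)))
    (fun t _ ht => by have := hF.lip.sub_le (v t) α (by linarith); linarith)
    (by simp [h0]) h1.ge (by simp [z, h0, h2]) (by simp [h1, h3]) t ht
  linarith [hcone.1]

/-- A positive solution at the threshold of the shooting set satisfies `z ≤ 0`; otherwise solutions
with nearby data are nonnegative too. -/
lemma exists_nonneg_nearby {V V1 V2 V3 : ℝ → ℝ → ℝ}
    (hF : Admissible a b K M a0 f)
    (hV : ∀ s, IsSol a b f (V s) (V1 s) (V2 s) (V3 s)) {L σ : ℝ} (hL : 0 ≤ L)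
    (hdep : ∀ s t, 0 ≤ t → |V s t - V σ t| ≤ |s - σ| * Real.exp (L * t) ∧
      |V1 s t - V1 σ t| ≤ |s - σ| * Real.exp (L * t) ∧
      |V2 s t - V2 σ t| ≤ |s - σ| * Real.exp (L * t) ∧
      |V3 s t - V3 σ t| ≤ |s - σ| * Real.exp (L * t))
    (hpos : ∀ t, 0 < V σ t) {r : ℝ} (hz : 0 < V2 σ r - a ^ 2 * V σ r)
    (hz1 : 0 ≤ V3 σ r - a ^ 2 * V1 σ r) :
    ∀ᶠ s in 𝓝 σ, ∀ t, 0 ≤ t → 0 ≤ V s t := by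
  have hb := hF.b_pos
  have hfv : ∀ t, 0 ≤ f (V σ t) := fun t => hF.nonneg (hpos t).le
  have g1 := (hV σ).tendsto_deriv_atTop hb.le (fun t => (hpos t).le) hfv hz hz1
  have g2 : Tendsto (fun t => V3 σ t - a ^ 2 * V1 σ t) atTop atTop :=
    tendsto_atTop_of_deriv_ge (hV σ).dz1 (T := r)
      (c := b ^ 2 * (V2 σ r - a ^ 2 * V σ r)) (by positivity) fun t ht => by
        have h1 := mul_le_mul_of_nonneg_left ((hV σ).z_growth hb.le hfv hz hz1 ht).1 (sq_nonneg b)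
        linarith [hfv t]
  -- At a late time T the data v', z, z' are strictly positive, an open condition; nonnegativity of
  -- nearby solutions on [0, T] comes from the positive minimum there, and beyond T from the cone.
  obtain ⟨T, ⟨hT1, hT2⟩, hTr, hT0⟩ := ((g1.eventually (eventually_gt_atTop 0)).and
    (g2.eventually (eventually_gt_atTop 0))|>.and ((eventually_ge_atTop r).and
      (eventually_ge_atTop 0))).exists
  have hT3 : 0 < V2 σ T - a ^ 2 * V σ T := hz.trans_le ((hV σ).z_growth hb.le hfv hz hz1 hTr).1
  have hcontV : Continuous (V σ) := continuous_iff_continuousAt.2 fun t => ((hV σ).d0 t).continuousAt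
  obtain ⟨t0, -, ht0⟩ := (isCompact_Icc (a := (0:ℝ)) (b := T)).exists_isMinOn
    (nonempty_Icc.2 hT0) hcontV.continuousOn
  have htend : Tendsto (fun s => |s - σ| * Real.exp (L * T)) (𝓝 σ) (𝓝 0) := by
    have : Continuous fun s => |s - σ| * Real.exp (L * T) := by fun_prop
    simpa using this.tendsto σ
  have hlim : ∀ φ : ℝ → ℝ, (∀ s, |φ s - φ σ| ≤ |s - σ| * Real.exp (L * T)) →
      Tendsto φ (𝓝 σ) (𝓝 (φ σ)) := fun φ hφ => by
    rw [tendsto_iff_norm_sub_tendsto_zero]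
    exact squeeze_zero (fun _ => norm_nonneg _) (fun s => hφ s) htend
  have l0 := hlim (fun s => V s T) fun s => (hdep s T hT0).1
  have l1 := hlim (fun s => V1 s T) fun s => (hdep s T hT0).2.1
  have l2 := hlim (fun s => V2 s T) fun s => (hdep s T hT0).2.2.1
  have l3 := hlim (fun s => V3 s T) fun s => (hdep s T hT0).2.2.2
  filter_upwards [htend.eventually (gt_mem_nhds (hpos t0)), l1.eventually (lt_mem_nhds hT1),
    (l3.sub (l1.const_mul (a ^ 2))).eventually (lt_mem_nhds hT2),
    (l2.sub (l0.const_mul (a ^ 2))).eventually (lt_mem_nhds hT3)] with s e0 e1 e2 e3 t ht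
  have hnn : ∀ t ∈ Icc 0 T, 0 ≤ V s t := fun t ht => by
    have h1 := (abs_le.1 (hdep s t ht.1).1).1
    have h2 : |s - σ| * Real.exp (L * t) ≤ |s - σ| * Real.exp (L * T) :=
      mul_le_mul_of_nonneg_left (Real.exp_le_exp.2 (mul_le_mul_of_nonneg_left ht.2 hL))
        (abs_nonneg _)
    have h3 : V σ t0 ≤ V σ t := ht0 ht
    linarith
  rcases le_total t T with h | h
  · exact hnn t ⟨ht, h⟩
  · exact (hV s).nonneg_of_cone hF.lip hF.zero hF.a_pos.le hb.le (hnn T ⟨hT0, le_rfl⟩) e1.le e3.le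
      e2.le h

/-- Shooting: there is a bounded positive solution with local minimum `α` at `0`, for every
`α` between `0` and `a₀`. -/
theorem exists_posSol (hF : Admissible a b K M a0 f) {α : ℝ} (hα : 0 < α) (hα0 : α < a0) :
    ∃ v v1 v2 v3 : ℝ → ℝ, PosSol a b f M v v1 v2 v3 ∧ v 0 = α ∧ v1 0 = 0 ∧ 0 < v2 0 := by
  have ha := hF.a_pos
  have hb := hF.b_pos
  choose V V1 V2 V3 hV h0 h1 h2 h3 using fun s => exists_isSol hF.lip a b α 0 s 0
  obtain ⟨L, hL, hLdep⟩ := exists_exp_dependence hF.lip a b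
  have hdep : ∀ σ s t, 0 ≤ t → |V s t - V σ t| ≤ |s - σ| * Real.exp (L * t) ∧
      |V1 s t - V1 σ t| ≤ |s - σ| * Real.exp (L * t) ∧
      |V2 s t - V2 σ t| ≤ |s - σ| * Real.exp (L * t) ∧
      |V3 s t - V3 σ t| ≤ |s - σ| * Real.exp (L * t) := fun σ s t ht =>
    hLdep _ _ _ _ _ _ _ _ (hV s) (hV σ) |s - σ| (by simp [h0]) (by simp [h1]) (by simp [h2])
      (by simp [h3]) t ht
  set s1 := (a ^ 2 * b ^ 2 * α - f α) / b ^ 2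
  have hs1 : 0 < s1 := div_pos (sub_pos.2 (hF.lt α hα hα0)) (by positivity)
  -- Admissible values of v''(0). The set is closed, contains s1 by `le_of_second_deriv_eq` and
  -- omits 0 by `exists_neg_of_second_deriv_zero`; its least element is the solution sought.
  set S : Set ℝ := Icc 0 s1 ∩ {s | ∀ t, 0 ≤ t → 0 ≤ V s t}
  have hcont : ∀ t, 0 ≤ t → Continuous fun s => V s t := fun t ht => by
    have : LipschitzWith ⟨Real.exp (L * t), (Real.exp_pos _).le⟩ fun s => V s t :=
      LipschitzWith.of_dist_le_mul fun s σ => by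
        rw [Real.dist_eq, Real.dist_eq, mul_comm]
        exact (hdep σ s t ht).1
    exact this.continuous
  have hSclosed : IsClosed S := by
    refine isClosed_Icc.inter ?_
    have : {s | ∀ t, 0 ≤ t → 0 ≤ V s t} = ⋂ (t : ℝ) (_ : 0 ≤ t), {s | 0 ≤ V s t} := by
      ext s; simp
    rw [this]
    exact isClosed_iInter fun t => isClosed_iInter fun ht =>
      isClosed_le continuous_const (hcont t ht)
  have hSne : s1 ∈ S := ⟨⟨hs1.le, le_rfl⟩, fun t ht =>
    hα.le.trans (hF.le_of_second_deriv_eq hα hα0 (hV s1) (h0 _) (h1 _) (h2 _) (h3 _) ht)⟩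
  have hSb : BddBelow S := ⟨0, fun s hs => hs.1.1⟩
  have hσS : sInf S ∈ S := hSclosed.csInf_mem ⟨s1, hSne⟩ hSb
  set σ := sInf S
  have hσpos : 0 < σ := by
    refine lt_of_le_of_ne hσS.1.1 fun h => ?_
    obtain ⟨t, ht, htn⟩ := hF.exists_neg_of_second_deriv_zero hα hα0 (hV σ) (h0 _) (h1 _)
      ((h2 σ).trans h.symm) (h3 _)
    exact absurd (hσS.2 t ht) (not_le.2 htn)
  have heven := (hV σ).even hF.lip ha.le hb.le (h1 σ) (h3 σ)
  have hnn : ∀ t, 0 ≤ V σ t := fun t => by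
    rcases le_total 0 t with ht | ht
    · exact hσS.2 t ht
    · rw [← heven]; exact hσS.2 _ (by linarith)
  have hpos : ∀ t, 0 < V σ t := fun t => by
    refine lt_of_le_of_ne (hnn t) fun h => ?_
    have hmin : IsLocalMin (V σ) t := Eventually.of_forall fun s => by rw [← h]; exact hnn s
    have hd := hmin.hasDerivAt_eq_zero ((hV σ).d0 t)
    -- At a zero, which is a minimum, the energy is -v''² ≤ 0; at time 0 it is potential(α) - σ² >
    -- 0.
    have he := (hV σ).energy hF.lip.continuous t 0
    rw [← h, hd, h0, h1, h2, h3, potential_zero] at he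
    have h4 := hF.potential_gt hα hα0
    have h5 : σ ^ 2 ≤ s1 ^ 2 := pow_le_pow_left₀ hσpos.le hσS.1.2 2
    nlinarith [sq_nonneg (V2 σ t)]
  have hz : ∀ t, V2 σ t - a ^ 2 * V σ t ≤ 0 := by
    have key : ∀ r, 0 < V2 σ r - a ^ 2 * V σ r → 0 ≤ V3 σ r - a ^ 2 * V1 σ r → False := by
      intro r hr hr1
      -- Parameters slightly smaller than σ would then also lie in S, against minimality.
      have hev := hF.exists_nonneg_nearby hV hL (hdep σ) hpos hr hr1
      obtain ⟨s, hs, hs0⟩ := ((hev.filter_mono nhdsWithin_le_nhds).and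
        (Ioo_mem_nhdsLT hσpos)).exists
      exact absurd (csInf_le hSb (⟨⟨hs0.1.le, hs0.2.le.trans hσS.1.2⟩, hs⟩ : s ∈ S))
        (not_le.2 hs0.2)
    intro t
    by_contra! ht
    rcases le_total 0 (V3 σ t - a ^ 2 * V1 σ t) with h | h
    · exact key t ht h
    · obtain ⟨e0, e1, e2, e3⟩ := IsSol.eq_of_data hF.lip ha.le hb.le (hV σ).reflect (hV σ)
        (by simp) (by simp [h1]) (by simp) (by simp [h3]) (-t)
      simp only [neg_neg] at e0 e1 e2 e3
      exact key (-t) (by rw [← e0, ← e2]; exact ht) (by rw [← e1, ← e3]; linarith)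
  exact ⟨V σ, V1 σ, V2 σ, V3 σ, ⟨hV σ, hpos, (hV σ).le_of_large ha.le hpos hz hF.large⟩, h0 σ,
    h1 σ, by rw [h2]; exact hσpos⟩

end Admissible
end

/-! ### Shape of the periodic solutions -/

noncomputable section

lemma eventually_pos_of_hasDerivAt_pos {φ : ℝ → ℝ} {φ' x : ℝ} (h : HasDerivAt φ φ' x)
    (h0 : φ x = 0) (hpos : 0 < φ') : ∀ᶠ t in 𝓝[>] x, 0 < φ t := by
  have h1 := (hasDerivAt_iff_tendsto_slope.1 h).mono_left
    (nhdsWithin_mono x (fun t (ht : x < t) => ht.ne'))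
  filter_upwards [h1.eventually (lt_mem_nhds hpos), self_mem_nhdsWithin] with t ht hxt
  rw [slope_def_field, h0, sub_zero] at ht
  exact (div_pos_iff_of_pos_right (sub_pos.2 hxt)).1 ht

namespace PosSol

variable {a b K M a0 : ℝ} {f v v1 v2 v3 u u1 u2 u3 : ℝ → ℝ}

/-- Without a positive critical point, 0 would be the only one by symmetry, and the solution would
decrease after 0, against v''(0) > 0. -/
lemma exists_half_period (hF : Admissible a b K M a0 f) (h : PosSol a b f M v v1 v2 v3)
    (h1 : v1 0 = 0) (h2 : 0 < v2 0) : ∃ c, 0 < c ∧ v1 c = 0 ∧ ∀ t ∈ Ioo 0 c, 0 < v1 t := by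
  obtain ⟨δ, hδ, hδpos⟩ := mem_nhdsGT_iff_exists_Ioo_subset.1
    (eventually_pos_of_hasDerivAt_pos (h.sol.d1 0) h1 h2)
  have hδ0 : (0:ℝ) < δ := hδ
  have hδpos' : ∀ t ∈ Ioo 0 δ, 0 < v1 t := fun t ht => hδpos ht
  have hne : ∃ t, 0 < t ∧ v1 t = 0 := by
    by_contra! hcon
    have huniq : ∀ t, v1 t = 0 → t = 0 := fun t ht => by
      by_contra hne
      rcases lt_or_gt_of_ne hne with hlt | hgt
      · refine hcon (-t) (by linarith) ?_
        have := (h.symm hF h1 t).2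
        simp only [zero_add, zero_sub] at this
        linarith
      · exact hcon t hgt ht
    have := (h.homoclinic_of_unique hF h1 huniq).1 (δ / 2) (by linarith)
    linarith [hδpos' (δ / 2) ⟨by linarith, by linarith⟩]
  obtain ⟨t0, ht0, ht01⟩ := hne
  -- Starting at δ/2 keeps the set closed while excluding the critical point 0.
  set S : Set ℝ := Ici (δ / 2) ∩ v1 ⁻¹' {0}
  have hScl : IsClosed S := isClosed_Ici.inter (isClosed_singleton.preimage h.deriv_continuous)
  have hSb : BddBelow S := ⟨δ / 2, fun x hx => hx.1⟩
  have ht0S : t0 ∈ S := ⟨by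
    by_contra hlt
    have : t0 < δ / 2 := not_le.1 hlt
    linarith [hδpos' t0 ⟨ht0, by linarith⟩], ht01⟩
  have hc : sInf S ∈ S := hScl.csInf_mem ⟨t0, ht0S⟩ hSb
  set c := sInf S
  have hcδ : δ / 2 ≤ c := hc.1
  have hne : ∀ t ∈ Ioo 0 c, v1 t ≠ 0 := fun t ht h0 => by
    rcases lt_or_ge t (δ / 2) with hlt | hge
    · linarith [hδpos' t ⟨ht.1, by linarith⟩]
    · exact absurd (csInf_le hSb (⟨hge, h0⟩ : t ∈ S)) (not_le.2 ht.2)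
  refine ⟨c, by linarith, hc.2, ?_⟩
  rcases forall_pos_or_forall_neg h.deriv_continuous isPreconnected_Ioo hne with hs | hs
  · exact hs
  · have h3 := hs (δ / 4) ⟨by linarith, by linarith⟩
    linarith [hδpos' (δ / 4) ⟨by linarith, by linarith⟩]

section HalfPeriod

variable {c : ℝ}

lemma half_period_strictMono (h : PosSol a b f M v v1 v2 v3)
    (hpos : ∀ t ∈ Ioo 0 c, 0 < v1 t) : StrictMonoOn v (Icc 0 c) := by
  refine strictMonoOn_of_deriv_pos (convex_Icc 0 c) h.continuous.continuousOn fun t ht => ?_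
  rw [interior_Icc] at ht
  rw [(h.sol.d0 t).deriv]
  exact hpos t ht

lemma half_period_symm (hF : Admissible a b K M a0 f) (h : PosSol a b f M v v1 v2 v3)
    (h1 : v1 c = 0) (t : ℝ) : v (2 * c - t) = v t := by
  have := (h.symm hF h1 (c - t)).1
  rwa [show c + (c - t) = 2 * c - t by ring, show c - (c - t) = t by ring] at this

lemma half_period_min_lt (hF : Admissible a b K M a0 f) (h : PosSol a b f M v v1 v2 v3)
    (hc : v1 c = 0) (hpos : ∀ t ∈ Ioo 0 c, 0 < v1 t) {t : ℝ}
    (ht : t ∈ Ioo 0 (2 * c)) : v 0 < v t := by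
  have hmono := h.half_period_strictMono hpos
  have key : ∀ t, 0 < t → t ≤ c → v 0 < v t := fun t ht htc =>
    hmono ⟨le_rfl, ht.le.trans htc⟩ ⟨ht.le, htc⟩ ht
  rcases le_total t c with htc | htc
  · exact key t ht.1 htc
  · rw [← h.half_period_symm hF hc t]
    exact key _ (by linarith [ht.2]) (by linarith)

lemma half_period_lt_max (hF : Admissible a b K M a0 f) (h : PosSol a b f M v v1 v2 v3)
    (hc : v1 c = 0) (hpos : ∀ t ∈ Ioo 0 c, 0 < v1 t) {t : ℝ}
    (ht : t ∈ Ico 0 (2 * c)) (htc : t ≠ c) : v t < v c := by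
  have hmono := h.half_period_strictMono hpos
  have key : ∀ t, 0 ≤ t → t < c → v t < v c := fun t ht htc =>
    hmono ⟨ht, htc.le⟩ ⟨ht.trans htc.le, le_rfl⟩ htc
  rcases lt_or_gt_of_ne htc with htc | htc
  · exact key t ht.1 htc
  · rw [← h.half_period_symm hF hc t]
    exact key _ (by linarith [ht.2]) (by linarith)

lemma half_period_periodic (hF : Admissible a b K M a0 f) (h : PosSol a b f M v v1 v2 v3)
    (h0 : v1 0 = 0) (hc : v1 c = 0) : Function.Periodic v (2 * c) := by
  simpa using (h.periodic hF h0 hc).1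

lemma half_period_le (hF : Admissible a b K M a0 f) (h : PosSol a b f M v v1 v2 v3)
    (h0 : v1 0 = 0) (hc0 : 0 < c) (hc : v1 c = 0) (hpos : ∀ t ∈ Ioo 0 c, 0 < v1 t) (t : ℝ) :
    v 0 ≤ v t ∧ v t ≤ v c := by
  obtain ⟨s, hs, hts⟩ := (h.half_period_periodic hF h0 hc).exists_mem_Ico₀
    (by linarith : 0 < 2 * c) t
  rw [hts]
  constructor
  · rcases hs.1.eq_or_lt with h | hlt
    · rw [h]
    · exact (h.half_period_min_lt hF hc hpos ⟨hlt, hs.2⟩).le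
  · by_cases hsc : s = c
    · rw [hsc]
    · exact (h.half_period_lt_max hF hc hpos hs hsc).le

lemma isMinimalPeriod (hF : Admissible a b K M a0 f) (h : PosSol a b f M v v1 v2 v3)
    (h0 : v1 0 = 0) (hc0 : 0 < c) (hc : v1 c = 0) (hpos : ∀ t ∈ Ioo 0 c, 0 < v1 t) :
    IsMinimalPeriod v (2 * c) := by
  refine ⟨⟨by linarith, h.half_period_periodic hF h0 hc⟩, fun P hP => ?_⟩
  by_contra! hlt
  have h1 := h.half_period_min_lt hF hc hpos ⟨hP.1, hlt⟩
  have h2 := hP.2 0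
  rw [zero_add] at h2
  linarith

/-- A periodic function takes a value exactly once per period if it does so once. -/
lemma existsUnique_of_periodic {φ : ℝ → ℝ} {L e : ℝ} (hL : 0 < L) (hper : Function.Periodic φ L)
    (hu : ∀ t ∈ Ico 0 L, φ t = φ e → t = e) (x : ℝ) :
    ∃! t, t ∈ Ico x (x + L) ∧ φ t = φ e := by
  have hzs : ∀ t : ℝ, ∀ m : ℤ, φ (t + m • L) = φ t := fun t m => (hper.zsmul m) t
  have hform : ∀ t, φ t = φ e → ∃ m : ℤ, e + m • L = t := by
    intro t ht
    obtain ⟨m, hm, -⟩ := existsUnique_add_zsmul_mem_Ico hL t 0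
    rw [zero_add] at hm
    refine ⟨-m, ?_⟩
    rw [← hu _ hm (by rw [hzs, ht]), neg_smul]
    ring
  obtain ⟨m, hm, hmu⟩ := existsUnique_add_zsmul_mem_Ico hL e x
  refine ⟨e + m • L, ⟨hm, hzs _ _⟩, fun t ⟨ht, hte⟩ => ?_⟩
  obtain ⟨k, rfl⟩ := hform t hte
  rw [hmu k ht]

/-- Modulo the period the only critical points are 0 and c, so every local extremum is a global one.
-/
lemma isLocalMax_iff (hF : Admissible a b K M a0 f) (h : PosSol a b f M v v1 v2 v3)
    (h0 : v1 0 = 0) (hc0 : 0 < c) (hc : v1 c = 0) (hpos : ∀ t ∈ Ioo 0 c, 0 < v1 t) (t : ℝ) :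
    (IsLocalMax v t ↔ v t = v c) ∧ (IsLocalMin v t ↔ v t = v 0) := by
  have hle := h.half_period_le hF h0 hc0 hc hpos
  have hL : 0 < 2 * c := by linarith
  have hcrit : ∀ t, v1 t = 0 → ∃ s, (s = 0 ∨ s = c) ∧ ∀ r, v (t + r) = v (s + r) := by
    intro t ht
    obtain ⟨m, hm, -⟩ := existsUnique_add_zsmul_mem_Ico hL t 0
    rw [zero_add] at hm
    have hp := (h.periodic hF h0 hc)
    rw [sub_zero] at hp
    have hm1 : v1 (t + m • (2 * c)) = 0 := by rw [(hp.2.zsmul m) t, ht]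
    refine ⟨t + m • (2 * c), ?_, fun r => ?_⟩
    · by_contra! hne
      have hpos' : 0 < t + m • (2 * c) := lt_of_le_of_ne hm.1 hne.1.symm
      rcases lt_or_gt_of_ne hne.2 with hlt | hgt
      · exact (hpos _ ⟨hpos', hlt⟩).ne' hm1
      · have h3 := (h.symm hF hc (c - (t + m • (2 * c)))).2
        rw [show c - (c - (t + m • (2 * c))) = t + m • (2 * c) by ring, hm1, neg_zero] at h3
        exact (hpos _ ⟨by linarith [hm.2], by linarith⟩).ne' h3
    · rw [add_right_comm, (hp.1.zsmul m) (t + r)]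
  have hshift : ∀ {s : ℝ} {p : ℝ → Prop}, (∀ᶠ r in 𝓝 s, p (v r)) → ∀ᶠ r in 𝓝 0, p (v (s + r)) := by
    intro s p hp
    have : Tendsto (fun r : ℝ => s + r) (𝓝 0) (𝓝 s) := by
      have : Continuous fun r : ℝ => s + r := by fun_prop
      simpa using this.tendsto 0
    exact this.eventually hp
  constructor
  · refine ⟨fun hmax => ?_, fun he => Eventually.of_forall fun s => by rw [he]; exact (hle s).2⟩
    obtain ⟨s, hs, hr⟩ := hcrit t (hmax.hasDerivAt_eq_zero (h.sol.d0 t))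
    have hts : v t = v s := by simpa using hr 0
    rcases hs with rfl | rfl
    · exfalso
      have h3 := (hshift (p := (· ≤ v t)) hmax).filter_mono (nhdsWithin_le_nhds (s := Ioi 0))
      obtain ⟨r, hr1, hr2⟩ := (h3.and (Ioo_mem_nhdsGT hL)).exists
      rw [hr r, hts, zero_add] at hr1
      exact absurd (h.half_period_min_lt hF hc hpos hr2) (not_lt.2 hr1)
    · exact hts
  · refine ⟨fun hmin => ?_, fun he => Eventually.of_forall fun s => by rw [he]; exact (hle s).1⟩
    obtain ⟨s, hs, hr⟩ := hcrit t (hmin.hasDerivAt_eq_zero (h.sol.d0 t))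
    have hts : v t = v s := by simpa using hr 0
    rcases hs with rfl | rfl
    · exact hts
    · exfalso
      have h3 := (hshift (p := (v t ≤ ·)) hmin).filter_mono (nhdsWithin_le_nhds (s := Ioi 0))
      obtain ⟨r, hr1, hr2⟩ := (h3.and (Ioo_mem_nhdsGT hc0)).exists
      rw [hr r, hts] at hr1
      exact absurd (h.half_period_lt_max hF hc hpos (t := s + r)
        ⟨by linarith [hr2.1], by linarith [hr2.2]⟩ (by linarith [hr2.1])) (not_lt.2 hr1)

lemma existsUnique_isLocalMax (hF : Admissible a b K M a0 f) (h : PosSol a b f M v v1 v2 v3)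
    (h0 : v1 0 = 0) (hc0 : 0 < c) (hc : v1 c = 0) (hpos : ∀ t ∈ Ioo 0 c, 0 < v1 t) (x : ℝ) :
    ∃! t, t ∈ Ico x (x + 2 * c) ∧ IsLocalMax v t := by
  simp only [(h.isLocalMax_iff hF h0 hc0 hc hpos _).1]
  refine existsUnique_of_periodic (by linarith) (h.half_period_periodic hF h0 hc)
    (fun t ht hte => ?_) x
  by_contra hne
  exact (h.half_period_lt_max hF hc hpos ht hne).ne hte

lemma existsUnique_isLocalMin (hF : Admissible a b K M a0 f) (h : PosSol a b f M v v1 v2 v3)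
    (h0 : v1 0 = 0) (hc0 : 0 < c) (hc : v1 c = 0) (hpos : ∀ t ∈ Ioo 0 c, 0 < v1 t) (x : ℝ) :
    ∃! t, t ∈ Ico x (x + 2 * c) ∧ IsLocalMin v t := by
  simp only [(h.isLocalMax_iff hF h0 hc0 hc hpos _).2]
  refine existsUnique_of_periodic (by linarith) (h.half_period_periodic hF h0 hc)
    (fun t ht hte => ?_) x
  by_contra hne
  exact (h.half_period_min_lt hF hc hpos ⟨lt_of_le_of_ne ht.1 (Ne.symm hne), ht.2⟩).ne' hte

end HalfPeriod

/-- The solution is even about a critical point, so its odd derivatives vanish there. -/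
lemma third_deriv_eq_zero (hF : Admissible a b K M a0 f) (h : PosSol a b f M v v1 v2 v3)
    (h1 : v1 0 = 0) : v3 0 = 0 := by
  have := (IsSol.eq_of_bounded hF.lip hF.a_pos hF.b_pos.le h.reflect.sol h.sol h.reflect.abs_le
    h.abs_le (by simp) (by simp [h1]) 0).2.2.2
  simp only [neg_zero] at this
  linarith

end PosSol
end

/-! ### The homoclinic solution: existence and uniqueness -/

noncomputable section

variable {a b K M a0 : ℝ} {f v v1 v2 v3 u u1 u2 u3 : ℝ → ℝ}

namespace Admissible

/-- A bounded positive solution with a maximum at `0`, descending to a minimum `α` at `c`. -/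
lemma exists_centred_posSol (hF : Admissible a b K M a0 f) {α : ℝ} (hα : 0 < α) (hα0 : α < a0) :
    ∃ (v v1 v2 v3 : ℝ → ℝ) (c : ℝ), PosSol a b f M v v1 v2 v3 ∧ v1 0 = 0 ∧ a0 ≤ v 0 ∧
      (∀ t ∈ Icc 0 c, v1 t ≤ 0) ∧ a0 ≤ α * Real.exp (a * c) ∧ 0 ≤ c ∧
      |potential a b f (v 0) - v2 0 ^ 2 - potential a b f α| ≤ (a ^ 2 * α) ^ 2 := by
  obtain ⟨w, w1, w2, w3, hw, e0, e1, e2⟩ := hF.exists_posSol hα hα0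
  obtain ⟨c, hc0, hc, hpos⟩ := hw.exists_half_period hF e1 e2
  have hmax : a0 ≤ w c := by
    by_contra! hlt
    have := hw.eq_a0_of_le hF (fun t => ((hw.half_period_le hF e1 hc0 hc hpos t).2.trans hlt.le)) 0
    linarith
  refine ⟨_, _, _, _, c, hw.shift c, by simpa using hc, by simpa using hmax, ?_, ?_, hc0.le, ?_⟩
  · intro t ht
    rw [(hw.symm hF hc t).2, neg_nonpos]
    rcases eq_or_lt_of_le ht.1 with rfl | h1
    · simp [hc]
    rcases eq_or_lt_of_le ht.2 with rfl | h2
    · simp [e1]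
    · exact (hpos _ ⟨by linarith, by linarith⟩).le
  · refine hmax.trans ?_
    -- Harnack between the minimum α and the maximum, which is at least a₀, forces a long half
    -- period when α is small.
    have := hw.sol.exp_harnack (hw.harnack hF) 0 c
    rwa [e0, sub_zero, abs_of_pos hc0] at this
  · have he := hw.sol.energy hF.lip.continuous c 0
    rw [hc, e1, e0] at he
    -- The energies at the two extrema differ only by v''² at the minimum, where 0 < v'' ≤ a²α since
    -- z ≤ 0.
    have h1 : potential a b f (w (c + 0)) - w2 (c + 0) ^ 2 - potential a b f α = -(w2 0 ^ 2) := by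
      rw [add_zero]; linarith
    rw [h1, abs_neg, abs_of_nonneg (sq_nonneg _)]
    have h2 := hw.z_nonpos hF 0
    rw [e0] at h2
    exact pow_le_pow_left₀ e2.le (by linarith) 2

lemma potential_monotone (hF : Admissible a b K M a0 f) {s t : ℝ} (hs : 0 ≤ s) (hst : s ≤ t)
    (ht : t ≤ a0) : potential a b f s ≤ potential a b f t :=
  le_of_hasDerivAt_nonneg (hasDerivAt_potential hF.lip.continuous) hst fun r hr => by
    have := hF.le_of_le (hs.trans_lt hr.1) (hr.2.le.trans ht)
    linarith

lemma potential_antitone (hF : Admissible a b K M a0 f) {s t : ℝ} (hs : a0 ≤ s) (hst : s ≤ t) :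
    potential a b f t ≤ potential a b f s :=
  le_of_hasDerivAt_nonpos (hasDerivAt_potential hF.lip.continuous) hst fun r hr => by
    have := hF.ge_of_ge (hs.trans hr.1.le)
    linarith

/-- The potential vanishes at 0, rises up to a₀ and falls afterwards, so on [0, ∞) it is nonnegative
on an initial interval. -/
lemma potential_nonneg_of_le (hF : Admissible a b K M a0 f) {s t : ℝ} (hs : 0 ≤ s) (hst : s ≤ t)
    (ht : 0 ≤ potential a b f t) : 0 ≤ potential a b f s := by
  rcases le_total s a0 with h | h
  · simpa using hF.potential_monotone le_rfl hs h
  · exact ht.trans (hF.potential_antitone h hst)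

lemma potential_a0_pos (hF : Admissible a b K M a0 f) : 0 < potential a b f a0 := by
  have ha0 := hF.a0_pos
  exact ((sq_nonneg _).trans_lt (hF.potential_gt (by linarith : 0 < a0 / 2) (by linarith))).trans_le
    (hF.potential_monotone (by linarith) (by linarith) le_rfl)

/-- Existence of an even homoclinic solution, decreasing on the positive half line. -/
theorem exists_homoclinic (hF : Admissible a b K M a0 f) :
    ∃ v v1 v2 v3 : ℝ → ℝ, PosSol a b f M v v1 v2 v3 ∧ v1 0 = 0 ∧ (∀ t, 0 < t → v1 t < 0) ∧
      Tendsto v atTop (𝓝 0) := by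
  have ha := hF.a_pos
  have hb := hF.b_pos
  have ha0 := hF.a0_pos
  have hfc := hF.lip.continuous
  set α : ℕ → ℝ := fun k => a0 / (k + 2)
  have hαpos : ∀ k, 0 < α k := fun k => by positivity
  have hαlt : ∀ k, α k < a0 := fun k => by
    simp only [α]
    rw [div_lt_iff₀ (by positivity)]
    nlinarith [Nat.cast_nonneg (α := ℝ) k]
  have hα0 : Tendsto α atTop (𝓝 0) :=
    tendsto_const_nhds.div_atTop (tendsto_atTop_add_const_right _ 2 tendsto_natCast_atTop_atTop)
  choose V V1 V2 V3 c hV h1 hge hdec hexp hc0 hen using fun k =>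
    hF.exists_centred_posSol (hαpos k) (hαlt k)
  have h3 := fun k => (hV k).third_deriv_eq_zero hF (h1 k)
  obtain ⟨C, hC⟩ := PosSol.exists_bound hF
  -- Only v(0) and v''(0) vary, since the odd derivatives vanish at the maximum; they lie in a
  -- compact rectangle.
  obtain ⟨⟨p, q⟩, -, φ, hφ, hlim⟩ := (isCompact_Icc (a := ((0:ℝ), -C)) (b := (M, C))).tendsto_subseq
    (x := fun k => (V k 0, V2 k 0)) fun k => by
      have := abs_le.1 ((hC _ _ _ _ (hV k)) 0).2.1
      exact ⟨⟨((hV k).pos 0).le, this.1⟩, ⟨(hV k).le 0, this.2⟩⟩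
  have hp : Tendsto (fun k => V (φ k) 0) atTop (𝓝 p) :=
    (continuous_fst.tendsto (p, q)).comp hlim
  have hq : Tendsto (fun k => V2 (φ k) 0) atTop (𝓝 q) :=
    (continuous_snd.tendsto (p, q)).comp hlim
  obtain ⟨u, u1, u2, u3, hu, i0, i1, i2, i3⟩ := exists_isSol hF.lip a b p 0 q 0
  obtain ⟨L, hL, hdep⟩ := exists_exp_dependence hF.lip a b
  have hdist : ∀ t, 0 ≤ t → Tendsto (fun k => V (φ k) t) atTop (𝓝 (u t)) ∧
      Tendsto (fun k => V1 (φ k) t) atTop (𝓝 (u1 t)) := by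
    intro t ht
    set δ : ℕ → ℝ := fun k => |V (φ k) 0 - p| + |V2 (φ k) 0 - q|
    have hδ : Tendsto (fun k => δ k * Real.exp (L * t)) atTop (𝓝 0) := by
      have e1 : Tendsto (fun k => |V (φ k) 0 - p|) atTop (𝓝 0) := by
        simpa using (hp.sub_const p).abs
      have e2 : Tendsto (fun k => |V2 (φ k) 0 - q|) atTop (𝓝 0) := by
        simpa using (hq.sub_const q).abs
      simpa using (e1.add e2).mul_const (Real.exp (L * t))
    have hd := fun k => hdep _ _ _ _ _ _ _ _ (hV (φ k)).sol hu (δ k)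
      (by rw [i0]; exact le_add_of_nonneg_right (abs_nonneg _))
      (by rw [h1, i1, sub_self, abs_zero]; positivity)
      (by rw [i2]; exact le_add_of_nonneg_left (abs_nonneg _))
      (by rw [h3, i3, sub_self, abs_zero]; positivity) t ht
    constructor
    · rw [tendsto_iff_norm_sub_tendsto_zero]
      exact squeeze_zero (fun _ => norm_nonneg _) (fun k => (hd k).1) hδ
    · rw [tendsto_iff_norm_sub_tendsto_zero]
      exact squeeze_zero (fun _ => norm_nonneg _) (fun k => (hd k).2.1) hδ
  have heven := hu.even hF.lip ha.le hb.le i1 i3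
  have hposle : ∀ t, 0 ≤ t → 0 < u t ∧ u t ≤ M := by
    intro t ht
    -- The maxima are at least a₀, so Harnack gives the uniform lower bound a₀ exp(-at) and the
    -- limit stays positive.
    refine ⟨lt_of_lt_of_le (by positivity : 0 < a0 * Real.exp (-(a * t)))
      (ge_of_tendsto' (hdist t ht).1 fun k => ?_), le_of_tendsto' (hdist t ht).1 fun k => (hV _).le t⟩
    have e1 := (hV (φ k)).sol.exp_harnack ((hV (φ k)).harnack hF) t 0
    rw [zero_sub, abs_neg, abs_of_nonneg ht] at e1
    have e2 := (hge (φ k)).trans e1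
    rw [Real.exp_neg, ← div_eq_mul_inv, div_le_iff₀ (Real.exp_pos _)]
    exact e2
  have huPos : PosSol a b f M u u1 u2 u3 := by
    refine ⟨hu, fun t => ?_, fun t => ?_⟩ <;> rcases le_total 0 t with ht | ht
    · exact (hposle t ht).1
    · rw [← heven]; exact (hposle (-t) (by linarith)).1
    · exact (hposle t ht).2
    · rw [← heven]; exact (hposle (-t) (by linarith)).2
  have hdecr : ∀ t, 0 ≤ t → u1 t ≤ 0 := by
    intro t ht
    refine le_of_tendsto (hdist t ht).2 ?_
    have hsmall : Tendsto (fun k => α (φ k) * Real.exp (a * t)) atTop (𝓝 0) := by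
      simpa using (hα0.comp hφ.tendsto_atTop).mul_const (Real.exp (a * t))
    -- Eventually α exp(at) < a₀ ≤ α exp(ac), so t precedes the minimum of the approximating
    -- solution.
    filter_upwards [hsmall.eventually (gt_mem_nhds ha0)] with k hk
    refine hdec (φ k) t ⟨ht, ?_⟩
    by_contra! hlt
    have e1 : Real.exp (a * c (φ k)) ≤ Real.exp (a * t) := Real.exp_le_exp.2 (by gcongr)
    have e2 := mul_le_mul_of_nonneg_left e1 (hαpos (φ k)).le
    linarith [hexp (φ k)]
  have henergy : potential a b f p = q ^ 2 := by
    have hpc : Continuous (potential a b f) := continuous_iff_continuousAt.2 fun x =>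
      (hasDerivAt_potential hfc x).continuousAt
    have e1 : Tendsto (fun k => potential a b f (V (φ k) 0) - V2 (φ k) 0 ^ 2 -
        potential a b f (α (φ k))) atTop (𝓝 (potential a b f p - q ^ 2 - 0)) := by
      refine (((hpc.tendsto p).comp hp).sub (hq.pow 2)).sub ?_
      have := (hpc.tendsto 0).comp (hα0.comp hφ.tendsto_atTop)
      simpa [Function.comp_def] using this
    have e2 : Tendsto (fun k => potential a b f (V (φ k) 0) - V2 (φ k) 0 ^ 2 -
        potential a b f (α (φ k))) atTop (𝓝 0) := by
      have e3 : Tendsto (fun k => (a ^ 2 * α (φ k)) ^ 2) atTop (𝓝 0) := by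
        simpa using ((hα0.comp hφ.tendsto_atTop).const_mul (a ^ 2)).pow 2
      exact squeeze_zero_norm (fun k => hen (φ k)) e3
    have := tendsto_nhds_unique e1 e2
    linarith
  -- The limit has zero energy, whereas the constant a₀ has energy potential(a₀) > 0.
  have hnc : ¬ ∀ t, u t = a0 := by
    intro hconst
    have d1 := huPos.deriv_eq_zero_of_const hconst
    have d2 : u2 0 = 0 := (hu.d1 0).unique
      ((hasDerivAt_const (0:ℝ) (0:ℝ)).congr_of_eventuallyEq (Eventually.of_forall d1))
    rw [← i0, hconst 0, ← i2, d2] at henergy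
    have := hF.potential_a0_pos
    rw [henergy] at this
    simp at this
  have hnp : ∀ d, 0 < d → u1 d ≠ 0 := by
    intro d hd hd0
    have hper := (huPos.periodic hF i1 hd0).2
    rw [sub_zero] at hper
    -- A second critical point would make u' periodic, hence nonpositive everywhere; being odd it
    -- would vanish.
    have hall : ∀ t, u1 t ≤ 0 := fun t => by
      obtain ⟨s, hs, hts⟩ := hper.exists_mem_Ico₀ (by linarith : 0 < 2 * d) t
      rw [hts]; exact hdecr s hs.1
    have hzero : ∀ t, u1 t = 0 := fun t => by
      refine le_antisymm (hall t) ?_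
      have := (huPos.symm hF i1 t).2
      rw [zero_add, zero_sub] at this
      rw [this]; linarith [hall (-t)]
    exact hnc (huPos.eq_a0_of_eventually_nondecreasing hF (c := 0) (fun t _ => (hzero t).ge)
      fun t ht => Or.inl (le_of_hasDerivAt_nonneg hu.d0 ht.le fun r _ => (hzero r).ge))
  have huniq : ∀ t, u1 t = 0 → t = 0 := fun t ht => by
    by_contra hne
    rcases lt_or_gt_of_ne hne with hlt | hgt
    · refine hnp (-t) (by linarith) ?_
      have := (huPos.symm hF i1 t).2
      simp only [zero_add, zero_sub] at this
      linarith
    · exact hnp t hgt ht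
  exact ⟨u, u1, u2, u3, huPos, i1, huPos.homoclinic_of_unique hF i1 huniq⟩

end Admissible

namespace PosSol

lemma energy_eq_zero (hF : Admissible a b K M a0 f) (h : PosSol a b f M v v1 v2 v3)
    (hl : Tendsto v atTop (𝓝 0)) (t : ℝ) :
    2 * (v1 t * v3 t) - v2 t ^ 2 - (a ^ 2 + b ^ 2) * v1 t ^ 2 + potential a b f (v t) = 0 := by
  obtain ⟨t1, t2, t3, -⟩ := h.tendsto_derivs hF hl
  have hpc : Tendsto (fun s => potential a b f (v s)) atTop (𝓝 0) := by
    have := ((hasDerivAt_potential (a := a) (b := b) hF.lip.continuous 0).continuousAt.tendsto).comp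
      hl
    simpa [Function.comp_def] using this
  have hlim : Tendsto (fun s => 2 * (v1 s * v3 s) - v2 s ^ 2 - (a ^ 2 + b ^ 2) * v1 s ^ 2 +
      potential a b f (v s)) atTop (𝓝 0) := by
    have := ((((t1.mul t3).const_mul 2).sub (t2.pow 2)).sub
      ((t1.pow 2).const_mul (a ^ 2 + b ^ 2))).add hpc
    simpa using this
  refine tendsto_nhds_unique (tendsto_const_nhds.congr fun s => ?_) hlim
  exact h.sol.energy hF.lip.continuous t s

/-- v' vanishes at 0 and at infinity and is negative in between, so it has an interior minimum. -/
lemma exists_inflection (h : PosSol a b f M v v1 v2 v3) (h1 : v1 0 = 0)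
    (hneg : ∀ t, 0 < t → v1 t < 0) (hl : Tendsto v1 atTop (𝓝 0)) : ∃ t, 0 < t ∧ v2 t = 0 := by
  obtain ⟨T, hT⟩ := eventually_atTop.1 (hl.eventually (lt_mem_nhds (hneg 1 one_pos)))
  obtain ⟨t, ht, hmin⟩ := (isCompact_Icc (a := (0:ℝ)) (b := max T 1)).exists_isMinOn
    (nonempty_Icc.2 (zero_le_one.trans (le_max_right _ _))) h.deriv_continuous.continuousOn
  have hle1 : v1 t ≤ v1 1 := hmin ⟨zero_le_one, le_max_right _ _⟩
  have hpos : 0 < t := by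
    refine lt_of_le_of_ne ht.1 fun h0 => ?_
    rw [← h0, h1] at hle1
    linarith [hneg 1 one_pos]
  refine ⟨t, hpos, IsLocalMin.hasDerivAt_eq_zero (f := v1) ?_ (h.sol.d1 t)⟩
  filter_upwards [Ioi_mem_nhds hpos] with s hs
  rcases le_total s (max T 1) with hsT | hsT
  · exact hmin ⟨le_of_lt hs, hsT⟩
  · exact hle1.trans (hT s ((le_max_left _ _).trans hsT)).le

/-- Suppose v peaks higher, and let τ(s) be the time at which v has the height u(s). At s = 0 the
graph of v is the steeper one; equal slopes at equal heights would make v a translate of u with the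
same peak, so v stays steeper. At an inflection point of u the two energy identities then contradict
`third_deriv_lt_of_cross`. -/
lemma homoclinic_le (hF : Admissible a b K M a0 f) (hu : PosSol a b f M u u1 u2 u3)
    (hv : PosSol a b f M v v1 v2 v3) (hu1 : u1 0 = 0) (hv1 : v1 0 = 0)
    (hun : ∀ t, 0 < t → u1 t < 0) (hvn : ∀ t, 0 < t → v1 t < 0) (hul : Tendsto u atTop (𝓝 0))
    (hvl : Tendsto v atTop (𝓝 0)) : v 0 ≤ u 0 := by
  by_contra! hlt
  have hanti : ∀ {w w1 w2 w3 : ℝ → ℝ}, PosSol a b f M w w1 w2 w3 → (∀ t, 0 < t → w1 t < 0) →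
      StrictAntiOn w (Ici 0) := by
    intro w w1 w2 w3 hw hwn
    refine strictAntiOn_of_deriv_neg (convex_Ici 0) hw.continuous.continuousOn fun t ht => ?_
    rw [interior_Ici] at ht
    rw [(hw.sol.d0 t).deriv]
    exact hwn t ht
  have hua := hanti hu hun
  have hva := hanti hv hvn
  have hsurj : ∀ {w w1 w2 w3 : ℝ → ℝ}, PosSol a b f M w w1 w2 w3 → Tendsto w atTop (𝓝 0) →
      ∀ y, 0 < y → y ≤ w 0 → ∃ t, 0 ≤ t ∧ w t = y := by
    intro w w1 w2 w3 hw hwl y hy hyw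
    obtain ⟨T, hT, hT0⟩ := ((hwl.eventually (gt_mem_nhds hy)).and (eventually_ge_atTop 0)).exists
    obtain ⟨t, ht, hty⟩ := intermediate_value_Icc' hT0 hw.continuous.continuousOn ⟨hT.le, hyw⟩
    exact ⟨t, ht.1, hty⟩
  have hule : ∀ s, 0 ≤ s → u s ≤ u 0 := fun s hs =>
    hua.antitoneOn (mem_Ici.2 le_rfl) (mem_Ici.2 hs) hs
  have hτex : ∀ s, ∃ t, 0 ≤ s → 0 ≤ t ∧ v t = u s := fun s => by
    by_cases hs : 0 ≤ s
    · obtain ⟨t, ht⟩ := hsurj hv hvl (u s) (hu.pos s) ((hule s hs).trans hlt.le)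
      exact ⟨t, fun _ => ht⟩
    · exact ⟨0, fun h => absurd h hs⟩
  choose τ hτ using hτex
  have hτpos : ∀ s, 0 ≤ s → 0 < τ s := fun s hs => by
    refine lt_of_le_of_ne (hτ s hs).1 fun h => ?_
    have := (hτ s hs).2
    rw [← h] at this
    linarith [hule s hs]
  have hτmono : ∀ s t, 0 ≤ s → s < t → τ s < τ t := fun s t hs hst => by
    have h2 : v (τ t) < v (τ s) := by
      rw [(hτ s hs).2, (hτ t (hs.trans hst.le)).2]
      exact hua (mem_Ici.2 hs) (mem_Ici.2 (hs.trans hst.le)) hst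
    exact (hva.lt_iff_gt (hτ t (hs.trans hst.le)).1 (hτ s hs).1).1 h2
  -- Extending τ linearly to negative times gives a monotone surjection of the line, which is
  -- automatically continuous.
  set θ : ℝ → ℝ := fun s => if 0 ≤ s then τ s else τ 0 + s
  have hθpos : ∀ s, 0 ≤ s → θ s = τ s := fun s hs => if_pos hs
  have hθneg : ∀ s, s < 0 → θ s = τ 0 + s := fun s hs => if_neg (not_le.2 hs)
  have hθmono : Monotone θ := by
    refine StrictMono.monotone fun s t hst => ?_
    rcases lt_or_ge s 0 with hs | hs
    · rw [hθneg s hs]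
      rcases lt_or_ge t 0 with ht | ht
      · rw [hθneg t ht]; linarith
      · rw [hθpos t ht]
        rcases ht.eq_or_lt with rfl | ht'
        · linarith
        · linarith [hτmono 0 t le_rfl ht']
    · rw [hθpos s hs, hθpos t (hs.trans hst.le)]
      exact hτmono s t hs hst
  have hθsurj : Function.Surjective θ := by
    intro y
    rcases lt_or_ge y (τ 0) with hy | hy
    · exact ⟨y - τ 0, by rw [hθneg _ (by linarith)]; ring⟩
    · have hy0 : 0 ≤ y := (hτ 0 le_rfl).1.trans hy
      have hvy : v y ≤ u 0 := by
        rw [← (hτ 0 le_rfl).2]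
        exact hva.antitoneOn (hτ 0 le_rfl).1 hy0 hy
      obtain ⟨s, hs, hsy⟩ := hsurj hu hul (v y) (hv.pos y) hvy
      refine ⟨s, ?_⟩
      rw [hθpos s hs]
      exact hva.injOn (hτ s hs).1 hy0 ((hτ s hs).2.trans hsy)
  have hθc : Continuous θ := hθmono.continuous_of_surjective hθsurj
  obtain ⟨t, ht, hinf⟩ := hu.exists_inflection hu1 hun (hu.tendsto_derivs hF hul).1
  have hsteep : v1 (τ t) < u1 t := by
    by_contra! hge
    have hcont : Continuous fun s => v1 (θ s) - u1 s :=
      (hv.deriv_continuous.comp hθc).sub hu.deriv_continuous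
    have h0 : v1 (θ 0) - u1 0 ≤ 0 := by
      rw [hθpos 0 le_rfl, hu1, sub_zero]; exact (hvn _ (hτpos 0 le_rfl)).le
    obtain ⟨s, hs, hs0⟩ := intermediate_value_Icc ht.le hcont.continuousOn
      ⟨h0, by rw [hθpos t ht.le]; linarith⟩
    simp only [hθpos s hs.1] at hs0
    have heq := fun r => hv.eq_of_eq hF hu (s := τ s) (t := s) (hτ s hs.1).2 (by linarith) r
    have hcrit := (heq (-s)).2
    rw [add_neg_cancel, hu1, ← sub_eq_add_neg] at hcrit
    have hval := (heq (-s)).1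
    rw [add_neg_cancel, ← sub_eq_add_neg] at hval
    -- The time τ(s) - s is a critical point of v, hence 0; then v(0) = u(0), which is excluded.
    rcases lt_trichotomy (τ s - s) 0 with h | h | h
    · have h4 := (hv.symm hF hv1 (τ s - s)).2
      rw [zero_add, zero_sub, hcrit] at h4
      linarith [hvn (-(τ s - s)) (by linarith)]
    · rw [h] at hval; linarith
    · exact (hvn _ h).ne hcrit
  have hcross := IsSol.third_deriv_lt_of_cross hF.lip hF.a_pos hF.b_pos.le (hv.shift (τ t)).sol
    (hu.shift t).sol (hv.shift (τ t)).abs_le (hu.shift t).abs_le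
    (by simpa using (hτ t ht.le).2) (by simpa using hsteep)
  simp only [add_zero] at hcross
  have eu := hu.energy_eq_zero hF hul t
  have ev := hv.energy_eq_zero hF hvl (τ t)
  rw [(hτ t ht.le).2] at ev
  rw [hinf] at eu
  have hFnn : 0 ≤ potential a b f (u t) := by
    refine hF.potential_nonneg_of_le (hu.pos t).le (hule t ht.le) ?_
    have := hu.energy_eq_zero hF hul 0
    rw [hu1] at this
    nlinarith [sq_nonneg (u2 0)]
  set P := potential a b f (u t)
  have hp : 0 < -u1 t := by linarith [hun t ht]
  have hq : -u1 t < -v1 (τ t) := by linarith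
  set p := -u1 t
  set q := -v1 (τ t)
  have eu' : 2 * (p * u3 t) = P - (a ^ 2 + b ^ 2) * p ^ 2 := by simp only [p]; linarith
  have ev' : 2 * (q * v3 (τ t)) = P - (a ^ 2 + b ^ 2) * q ^ 2 - v2 (τ t) ^ 2 := by
    simp only [q]; linarith
  have hcr : u3 t - v3 (τ t) < a ^ 2 * (q - p) := by simp only [p, q]; linarith
  have hab : a ^ 2 < b ^ 2 := by
    have := hF.a_lt_b
    have := hF.a_pos.le
    gcongr
  have hpq : 0 < p * q := mul_pos hp (hp.trans hq)
  -- Combining the energy identities bounds this below by (a² + b²)pq(q - p), while the crossing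
  -- inequality bounds it above by 2a²pq(q - p); a < b and q > p make these incompatible.
  have e1 : 2 * (p * q) * (u3 t - v3 (τ t)) =
      P * (q - p) + (a ^ 2 + b ^ 2) * (p * q) * (q - p) + p * v2 (τ t) ^ 2 := by
    linear_combination q * eu' - p * ev'
  have e2 : 2 * (p * q) * (u3 t - v3 (τ t)) < 2 * (p * q) * (a ^ 2 * (q - p)) :=
    mul_lt_mul_of_pos_left hcr (by linarith)
  have e3 : 0 ≤ P * (q - p) := mul_nonneg hFnn (by linarith)
  have e4 : 0 ≤ p * v2 (τ t) ^ 2 := mul_nonneg hp.le (sq_nonneg _)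
  have e5 : 0 < (b ^ 2 - a ^ 2) * ((p * q) * (q - p)) :=
    mul_pos (by linarith) (mul_pos hpq (by linarith))
  nlinarith

/-- Uniqueness of the homoclinic solution. -/
theorem homoclinic_unique (hF : Admissible a b K M a0 f) (hu : PosSol a b f M u u1 u2 u3)
    (hv : PosSol a b f M v v1 v2 v3) (hu1 : u1 0 = 0) (hv1 : v1 0 = 0)
    (hun : ∀ t, 0 < t → u1 t < 0) (hvn : ∀ t, 0 < t → v1 t < 0) (hul : Tendsto u atTop (𝓝 0))
    (hvl : Tendsto v atTop (𝓝 0)) (t : ℝ) : u t = v t := by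
  have h0 : u 0 = v 0 := le_antisymm (hv.homoclinic_le hF hu hv1 hu1 hvn hun hvl hul)
    (hu.homoclinic_le hF hv hu1 hv1 hun hvn hul hvl)
  simpa using (hu.eq_of_eq hF hv h0 (hu1.trans hv1.symm) t).1

end PosSol
end

/-! ### Exponential decay of the homoclinic solution -/

noncomputable section

variable {a b K M a0 : ℝ} {f v v1 v2 v3 : ℝ → ℝ}

/-- Maximum principle on a half line for `y'' ≤ k² y`. -/
lemma nonneg_of_second_deriv_le {y y1 y2 : ℝ → ℝ} (h0 : ∀ t, HasDerivAt y (y1 t) t)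
    (h1 : ∀ t, HasDerivAt y1 (y2 t) t) {k T : ℝ} (hk : 0 ≤ k)
    (hn : ∀ t, T ≤ t → y2 t ≤ k ^ 2 * y t) (hT : 0 ≤ y T) (hl : Tendsto y atTop (𝓝 0)) {t : ℝ}
    (ht : T ≤ t) : 0 ≤ y t := by
  by_contra! hlt
  -- A negative value moves further from zero in the direction in which y is nonincreasing: forward
  -- this contradicts y → 0, backward it contradicts y(T) ≥ 0.
  rcases le_total (y1 t) 0 with h | h
  · have hle : ∀ s, t ≤ s → y s ≤ y t := fun s hs =>
      le_of_hasDerivAt_nonpos h0 hs fun r hr => by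
        have := (nonneg_of_second_deriv_ge (fun t => (h0 t).neg) (fun t => (h1 t).neg) hk hr.1.le
          (fun x hx => by
            have := hn x (ht.trans hx.1.le)
            simp only [Pi.neg_apply]; linarith) (by simpa using hlt.le) (by simpa using h)).2
        simpa using this
    have := le_of_tendsto hl (eventually_atTop.2 ⟨t, hle⟩)
    linarith
  · have := le_of_hasDerivAt_nonneg h0 ht fun r hr => by
      have := (nonneg_of_second_deriv_ge (z := fun t => -y (-t)) (z1 := fun t => y1 (-t))
        (z2 := fun t => -y2 (-t)) (s := -t) (t := -r)
        (fun t => (hasDerivAt_comp_neg' (h0 (-t))).neg.congr_deriv (neg_neg _))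
        (fun t => hasDerivAt_comp_neg' (h1 (-t))) hk (by linarith [hr.2])
        (fun x hx => by
            have := hn (-x) (by linarith [hx.2, hr.1])
            linarith) (by simpa using hlt.le) (by simpa using h)).2
      simpa using this
    linarith

/-- exp(-kt) y is nonincreasing and tends to 0, so it is nonnegative. -/
lemma nonneg_of_deriv_le {y y1 : ℝ → ℝ} (h0 : ∀ t, HasDerivAt y (y1 t) t) {k T : ℝ} (hk : 0 < k)
    (hn : ∀ t, T ≤ t → y1 t ≤ k * y t) (hl : Tendsto y atTop (𝓝 0)) {t : ℝ}
    (ht : T ≤ t) : 0 ≤ y t := by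
  have hmono : ∀ s, t ≤ s → Real.exp (-k * s) * y s ≤ Real.exp (-k * t) * y t := fun s hs => by
    have := exp_mul_le_exp_mul (φ := fun t => -y t) (k := k) (fun t => (h0 t).neg) hs fun r hr => by
      have := hn r (ht.trans hr.1.le)
      linarith
    simp only [mul_neg] at this
    linarith
  have hexp : Tendsto (fun s => Real.exp (-k * s) * y s) atTop (𝓝 0) := by
    have : Tendsto (fun s : ℝ => Real.exp (-k * s)) atTop (𝓝 0) :=
      Real.tendsto_exp_atBot.comp (tendsto_id.const_mul_atTop_of_neg (by linarith))
    simpa using this.mul hl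
  have := le_of_tendsto hexp (eventually_atTop.2 ⟨t, hmono⟩)
  exact nonneg_of_mul_nonneg_right this (Real.exp_pos _)

namespace IsSol

/-- Shift of the linear part. -/
lemma change_coeff (h : IsSol a b f v v1 v2 v3) {σ τ : ℝ} (hsum : σ ^ 2 + τ ^ 2 = a ^ 2 + b ^ 2) :
    IsSol σ τ (fun x => f x - (a ^ 2 * b ^ 2 - σ ^ 2 * τ ^ 2) * x) v v1 v2 v3 :=
  ⟨h.d0, h.d1, h.d2, fun t => (h.d3 t).congr_deriv (by rw [hsum]; ring)⟩

/-- Exponential upper bound for decaying solutions. -/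
lemma exp_mul_bounded {σ τ κ C T : ℝ} (h : IsSol σ τ f v v1 v2 v3) (hσ : 0 < σ) (hσκ : σ < κ)
    (hκτ : κ < τ) (hC : 0 ≤ C) (hf : ∀ t, T ≤ t → f (v t) ≤ C * Real.exp (-κ * t))
    (l0 : Tendsto v atTop (𝓝 0)) (l1 : Tendsto v1 atTop (𝓝 0)) (l2 : Tendsto v2 atTop (𝓝 0)) :
    ∃ C', ∀ t, T ≤ t → Real.exp (σ * t) * v t ≤ C' := by
  have hκ : 0 < κ := hσ.trans hσκ
  have hτ : 0 < τ := hκ.trans hκτ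
  have hτκ : 0 < τ ^ 2 - κ ^ 2 := by nlinarith
  set E : ℝ → ℝ := fun t => Real.exp (-κ * t)
  have hE : ∀ t, HasDerivAt E (-κ * E t) t := fun t => hasDerivAt_exp_mul (-κ) t
  have hEpos : ∀ t, 0 < E t := fun t => Real.exp_pos _
  have hElim : Tendsto E atTop (𝓝 0) :=
    Real.tendsto_exp_atBot.comp (tendsto_id.const_mul_atTop_of_neg (by linarith))
  -- C1 exp(-κt) is a barrier for v'' - σ²v: the first summand absorbs the source, using κ < τ, and
  -- the second dominates the value at T.
  set C1 : ℝ := C / (τ ^ 2 - κ ^ 2) + |v2 T - σ ^ 2 * v T| / E T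
  have hC1 : 0 ≤ C1 := by have := (hEpos T).le; positivity
  have hC1C : C ≤ C1 * (τ ^ 2 - κ ^ 2) := by
    have h1 : C / (τ ^ 2 - κ ^ 2) * (τ ^ 2 - κ ^ 2) = C := by field_simp
    have h2 : 0 ≤ |v2 T - σ ^ 2 * v T| / E T * (τ ^ 2 - κ ^ 2) := by
      have := (hEpos T).le; positivity
    simp only [C1]; linarith
  have hC1T : |v2 T - σ ^ 2 * v T| ≤ C1 * E T := by
    have h1 : |v2 T - σ ^ 2 * v T| / E T * E T = |v2 T - σ ^ 2 * v T| := by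
      have := (hEpos T).ne'; field_simp
    have h2 : 0 ≤ C / (τ ^ 2 - κ ^ 2) * E T := by have := (hEpos T).le; positivity
    simp only [C1]; linarith
  have hζ : ∀ t, T ≤ t → -(C1 * E t) ≤ v2 t - σ ^ 2 * v t := by
    intro t ht
    have := nonneg_of_second_deriv_le (y := fun t => v2 t - σ ^ 2 * v t + C1 * E t)
      (y1 := fun t => v3 t - σ ^ 2 * v1 t + C1 * (-κ * E t))
      (y2 := fun t => τ ^ 2 * (v2 t - σ ^ 2 * v t) + f (v t) + C1 * (-κ * (-κ * E t)))
      (fun t => (h.dz t).add ((hE t).const_mul C1))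
      (fun t => (h.dz1 t).add (((hE t).const_mul (-κ)).const_mul C1)) hτ.le (T := T)
      (fun s hs => by
        have h1 := hf s hs
        have h2 : C * E s ≤ C1 * (τ ^ 2 - κ ^ 2) * E s :=
          mul_le_mul_of_nonneg_right hC1C (hEpos s).le
        have h3 : Real.exp (-κ * s) = E s := rfl
        rw [h3] at h1
        linarith)
      (by linarith [neg_abs_le (v2 T - σ ^ 2 * v T)])
      (by simpa using (l2.sub (l0.const_mul (σ ^ 2))).add (hElim.const_mul C1)) ht
    linarith
  -- The factor D - σ, inverted from infinity, turns the barrier into v' + σv ≤ C2 exp(-κt). Hence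
  -- the derivative of exp(σt) v is at most C2 exp(-(κ - σ)t), which is integrable as κ > σ.
  set C2 : ℝ := C1 / (κ + σ)
  have hC2 : (κ + σ) * C2 = C1 := by simp only [C2]; field_simp
  have hy : ∀ t, T ≤ t → v1 t + σ * v t ≤ C2 * E t := by
    intro t ht
    have := nonneg_of_deriv_le (y := fun t => C2 * E t - (v1 t + σ * v t))
      (y1 := fun t => C2 * (-κ * E t) - (v2 t + σ * v1 t))
      (fun t => ((hE t).const_mul C2).sub ((h.d1 t).add ((h.d0 t).const_mul σ))) hσ (T := T)
      (fun s hs => by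
        have h1 := hζ s hs
        rw [← hC2] at h1
        linarith)
      (by simpa using (hElim.const_mul C2).sub (l1.add (l0.const_mul σ))) ht
    linarith
  have hd : 0 < κ - σ := by linarith
  have hΦ : ∀ t, HasDerivAt (fun t => Real.exp (σ * t) * v t +
      C2 / (κ - σ) * Real.exp (-(κ - σ) * t))
      (σ * Real.exp (σ * t) * v t + Real.exp (σ * t) * v1 t +
        C2 / (κ - σ) * (-(κ - σ) * Real.exp (-(κ - σ) * t))) t := fun t =>
    ((hasDerivAt_exp_mul σ t).mul (h.d0 t)).add ((hasDerivAt_exp_mul _ t).const_mul _)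
  refine ⟨_, fun t ht => le_trans ?_ (le_of_hasDerivAt_nonpos hΦ ht fun s hs => ?_)⟩
  · have : 0 ≤ C2 / (κ - σ) * Real.exp (-(κ - σ) * t) := by positivity
    linarith
  · have h1 := mul_le_mul_of_nonneg_left (hy s hs.1.le) (Real.exp_pos (σ * s)).le
    have h2 : Real.exp (σ * s) * (C2 * E s) = C2 * Real.exp (-(κ - σ) * s) := by
      have : Real.exp (σ * s) * E s = Real.exp (-(κ - σ) * s) := by
        simp only [E]; rw [← Real.exp_add]; ring_nf
      rw [← this]; ring
    have h3 : C2 / (κ - σ) * (-(κ - σ) * Real.exp (-(κ - σ) * s)) =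
        -(C2 * Real.exp (-(κ - σ) * s)) := by field_simp
    linarith

end IsSol

namespace PosSol

/-- Decay rates slightly below the linear one. -/
lemma exists_exp_bound (hF : Admissible a b K M a0 f) (h : PosSol a b f M v v1 v2 v3)
    (heven : ∀ t, v (-t) = v t) (hl : Tendsto v atTop (𝓝 0)) {σ τ : ℝ} (hσ : 0 < σ)
    (hστ : σ < τ) (hsum : σ ^ 2 + τ ^ 2 = a ^ 2 + b ^ 2)
    (hf : ∀ η, a ^ 2 * b ^ 2 - σ ^ 2 * τ ^ 2 < η → ∀ᶠ x in 𝓝[>] 0, f x ≤ η * x)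
    {ε : ℝ} (hε : 0 < ε) : ∃ C, 0 ≤ C ∧ ∀ t, v t ≤ C * Real.exp (-(σ - ε) * |t|) := by
  obtain ⟨l1, l2, -, -⟩ := h.tendsto_derivs hF hl
  -- Lowering σ to ρ > 0 with σ² + τ² fixed lowers the product of the squares. Near zero the
  -- nonlinearity of the new factorization is then nonpositive, so `exp_mul_bounded` applies with C
  -- = 0.
  set ρ := max (σ - ε) (σ / 2)
  have hρ : 0 < ρ := lt_max_of_lt_right (by linarith)
  have hρσ : ρ < σ := max_lt (by linarith) (by linarith)
  have hsq : ρ ^ 2 < σ ^ 2 := by gcongr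
  have hστ2 : σ ^ 2 < τ ^ 2 := by gcongr
  have hA : 0 < σ ^ 2 + τ ^ 2 - ρ ^ 2 := by nlinarith [sq_nonneg σ]
  set τ' := Real.sqrt (σ ^ 2 + τ ^ 2 - ρ ^ 2)
  have hτ' : τ' ^ 2 = σ ^ 2 + τ ^ 2 - ρ ^ 2 := Real.sq_sqrt hA.le
  have hττ' : τ < τ' := Real.lt_sqrt_of_sq_lt (by linarith)
  have hprod : ρ ^ 2 * τ' ^ 2 < σ ^ 2 * τ ^ 2 := by rw [hτ']; nlinarith
  have hvpos : Tendsto v atTop (𝓝[>] 0) :=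
    tendsto_nhdsWithin_iff.2 ⟨hl, Eventually.of_forall h.pos⟩
  obtain ⟨T, hT⟩ := eventually_atTop.1
    (hvpos.eventually (hf (a ^ 2 * b ^ 2 - ρ ^ 2 * τ' ^ 2) (by linarith)))
  obtain ⟨C, hC⟩ := (h.sol.change_coeff (σ := ρ) (τ := τ') (by rw [hτ']; linarith)).exp_mul_bounded
    (κ := τ) hρ (hρσ.trans hστ) hττ' le_rfl (T := T) (fun t ht => by
      rw [zero_mul]; linarith [hT t ht]) hl l1 l2
  have hM : 0 ≤ M := (h.pos 0).le.trans (h.le 0)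
  have key : ∀ t, 0 ≤ t → Real.exp (ρ * t) * v t ≤ |C| + Real.exp (ρ * T) * M := fun t ht => by
    rcases le_total T t with htT | htT
    · have := hC t htT
      have h2 : 0 ≤ Real.exp (ρ * T) * M := by positivity
      linarith [le_abs_self C]
    · have h1 : Real.exp (ρ * t) * v t ≤ Real.exp (ρ * T) * M :=
        mul_le_mul (Real.exp_le_exp.2 (mul_le_mul_of_nonneg_left htT hρ.le)) (h.le t)
          (h.pos t).le (Real.exp_pos _).le
      linarith [abs_nonneg C]
  refine ⟨|C| + Real.exp (ρ * T) * M, by positivity, fun t => ?_⟩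
  have habs : v t = v |t| := by
    rcases abs_choice t with h | h <;> rw [h]
    rw [heven]
  have h1 := key |t| (abs_nonneg t)
  rw [← habs] at h1
  have h2 : v t ≤ (|C| + Real.exp (ρ * T) * M) * Real.exp (-ρ * |t|) := by
    have e : v t = Real.exp (ρ * |t|) * v t * Real.exp (-ρ * |t|) := by
      rw [mul_right_comm, ← Real.exp_add]; simp
    rw [e]
    gcongr
  refine h2.trans ?_
  gcongr
  exact le_max_left _ _

/-- The exact exponential rate, when `f(x) - β x = O(x ^ r)` with `r > 1`. -/
lemma exists_limit_exp_mul (hF : Admissible a b K M a0 f) (h : PosSol a b f M v v1 v2 v3)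
    (heven : ∀ t, v (-t) = v t) (hl : Tendsto v atTop (𝓝 0)) {σ τ : ℝ} (hσ : 0 < σ)
    (hστ : σ < τ) (hsum : σ ^ 2 + τ ^ 2 = a ^ 2 + b ^ 2)
    (hf : ∀ η, a ^ 2 * b ^ 2 - σ ^ 2 * τ ^ 2 < η → ∀ᶠ x in 𝓝[>] 0, f x ≤ η * x)
    (hge : ∀ t, (a ^ 2 * b ^ 2 - σ ^ 2 * τ ^ 2) * v t ≤ f (v t)) {r C : ℝ} (hr : 1 < r)
    (hrC : ∀ᶠ x in 𝓝[>] 0, f x - (a ^ 2 * b ^ 2 - σ ^ 2 * τ ^ 2) * x ≤ C * x ^ r) :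
    ∃ l, 0 < l ∧ Tendsto (fun t => Real.exp (σ * |t|) * v t) (cocompact ℝ) (𝓝 l) := by
  obtain ⟨l1, l2, -, -⟩ := h.tendsto_derivs hF hl
  have hsol := h.sol.change_coeff hsum
  have hz := hsol.z_nonpos_of_bounded (hσ.trans hστ).le (fun t => (h.pos t).le)
    (fun t => by linarith [hge t]) h.le
  -- For the factorization with σ and τ the source f(v) - βv is nonnegative, where β = a²b² - σ²τ².
  -- The Harnack constant becomes σ, so exp(σt) v is nondecreasing.
  have hH := hsol.abs_deriv_le hσ.le h.pos hz
  have hmono : Monotone fun t => Real.exp (σ * t) * v t := fun s t hst =>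
    le_of_hasDerivAt_nonneg (fun t => (hasDerivAt_exp_mul σ t).mul (h.sol.d0 t)) hst fun x _ => by
      have := mul_nonneg (Real.exp_pos (σ * x)).le
        (by linarith [(_root_.abs_le.1 (hH x)).1] : 0 ≤ v1 x + σ * v x)
      linarith
  have hr0 : 0 < r := by linarith
  have hσr : σ < r * σ := by nlinarith
  -- κ lies strictly between σ and both rσ and τ. The almost sharp decay with loss ε = σ - κ/r gives
  -- v^r = O(exp(-κt)), which is an admissible source.
  set κ := (σ + min (r * σ) τ) / 2
  have hmin : σ < min (r * σ) τ := lt_min hσr hστ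
  have hκσ : σ < κ := by simp only [κ]; linarith
  have hκτ : κ < τ := by simp only [κ]; linarith [min_le_right (r * σ) τ]
  have hκr : κ < r * σ := by simp only [κ]; linarith [min_le_left (r * σ) τ]
  have hε : 0 < σ - κ / r := by
    rw [sub_pos, div_lt_iff₀ hr0]; linarith
  obtain ⟨D, hD, hDb⟩ := h.exists_exp_bound hF heven hl hσ hστ hsum hf hε
  have hvpos : Tendsto v atTop (𝓝[>] 0) :=
    tendsto_nhdsWithin_iff.2 ⟨hl, Eventually.of_forall h.pos⟩
  obtain ⟨T, hT⟩ := eventually_atTop.1 ((hvpos.eventually hrC).and (eventually_ge_atTop 0))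
  obtain ⟨C', hC'⟩ := hsol.exp_mul_bounded (κ := κ) (C := |C| * D ^ r) (T := T) hσ hκσ hκτ
    (by positivity) (fun t ht => by
      obtain ⟨h1, h2⟩ := hT t ht
      have h3 := hDb t
      rw [abs_of_nonneg h2] at h3
      have h4 : v t ^ r ≤ (D * Real.exp (-(σ - (σ - κ / r)) * t)) ^ r :=
        Real.rpow_le_rpow (h.pos t).le h3 hr0.le
      have h5 : (D * Real.exp (-(σ - (σ - κ / r)) * t)) ^ r = D ^ r * Real.exp (-κ * t) := by
        rw [Real.mul_rpow hD (Real.exp_pos _).le, ← Real.exp_mul]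
        congr 2
        field_simp
        ring
      rw [h5] at h4
      have h6 : C * v t ^ r ≤ |C| * v t ^ r :=
        mul_le_mul_of_nonneg_right (le_abs_self C) (Real.rpow_nonneg (h.pos t).le r)
      have h7 := mul_le_mul_of_nonneg_left h4 (abs_nonneg C)
      linarith) hl l1 l2
  have hbdd : BddAbove (range fun t => Real.exp (σ * t) * v t) := by
    refine ⟨C', ?_⟩
    rintro _ ⟨t, rfl⟩
    exact (hmono (le_max_left t T)).trans (hC' _ (le_max_right t T))
  have hlim := tendsto_atTop_ciSup hmono hbdd
  refine ⟨⨆ t, Real.exp (σ * t) * v t, ?_, ?_⟩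
  · have h0 := le_ciSup hbdd 0
    simp only [mul_zero, Real.exp_zero, one_mul] at h0
    exact (h.pos 0).trans_le h0
  · refine (hlim.comp (tendsto_norm_cocompact_atTop (E := ℝ))).congr fun t => ?_
    simp only [Function.comp_apply, Real.norm_eq_abs]
    rcases abs_choice t with h | h <;> rw [h]
    rw [heven]

end PosSol
end

/-! ### Truncation of the nonlinearity and passage to the original equation -/

noncomputable section

lemma coeffA_eq (n : ℕ) : coeffA n = (((n : ℝ) - 4) / 2) ^ 2 + ((n : ℝ) / 2) ^ 2 := by
  unfold coeffA; ring

lemma coeffB_eq (n : ℕ) : coeffB n = (((n : ℝ) - 4) / 2) ^ 2 * ((n : ℝ) / 2) ^ 2 := by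
  unfold coeffB; ring

/-- The nonlinearity that vanishes on `(-∞, 0]`, agrees with `g` on `(0, M]` and is linear on
`[M, ∞)`. -/
def truncate (g : ℝ → ℝ) (M t : ℝ) : ℝ := max t 0 * (g (min t M) / min t M)

section Truncate

variable {g : ℝ → ℝ} {M t : ℝ}

lemma truncate_of_nonpos (ht : t ≤ 0) : truncate g M t = 0 := by
  rw [truncate, max_eq_right ht, zero_mul]

lemma truncate_of_le (ht : 0 < t) (htM : t ≤ M) : truncate g M t = g t := by
  rw [truncate, max_eq_left ht.le, min_eq_left htM, mul_div_cancel₀ _ ht.ne']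

lemma truncate_of_ge (hM : 0 < M) (htM : M ≤ t) : truncate g M t = t * (g M / M) := by
  rw [truncate, max_eq_left (hM.le.trans htM), min_eq_right htM]

end Truncate

namespace GrowthConditions

variable {n : ℕ} {g : ℝ → ℝ} {β : ℝ}

lemma hasDerivAt (hg : GrowthConditions n g β) {t : ℝ} (ht : 0 < t) :
    HasDerivAt g (deriv g t) t :=
  ((hg.contDiffOn.differentiableOn (by norm_num)).differentiableAt (Ioi_mem_nhds ht)).hasDerivAt

lemma continuousOn_div (hg : GrowthConditions n g β) :
    ContinuousOn (fun t => g t / t) (Ioi 0) := fun _ ht =>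
  ((hg.hasDerivAt ht).continuousAt.div continuousAt_id (ne_of_gt ht)).continuousWithinAt

/-- By the quotient rule, g(t)/t < g'(t) says exactly that the quotient has positive derivative. -/
lemma strictMonoOn_div (hg : GrowthConditions n g β) :
    StrictMonoOn (fun t => g t / t) (Ioi 0) := by
  refine strictMonoOn_of_deriv_pos (convex_Ioi 0) hg.continuousOn_div fun t ht => ?_
  rw [interior_Ioi] at ht
  have ht0 : 0 < t := ht
  have h1 := (hg.hasDerivAt ht0).div (hasDerivAt_id t) ht0.ne'
  have h2 := hg.lt_deriv t ht0
  rw [div_lt_iff₀ ht0] at h2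
  rw [show (fun t => g t / t) = g / id from rfl, h1.deriv]
  simp only [id, mul_one]
  exact div_pos (by linarith) (by positivity)

lemma div_le_div (hg : GrowthConditions n g β) {s t : ℝ} (hs : 0 < s) (hst : s ≤ t) :
    g s / s ≤ g t / t :=
  hg.strictMonoOn_div.monotoneOn hs (hs.trans_le hst) hst

lemma tendsto_div (hg : GrowthConditions n g β) :
    Tendsto (fun t => g t / t) (𝓝[>] 0) (𝓝 β) := by
  have hid : Tendsto (fun t : ℝ => t) (𝓝[>] 0) (𝓝 0) := tendsto_id.mono_left nhdsWithin_le_nhds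
  refine HasDerivAt.lhopital_zero_nhdsGT (f' := deriv g) (g' := fun _ => 1) ?_ ?_ ?_
    hg.tendsto_zero hid ?_
  · filter_upwards [self_mem_nhdsWithin] with t ht using hg.hasDerivAt ht
  · exact Eventually.of_forall hasDerivAt_id
  · exact Eventually.of_forall fun _ => one_ne_zero
  · simpa using hg.tendsto_deriv

lemma beta_le_div (hg : GrowthConditions n g β) {t : ℝ} (ht : 0 < t) : β ≤ g t / t := by
  refine le_of_tendsto hg.tendsto_div ?_
  filter_upwards [Ioo_mem_nhdsGT ht] with s hs using hg.div_le_div hs.1 hs.2.le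

lemma beta_mul_le (hg : GrowthConditions n g β) {t : ℝ} (ht : 0 < t) : β * t ≤ g t :=
  (le_div_iff₀ ht).1 (hg.beta_le_div ht)

lemma beta_nonneg (hg : GrowthConditions n g β) : 0 ≤ β := by
  refine ge_of_tendsto hg.tendsto_div ?_
  filter_upwards [self_mem_nhdsWithin] with t ht using (div_pos (hg.pos t ht) ht).le

lemma eventually_le_mul (hg : GrowthConditions n g β) {η : ℝ} (hη : β < η) :
    ∀ᶠ x in 𝓝[>] 0, g x ≤ η * x := by
  filter_upwards [hg.tendsto_div.eventually (gt_mem_nhds hη), self_mem_nhdsWithin] with x hx hx0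
  exact ((div_lt_iff₀ hx0).1 hx).le

lemma tendsto_div_atTop (hg : GrowthConditions n g β) :
    Tendsto (fun t => g t / t) atTop atTop := by
  obtain ⟨q, c, hq, hc, h⟩ := hg.superlinear
  refine tendsto_atTop_mono' _ ?_
    ((tendsto_rpow_atTop (by linarith : 0 < q - 1)).const_mul_atTop hc)
  filter_upwards [eventually_ge_atTop 1] with t ht
  have ht0 : 0 < t := by linarith
  rw [Real.rpow_sub_one ht0.ne', ← mul_div_assoc]
  exact div_le_div_of_nonneg_right (h t ht) ht0.le

lemma exists_fixed (hg : GrowthConditions n g β) : ∃ a0, 0 < a0 ∧ g a0 = coeffB n * a0 := by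
  obtain ⟨s, hs, hs0⟩ := ((hg.tendsto_div.eventually (gt_mem_nhds hg.beta_lt)).and
    self_mem_nhdsWithin).exists
  obtain ⟨t, ht, ht0⟩ := ((hg.tendsto_div_atTop.eventually (eventually_ge_atTop (coeffB n))).and
    (eventually_gt_atTop 0)).exists
  obtain ⟨a0, ha0, h⟩ := isPreconnected_Ioi.intermediate_value hs0 ht0 hg.continuousOn_div
    ⟨hs.le, ht⟩
  exact ⟨a0, ha0, (div_eq_iff (ne_of_gt ha0)).1 h⟩

lemma fixed_unique (hg : GrowthConditions n g β) {s t : ℝ} (hs : 0 < s) (ht : 0 < t)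
    (hs' : g s = coeffB n * s) (ht' : g t = coeffB n * t) : s = t :=
  hg.strictMonoOn_div.injOn hs ht
    (((div_eq_iff hs.ne').2 hs').trans ((div_eq_iff ht.ne').2 ht').symm)

lemma truncate_monotone (hg : GrowthConditions n g β) {M : ℝ} (hM : 0 < M) {x y : ℝ}
    (hxy : x ≤ y) : truncate g M x ≤ truncate g M y := by
  have hpos : ∀ {t : ℝ}, 0 < t → 0 ≤ g (min t M) / min t M := fun ht =>
    (div_pos (hg.pos _ (lt_min ht hM)) (lt_min ht hM)).le
  rcases le_or_gt x 0 with hx | hx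
  · rw [truncate_of_nonpos hx]
    rcases le_or_gt y 0 with hy | hy
    · rw [truncate_of_nonpos hy]
    · exact mul_nonneg (le_max_right _ _) (hpos hy)
  · exact mul_le_mul (max_le_max hxy le_rfl) (hg.div_le_div (lt_min hx hM) (min_le_min hxy le_rfl))
      (hpos hx) (le_max_right _ _)

/-- The upper bound on g' together with the monotone quotient g(t)/t ≤ g(M)/M bounds g' on (0, M],
even near 0. -/
lemma sub_le_of_le (hg : GrowthConditions n g β) (hn : 5 ≤ n) {M x y : ℝ} (hx : 0 < x)
    (hxy : x ≤ y) (hyM : y ≤ M) :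
    g y - g x ≤ ((n : ℝ) + 4) / ((n : ℝ) - 4) * (g M / M) * (y - x) := by
  have hn' : (5 : ℝ) ≤ n := by exact_mod_cast hn
  refine (convex_Icc x y).image_sub_le_mul_sub_of_deriv_le (f := g) (fun t ht =>
    (hg.hasDerivAt (hx.trans_le ht.1)).continuousAt.continuousWithinAt) ?_ ?_ x
    (left_mem_Icc.2 hxy) y (right_mem_Icc.2 hxy) hxy
  · rw [interior_Icc]
    exact fun t ht => (hg.hasDerivAt (hx.trans ht.1)).differentiableAt.differentiableWithinAt
  · rw [interior_Icc]
    intro t ht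
    have ht0 := hx.trans ht.1
    refine (hg.deriv_le t ht0).trans (mul_le_mul_of_nonneg_left
      (hg.div_le_div ht0 (ht.2.le.trans hyM)) ?_)
    exact div_nonneg (by linarith) (by linarith)

lemma truncate_lipschitz (hg : GrowthConditions n g β) (hn : 5 ≤ n) {M : ℝ} (hM : 0 < M) :
    MonotoneLipschitz (((n : ℝ) + 4) / ((n : ℝ) - 4) * (g M / M)) (truncate g M) := by
  have hn' : (5 : ℝ) ≤ n := by exact_mod_cast hn
  have hh : 0 < g M / M := div_pos (hg.pos M hM) hM
  have hp : 1 ≤ ((n : ℝ) + 4) / ((n : ℝ) - 4) := by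
    rw [le_div_iff₀ (by linarith)]; linarith
  set K := ((n : ℝ) + 4) / ((n : ℝ) - 4) * (g M / M) with hK
  have hhK : g M / M ≤ K := le_mul_of_one_le_left hh.le hp
  have hlin : ∀ x y, M ≤ x → x ≤ y → truncate g M y - truncate g M x ≤ K * (y - x) := by
    intro x y hx hxy
    rw [truncate_of_ge hM hx, truncate_of_ge hM (hx.trans hxy), ← sub_mul, mul_comm]
    exact mul_le_mul_of_nonneg_right hhK (sub_nonneg.2 hxy)
  have hmid : ∀ x y, 0 < x → x ≤ y → y ≤ M → truncate g M y - truncate g M x ≤ K * (y - x) := by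
    intro x y hx hxy hy
    rw [truncate_of_le hx (hxy.trans hy), truncate_of_le (hx.trans_le hxy) hy]
    exact hg.sub_le_of_le hn hx hxy hy
  refine ⟨hh.le.trans hhK, fun x y => hg.truncate_monotone hM, fun x y hxy => ?_⟩
  rcases le_or_gt x 0 with hx | hx
  · rw [truncate_of_nonpos hx, sub_zero]
    rcases le_or_gt y 0 with hy | hy
    · rw [truncate_of_nonpos hy]
      exact mul_nonneg (hh.le.trans hhK) (sub_nonneg.2 hxy)
    · rw [truncate, max_eq_left hy.le, mul_comm]
      exact mul_le_mul ((hg.div_le_div (lt_min hy hM) (min_le_right y M)).trans hhK)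
        (by linarith) hy.le (hh.le.trans hhK)
  · rcases le_total y M with hy | hy
    · exact hmid x y hx hxy hy
    · rcases le_total x M with hxM | hxM
      · have := hmid x M hx hxM le_rfl
        have := hlin M y le_rfl hy
        linarith
      · exact hlin x y hxM hxy

/-- A superlinear nonlinearity agrees with an admissible one on an interval `(0, M]` containing
the values of all positive solutions. -/
lemma exists_admissible (hg : GrowthConditions n g β) (hn : 5 ≤ n) {a0 : ℝ} (ha0 : 0 < a0)
    (heq : g a0 = coeffB n * a0) :
    ∃ K M : ℝ, ∃ f : ℝ → ℝ, Admissible (((n : ℝ) - 4) / 2) ((n : ℝ) / 2) K M a0 f ∧ a0 ≤ M ∧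
      (∀ t, 0 < t → t ≤ M → f t = g t) ∧ ∀ t, M * Real.exp (-(((n : ℝ) - 4) / 2)) ≤ t →
        ((((n : ℝ) - 4) / 2) ^ 2 * ((n : ℝ) / 2) ^ 2 + 16 * ((((n : ℝ) - 4) / 2) ^ 2 +
          ((n : ℝ) / 2) ^ 2 + 2 * (((n : ℝ) - 4) / 2)) * Real.exp (2 * (((n : ℝ) - 4) / 2)) + 1) * t
          ≤ g t := by
  have hn' : (5 : ℝ) ≤ n := by exact_mod_cast hn
  rw [coeffB_eq] at heq
  set a := ((n : ℝ) - 4) / 2 with ha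
  set b := (n : ℝ) / 2 with hb
  have ha_pos : 0 < a := by simp only [ha]; linarith
  have hab : a < b := by simp only [ha, hb]; linarith
  set H := a ^ 2 * b ^ 2 + 16 * (a ^ 2 + b ^ 2 + 2 * a) * Real.exp (2 * a) + 1
  obtain ⟨R, hR, hRa⟩ := ((hg.tendsto_div_atTop.eventually (eventually_ge_atTop H)).and
    (eventually_ge_atTop a0)).exists
  have hR0 : 0 < R := ha0.trans_le hRa
  -- The universal bound needs the growth condition from M exp(-a) on, and this equals R.
  set M := R * Real.exp a with hMdef
  have hMR : M * Real.exp (-a) = R := by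
    rw [hMdef, mul_assoc, ← Real.exp_add, add_neg_cancel, Real.exp_zero, mul_one]
  have hRM : R ≤ M := le_mul_of_one_le_right hR0.le (Real.one_le_exp ha_pos.le)
  have hM : 0 < M := hR0.trans_le hRM
  have hlarge : ∀ t, R ≤ t → H ≤ g t / t := fun t ht => hR.trans (hg.div_le_div hR0 ht)
  have hform : ∀ t, 0 < t → truncate g M t = g (min t M) / min t M * t := fun t ht => by
    rw [truncate, max_eq_left ht.le, mul_comm]
  have hdiv : g a0 / a0 = a ^ 2 * b ^ 2 := (div_eq_iff ha0.ne').2 heq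
  refine ⟨_, M, truncate g M, ⟨ha_pos, hab, hg.truncate_lipschitz hn hM, truncate_of_nonpos le_rfl,
    ha0, fun t ht hta => ?_, ?_, fun t hta => ?_, fun s t hs hst => ?_, fun t ht => ?_⟩,
    hRa.trans hRM, fun t => truncate_of_le, fun t ht => ?_⟩
  · rw [hform t ht, min_eq_left ((hta.le.trans hRa).trans hRM), ← hdiv]
    exact mul_lt_mul_of_pos_right (hg.strictMonoOn_div ht ha0 hta) ht
  · rw [truncate_of_le ha0 (hRa.trans hRM), heq]
  · have ht := ha0.trans hta
    rw [hform t ht, ← hdiv]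
    have hmin : a0 < min t M := lt_min hta (hRa.trans_lt (lt_mul_of_one_lt_right hR0
      (Real.one_lt_exp_iff.2 ha_pos)))
    exact mul_lt_mul_of_pos_right (hg.strictMonoOn_div ha0 (ha0.trans hmin) hmin) ht
  · have ht := hs.trans_le hst
    rw [hform t ht, hform s hs, mul_assoc, mul_assoc, mul_comm t s]
    exact mul_le_mul_of_nonneg_right
      (hg.div_le_div (lt_min hs hM) (min_le_min hst le_rfl)) (by positivity)
  · rw [hMR] at ht
    rw [hform t (hR0.trans_le ht)]
    exact mul_le_mul_of_nonneg_right (hlarge _ (le_min ht hRM)) (hR0.le.trans ht)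
  · rw [hMR] at ht
    exact (le_div_iff₀ (hR0.trans_le ht)).1 (hlarge t ht)

end GrowthConditions

lemma contDiff_succ_of_hasDerivAt {φ φ' : ℝ → ℝ} {k : ℕ} (h : ∀ t, HasDerivAt φ (φ' t) t)
    (hφ : ContDiff ℝ k φ') : ContDiff ℝ (k + 1 : ℕ) φ := by
  have hd : deriv φ = φ' := funext fun t => (h t).deriv
  rw [Nat.cast_succ, contDiff_succ_iff_deriv, hd]
  exact ⟨fun t => (h t).differentiableAt, by simp, hφ⟩

lemma iteratedDeriv_succ_of_hasDerivAt {v φ φ' : ℝ → ℝ} {k : ℕ} (h : iteratedDeriv k v = φ)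
    (hφ : ∀ t, HasDerivAt φ (φ' t) t) : iteratedDeriv (k + 1) v = φ' := by
  rw [iteratedDeriv_succ, h]
  exact funext fun t => (hφ t).deriv

section Conversion

variable {n : ℕ} {g f v v1 v2 v3 : ℝ → ℝ} {M : ℝ}

lemma IsODESolution.isSol (h : IsODESolution n g v) :
    IsSol (((n : ℝ) - 4) / 2) ((n : ℝ) / 2) g v (iteratedDeriv 1 v) (iteratedDeriv 2 v)
      (iteratedDeriv 3 v) := by
  have hd : ∀ k : ℕ, k < 4 → ∀ t, HasDerivAt (iteratedDeriv k v) (iteratedDeriv (k + 1) v t) t := by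
    intro k hk t
    rw [iteratedDeriv_succ]
    exact (h.1.differentiable_iteratedDeriv k (by exact_mod_cast hk) t).hasDerivAt
  refine ⟨fun t => ?_, hd 1 (by norm_num), hd 2 (by norm_num), fun t => ?_⟩
  · simpa using hd 0 (by norm_num) t
  · refine (hd 3 (by norm_num) t).congr_deriv ?_
    have := h.2 t
    rw [coeffA_eq, coeffB_eq] at this
    linarith

/-- Positive solutions of the original equation are solutions of the truncated one. -/
lemma IsPositiveSolution.posSol {β : ℝ} (hg : GrowthConditions n g β) (hn : 5 ≤ n)
    (hfg : ∀ t, 0 < t → t ≤ M → f t = g t)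
    (hlarge : ∀ t, M * Real.exp (-(((n : ℝ) - 4) / 2)) ≤ t →
        ((((n : ℝ) - 4) / 2) ^ 2 * ((n : ℝ) / 2) ^ 2 + 16 * ((((n : ℝ) - 4) / 2) ^ 2 +
          ((n : ℝ) / 2) ^ 2 + 2 * (((n : ℝ) - 4) / 2)) * Real.exp (2 * (((n : ℝ) - 4) / 2)) + 1) * t
          ≤ g t) (h : IsPositiveSolution n g v) :
    PosSol (((n : ℝ) - 4) / 2) ((n : ℝ) / 2) f M v (iteratedDeriv 1 v) (iteratedDeriv 2 v)
      (iteratedDeriv 3 v) := by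
  have hn' : (5 : ℝ) ≤ n := by exact_mod_cast hn
  obtain ⟨q, c, hq, hc, hqc⟩ := hg.superlinear
  have hs := h.1.isSol
  -- Both steps use g itself: no bound on v is known yet, so the truncation cannot be invoked before
  -- v ≤ M is established.
  have hz := hs.z_nonpos_of_superlinear (by positivity) h.2 (fun t ht => (hg.pos t ht).le) hq hc hqc
  have hle := hs.le_of_large (by linarith) h.2 hz hlarge
  exact ⟨⟨hs.d0, hs.d1, hs.d2, fun t => by rw [hfg _ (h.2 t) (hle t)]; exact hs.d3 t⟩, h.2, hle⟩

lemma PosSol.iteratedDeriv_eq {a b : ℝ} (h : PosSol a b f M v v1 v2 v3) :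
    iteratedDeriv 1 v = v1 ∧ iteratedDeriv 2 v = v2 ∧ iteratedDeriv 3 v = v3 := by
  have e1 : iteratedDeriv 1 v = v1 := iteratedDeriv_succ_of_hasDerivAt iteratedDeriv_zero h.sol.d0
  have e2 : iteratedDeriv 2 v = v2 := iteratedDeriv_succ_of_hasDerivAt e1 h.sol.d1
  exact ⟨e1, e2, iteratedDeriv_succ_of_hasDerivAt e2 h.sol.d2⟩

lemma PosSol.isPositiveSolution {K a0 : ℝ}
    (hF : Admissible (((n : ℝ) - 4) / 2) ((n : ℝ) / 2) K M a0 f)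
    (hfg : ∀ t, 0 < t → t ≤ M → f t = g t)
    (h : PosSol (((n : ℝ) - 4) / 2) ((n : ℝ) / 2) f M v v1 v2 v3) : IsPositiveSolution n g v := by
  obtain ⟨e1, e2, e3⟩ := h.iteratedDeriv_eq
  have hc2 : Continuous v2 := continuous_iff_continuousAt.2 fun t => (h.sol.d2 t).continuousAt
  refine ⟨⟨?_, fun t => ?_⟩, h.pos⟩
  · have c3 : ContDiff ℝ (0 + 1 : ℕ) v3 := contDiff_succ_of_hasDerivAt h.sol.d3 (by
      rw [Nat.cast_zero, contDiff_zero]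
      exact ((continuous_const.mul hc2).sub (continuous_const.mul h.continuous)).add
        (hF.lip.continuous.comp h.continuous))
    exact contDiff_succ_of_hasDerivAt h.sol.d0 (contDiff_succ_of_hasDerivAt h.sol.d1
      (contDiff_succ_of_hasDerivAt h.sol.d2 c3))
  · rw [iteratedDeriv_succ_of_hasDerivAt e3 h.sol.d3, e2, ← hfg _ (h.pos t) (h.le t), coeffA_eq,
      coeffB_eq]
    ring

end Conversion
end

/-! ### Infima, translates and assembly of the theorem -/

noncomputable section

namespace PosSol

variable {a b K M a0 α : ℝ} {f v v1 v2 v3 w w1 w2 w3 : ℝ → ℝ}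

lemma eq_of_isLocalExtr (hF : Admissible a b K M a0 f) (h : PosSol a b f M v v1 v2 v3) {t : ℝ}
    (ht : IsLocalExtr v t) (s : ℝ) : v (t + s) = v (t - s) :=
  (h.symm hF (ht.hasDerivAt_eq_zero (h.sol.d0 t)) s).1

lemma homoclinicToZero (hF : Admissible a b K M a0 f) (h : PosSol a b f M v v1 v2 v3) {c : ℝ}
    (hc : v1 c = 0) (hl : Tendsto v atTop (𝓝 0)) : HomoclinicToZero v := by
  obtain ⟨e1, e2, e3⟩ := h.iteratedDeriv_eq
  obtain ⟨l0, l1, l2, l3⟩ := h.tendsto_cocompact_zero hF hc hl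
  intro k hk
  interval_cases k
  · rwa [iteratedDeriv_zero]
  · rwa [e1]
  · rwa [e2]
  · rwa [e3]

lemma const_or_homoclinic_or_periodic (hF : Admissible a b K M a0 f)
    (h : PosSol a b f M v v1 v2 v3) :
    (∃ c, ∀ t, v t = c) ∨ HomoclinicToZero v ∨ ∃ L, 0 < L ∧ Function.Periodic v L := by
  rcases h.trichotomy hF with hc | ⟨-, c, d, hcd, hc, hd⟩ | ⟨c, hc, -, hl⟩
  · exact Or.inl ⟨a0, hc⟩
  · exact Or.inr (Or.inr ⟨2 * (d - c), by linarith, (h.periodic hF hc hd).1⟩)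
  · exact Or.inr (Or.inl (h.homoclinicToZero hF hc hl))

/-- A bounded solution with positive infimum below `a0` attains its infimum. -/
lemma exists_min_of_isGLB (hF : Admissible a b K M a0 f) (h : PosSol a b f M v v1 v2 v3)
    (hα : 0 < α) (hα0 : α < a0) (hglb : IsGLB (range v) α) : ∃ t, v1 t = 0 ∧ v t = α := by
  have hle : ∀ t, α ≤ v t := fun t => hglb.1 ⟨t, rfl⟩
  rcases h.trichotomy hF with hc | ⟨-, c, d, hcd, hc, hd⟩ | ⟨c, hc, -, hl⟩
  · refine absurd (hglb.2 (show a0 ∈ lowerBounds (range v) from ?_)) (not_le.2 hα0)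
    rintro _ ⟨t, rfl⟩
    exact (hc t).ge
  · obtain ⟨t, ht, hmin⟩ := h.exists_min_of_periodic (by linarith : 0 < 2 * (d - c))
      (h.periodic hF hc hd).1
    refine ⟨t, ht, le_antisymm (hglb.2 ?_) (hle t)⟩
    rintro _ ⟨s, rfl⟩
    exact hmin s
  · exact absurd (ge_of_tendsto' hl hle) (not_le.2 hα)

/-- At its minimum w has the value α and slope 0, exactly the data of v at 0. -/
lemma isTranslate_of_isGLB (hF : Admissible a b K M a0 f) (hv : PosSol a b f M v v1 v2 v3)
    (hw : PosSol a b f M w w1 w2 w3) (hα : 0 < α) (hα0 : α < a0) (hv0 : v 0 = α) (hv1 : v1 0 = 0)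
    (hglb : IsGLB (range w) α) : IsTranslate v w := by
  obtain ⟨t, ht1, ht⟩ := hw.exists_min_of_isGLB hF hα hα0 hglb
  refine ⟨-t, fun s => ?_⟩
  have := (hw.eq_of_eq hF hv (s := t) (t := 0) (by rw [ht, hv0]) (by rw [ht1, hv1]) (s - t)).1
  rwa [add_sub_cancel, zero_add, sub_eq_add_neg] at this

/-- A positive solution with infimum zero is decreasing after some critical point. -/
lemma exists_max_of_isGLB_zero (hF : Admissible a b K M a0 f) (h : PosSol a b f M v v1 v2 v3)
    (hglb : IsGLB (range v) 0) :
    ∃ c, v1 c = 0 ∧ (∀ t, c < t → v1 t < 0) ∧ Tendsto v atTop (𝓝 0) := by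
  rcases h.trichotomy hF with hc | ⟨-, c, d, hcd, hc, hd⟩ | hh
  · refine absurd (hglb.2 (show a0 ∈ lowerBounds (range v) from ?_)) (not_le.2 hF.a0_pos)
    rintro _ ⟨t, rfl⟩
    exact (hc t).ge
  · obtain ⟨t, -, hmin⟩ := h.exists_min_of_periodic (by linarith : 0 < 2 * (d - c))
      (h.periodic hF hc hd).1
    refine absurd (hglb.2 (show v t ∈ lowerBounds (range v) from ?_)) (not_le.2 (h.pos t))
    rintro _ ⟨s, rfl⟩
    exact hmin s
  · exact hh

lemma isTranslate_of_isGLB_zero (hF : Admissible a b K M a0 f) (hv : PosSol a b f M v v1 v2 v3)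
    (hw : PosSol a b f M w w1 w2 w3) (hv1 : v1 0 = 0) (hvn : ∀ t, 0 < t → v1 t < 0)
    (hvl : Tendsto v atTop (𝓝 0)) (hglb : IsGLB (range w) 0) : IsTranslate v w := by
  obtain ⟨c, hc, hn, hl⟩ := hw.exists_max_of_isGLB_zero hF hglb
  refine ⟨-c, fun s => ?_⟩
  have := (hw.shift c).homoclinic_unique hF hv (by simpa using hc) hv1
    (fun t ht => hn _ (by linarith)) hvn (hl.comp (tendsto_atTop_add_const_left _ c tendsto_id)) hvl
    (s - c)
  simpa [sub_eq_add_neg] using this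

lemma isGLB_zero (h : PosSol a b f M v v1 v2 v3) (hl : Tendsto v atTop (𝓝 0)) :
    IsGLB (range v) 0 := by
  refine ⟨?_, fun m hm => ge_of_tendsto' hl fun t => hm ⟨t, rfl⟩⟩
  rintro _ ⟨t, rfl⟩
  exact (h.pos t).le

lemma strictAntiOn (h : PosSol a b f M v v1 v2 v3) (hn : ∀ t, 0 < t → v1 t < 0) :
    StrictAntiOn v (Ici 0) := by
  refine strictAntiOn_of_deriv_neg (convex_Ici 0) h.continuous.continuousOn fun t ht => ?_
  rw [interior_Ici] at ht
  rw [(h.sol.d0 t).deriv]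
  exact hn t ht

end PosSol

/-- Existence of periodic solutions with prescribed minimum. -/
lemma Admissible.exists_periodic {a b K M a0 α : ℝ} {f : ℝ → ℝ} (hF : Admissible a b K M a0 f)
    (hα : 0 < α) (hα0 : α < a0) :
    ∃ v v1 v2 v3 : ℝ → ℝ, PosSol a b f M v v1 v2 v3 ∧ v 0 = α ∧ v1 0 = 0 ∧
      IsGLB (range v) α ∧ ∃ L, IsMinimalPeriod v L ∧
        (∀ x, ∃! t, t ∈ Ico x (x + L) ∧ IsLocalMax v t) ∧
        (∀ x, ∃! t, t ∈ Ico x (x + L) ∧ IsLocalMin v t) := by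
  obtain ⟨v, v1, v2, v3, h, h0, h1, h2⟩ := hF.exists_posSol hα hα0
  obtain ⟨c, hc0, hc, hpos⟩ := h.exists_half_period hF h1 h2
  refine ⟨v, v1, v2, v3, h, h0, h1, ⟨?_, fun m hm => h0 ▸ hm ⟨0, rfl⟩⟩, 2 * c,
    h.isMinimalPeriod hF h1 hc0 hc hpos, h.existsUnique_isLocalMax hF h1 hc0 hc hpos,
    h.existsUnique_isLocalMin hF h1 hc0 hc hpos⟩
  rintro _ ⟨t, rfl⟩
  exact h0 ▸ (h.half_period_le hF h1 hc0 hc hpos t).1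

/-- The exponents `±√μ`, `±τ` of the linearization at zero. -/
lemma GrowthConditions.exists_exponents {n : ℕ} {g : ℝ → ℝ} {β : ℝ} (hg : GrowthConditions n g β)
    (hn : 5 ≤ n) : ∃ τ, 0 < Real.sqrt (muExp n β) ∧ Real.sqrt (muExp n β) < τ ∧
      Real.sqrt (muExp n β) ^ 2 + τ ^ 2 = coeffA n ∧
      coeffB n - Real.sqrt (muExp n β) ^ 2 * τ ^ 2 = β := by
  have hn' : (5 : ℝ) ≤ n := by exact_mod_cast hn
  have hβ := hg.beta_nonneg
  have hβB : β < coeffB n := hg.beta_lt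
  have hA : 0 < coeffA n := by rw [coeffA_eq]; positivity
  have hD : 0 < coeffA n ^ 2 - 4 * (coeffB n - β) := by
    -- A² - 4B = (b² - a²)² = (2n - 4)², so the discriminant is positive because β ≥ 0.
    have : coeffA n ^ 2 - 4 * (coeffB n - β) = (2 * (n : ℝ) - 4) ^ 2 + 4 * β := by
      rw [coeffA_eq, coeffB_eq]; ring
    rw [this]
    have : 0 < 2 * (n : ℝ) - 4 := by linarith
    positivity
  have hS := Real.sqrt_pos.2 hD
  have hSA : Real.sqrt (coeffA n ^ 2 - 4 * (coeffB n - β)) < coeffA n :=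
    (Real.sqrt_lt' hA).2 (by linarith)
  have hS2 := Real.sq_sqrt hD.le
  set S := Real.sqrt (coeffA n ^ 2 - 4 * (coeffB n - β))
  have hμ : muExp n β = (coeffA n - S) / 2 := rfl
  have hμ0 : 0 < muExp n β := by rw [hμ]; linarith
  have hτ0 : 0 ≤ (coeffA n + S) / 2 := by linarith
  refine ⟨Real.sqrt ((coeffA n + S) / 2), Real.sqrt_pos.2 hμ0, Real.sqrt_lt_sqrt hμ0.le
    (by rw [hμ]; linarith), ?_, ?_⟩
  · rw [Real.sq_sqrt hμ0.le, Real.sq_sqrt hτ0, hμ]; ring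
  · rw [Real.sq_sqrt hμ0.le, Real.sq_sqrt hτ0, hμ]
    linarith [show (coeffA n - S) / 2 * ((coeffA n + S) / 2) = (coeffA n ^ 2 - S ^ 2) / 4 by ring]

end

theorem theorem1p2 (n : ℕ) (hn : 5 ≤ n) (g : ℝ → ℝ) (β : ℝ) (hg : GrowthConditions n g β) :
    -- every positive solution is constant, homoclinic to zero, or periodic
    (∀ v : ℝ → ℝ, IsPositiveSolution n g v →
      (∃ c : ℝ, ∀ t : ℝ, v t = c) ∨ HomoclinicToZero v ∨
        (∃ L : ℝ, 0 < L ∧ Function.Periodic v L)) ∧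
    -- (i) the unique positive solution of `g(a) = B a`, and the bound on the infimum
    (∃ a₀ : ℝ, (0 < a₀ ∧ g a₀ = coeffB n * a₀) ∧
      (∀ b : ℝ, 0 < b → g b = coeffB n * b → b = a₀) ∧
      (∀ v : ℝ → ℝ, IsPositiveSolution n g v →
        sInf (range v) ≤ a₀ ∧
          (sInf (range v) = a₀ ↔ ∃ c : ℝ, c ≠ 0 ∧ ∀ t : ℝ, v t = c)) ∧
      -- (ii) the bounded solutions with infimum `a ∈ (0, a₀)`
      (∀ a : ℝ, 0 < a → a < a₀ →
        ∃ v : ℝ → ℝ,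
          (IsODESolution n g v ∧ Bornology.IsBounded (range v) ∧ IsGLB (range v) a) ∧
          (∀ w : ℝ → ℝ, IsODESolution n g w → Bornology.IsBounded (range w) →
            IsGLB (range w) a → IsTranslate v w) ∧
          (∃ L : ℝ, IsMinimalPeriod v L ∧
            (∀ x : ℝ, ∃! t : ℝ, t ∈ Ico x (x + L) ∧ IsLocalMax v t) ∧
            (∀ x : ℝ, ∃! t : ℝ, t ∈ Ico x (x + L) ∧ IsLocalMin v t)) ∧
          (∀ t₀ : ℝ, IsLocalExtr v t₀ → ∀ s : ℝ, v (t₀ + s) = v (t₀ - s)))) ∧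
    -- (iii) the positive solution with infimum zero, translated so that it is even
    (∃ v : ℝ → ℝ,
      (IsPositiveSolution n g v ∧ IsGLB (range v) 0) ∧
      (∀ w : ℝ → ℝ, IsPositiveSolution n g w → IsGLB (range w) 0 → IsTranslate v w) ∧
      HomoclinicToZero v ∧
      (∀ t : ℝ, v (-t) = v t) ∧ StrictAntiOn v (Ici 0) ∧
      (∀ ε : ℝ, 0 < ε → ∃ C : ℝ, ∀ t : ℝ,
        v t ≤ C * Real.exp (-(Real.sqrt (muExp n β) - ε) * |t|)) ∧
      ((∃ r C : ℝ, 1 < r ∧ ∀ t : ℝ, 0 < t → t ≤ 1 → |g t - β * t| ≤ C * t ^ r) →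
        ∃ l : ℝ,
          Tendsto (fun t : ℝ => Real.exp (Real.sqrt (muExp n β) * |t|) * v t)
            (cocompact ℝ) (𝓝 l) ∧
          ((∀ t : ℝ, 0 < t → β * t ≤ g t) → 0 < l))) := by
  obtain ⟨a0, ha0, heq⟩ := hg.exists_fixed
  obtain ⟨K, M, f, hF, ha0M, hfg, hlarge⟩ := hg.exists_admissible hn ha0 heq
  have hpos : ∀ {v : ℝ → ℝ}, IsPositiveSolution n g v →
      PosSol (((n : ℝ) - 4) / 2) ((n : ℝ) / 2) f M v (iteratedDeriv 1 v) (iteratedDeriv 2 v)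
        (iteratedDeriv 3 v) := fun h => h.posSol hg hn hfg hlarge
  refine ⟨fun v hv => (hpos hv).const_or_homoclinic_or_periodic hF,
    ⟨a0, ⟨ha0, heq⟩, fun b hb hb' => hg.fixed_unique hb ha0 hb' heq, fun v hv => ?_,
      fun a ha haa0 => ?_⟩, ?_⟩
  · have h := hpos hv
    have hbdd : BddBelow (range v) := ⟨0, by rintro _ ⟨t, rfl⟩; exact (hv.2 t).le⟩
    have hconst : ∀ c, (∀ t, v t = c) → sInf (range v) = c := fun c hc => by
      rw [funext hc, range_const, csInf_singleton]
    have key : a0 ≤ sInf (range v) → ∀ t, v t = a0 := fun hle =>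
      h.eq_a0_of_ge hF fun t => hle.trans (csInf_le hbdd ⟨t, rfl⟩)
    refine ⟨?_, fun he => ⟨a0, ha0.ne', key he.ge⟩, ?_⟩
    · by_contra! hlt
      exact hlt.ne' (hconst a0 (key hlt.le))
    · rintro ⟨c, -, hc⟩
      rw [hconst c hc]
      have hc0 : 0 < c := hc 0 ▸ hv.2 0
      have hode := hv.1.2 0
      rw [funext hc] at hode
      simp only [iteratedDeriv_const, OfNat.ofNat_ne_zero, if_false] at hode
      exact hg.fixed_unique hc0 ha0 (by linarith) heq
  · obtain ⟨v, v1, v2, v3, h, h0, h1, hglb, hL⟩ := hF.exists_periodic ha haa0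
    refine ⟨v, ⟨(h.isPositiveSolution hF hfg).1, ?_, hglb⟩, fun w hw _ hwglb => ?_, hL,
      fun t ht => h.eq_of_isLocalExtr hF ht⟩
    · refine (Metric.isBounded_Icc (0 : ℝ) M).subset ?_
      rintro _ ⟨t, rfl⟩
      exact ⟨(h.pos t).le, h.le t⟩
    -- A solution with infimum a > 0 is positive, so it solves the truncated equation.
    · exact h.isTranslate_of_isGLB hF (hpos ⟨hw, fun t => ha.trans_le (hwglb.1 ⟨t, rfl⟩)⟩) ha haa0
        h0 h1 hwglb
  · obtain ⟨v, v1, v2, v3, h, h1, hneg, hl⟩ := hF.exists_homoclinic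
    obtain ⟨τ, hσ, hστ, hsum, hprod⟩ := hg.exists_exponents hn
    have heven : ∀ t, v (-t) = v t := fun t => by simpa using ((h.symm hF h1) t).1.symm
    rw [coeffA_eq] at hsum
    rw [coeffB_eq] at hprod
    have hM : 0 < M := ha0.trans_le ha0M
    have hfη : ∀ η, (((n : ℝ) - 4) / 2) ^ 2 * ((n : ℝ) / 2) ^ 2 -
        Real.sqrt (muExp n β) ^ 2 * τ ^ 2 < η → ∀ᶠ x in 𝓝[>] 0, f x ≤ η * x := fun η hη => by
      rw [hprod] at hη
      filter_upwards [hg.eventually_le_mul hη, Ioo_mem_nhdsGT hM] with x hx hx0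
      rwa [hfg x hx0.1 hx0.2.le]
    refine ⟨v, ⟨h.isPositiveSolution hF hfg, h.isGLB_zero hl⟩, fun w hw hglb =>
      h.isTranslate_of_isGLB_zero hF (hpos hw) h1 hneg hl hglb, h.homoclinicToZero hF h1 hl, heven,
      h.strictAntiOn hneg, fun ε hε => ?_, ?_⟩
    · obtain ⟨C, -, hC⟩ := h.exists_exp_bound hF heven hl hσ hστ hsum hfη hε
      exact ⟨C, hC⟩
    · rintro ⟨r, C, hr, hC⟩
      obtain ⟨l, hl0, hlim⟩ := h.exists_limit_exp_mul hF heven hl hσ hστ hsum hfη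
        (fun t => by rw [hprod, hfg _ (h.pos t) (h.le t)]; exact hg.beta_mul_le (h.pos t)) hr
        (C := C) (by
          rw [hprod]
          -- Below M the truncation equals g, and below 1 the expansion of g is available.
          filter_upwards [Ioo_mem_nhdsGT hM, Ioo_mem_nhdsGT one_pos] with x hx hx1
          rw [hfg x hx.1 hx.2.le]
          exact (le_abs_self _).trans (hC x hx1.1 hx1.2.le))
      exact ⟨l, hlim, fun _ => hl0⟩
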